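/- **Model.** When $k\in\mathbb Z_+$ agents are in the queue, a new agent arrives at Poisson rate $\lambda_k\ge 0$ ($\lambda_0>0$) and the maximal service rate is $\mu_k$, where $\mu_0=0$, $\mu_k>0$ for $k\ge1$, and $\mu$ is nondecreasing and bounded. Fix $V,C,R>0$ and $\alpha\in[0,1]$. The primitive process $(\lambda,\mu)$ is *regular* if $\mu_k-\mu_{k-1}$ is nonincreasing in $k\ge1$ and $\lambda_k-\lambda_{k-1}\le\mu_k-\mu_{k-1}$ for all $k\ge2$. An entry/exit policy $(x,y,z)$ consists of $x_k\in[0,1]$ (probability that an arriving agent joins a queue of length $k$) and, for $1\le\ell\le k$, $y_{k,\ell}\ge0$ (rate at which the agent in position $\ell$ is removed) and $z_{k,\ell}\in[0,1]$ (probability that she is removed when another agent joins), with $\sum_{\ell}z_{k,\ell}\le1$. It generates the probability distribution $p$ on $\mathbb Z_+$ if $$(B)\qquad \lambda_kx_k\Big(1-\sum_\ell z_{k,\ell}\Big)p_k=\Big(\mu_{k+1}+\sum_\ell y_{k+1,\ell}\Big)p_{k+1}\quad\text{for all }k.$$ It is a *cutoff policy* if $y=z=0$ and, for some $K\in\mathbb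 Z_+\cup\{\infty\}$, $x_k=1$ for $k\le K-2$, $x_{K-1}\in(0,1]$, and $x_k=0$ for $k\ge K$. A queueing rule $q=(q_{k,\ell})_{1\le\ell\le k}$ gives service rates $q_{k,\ell}\ge0$ with $\sum_{\ell\in S}q_{k,\ell}\le\mu_{|S|}$ for all $S\subset\{1,\dots,k\}$ and $\sum_{\ell=1}^kq_{k,\ell}=\mu_k$. FCFS is $q^*_{k,\ell}=\mu_\ell-\mu_{\ell-1}$. Given $(x,y,z,q)$, the pair (queue length, position) of an agent in the queue evolves as a continuous-time Markov chain until she is served or removed; let $\sigma_{k,\ell}$ be the probability that she is eventually served and $\tau_{k,\ell}\in[0,\infty]$ her expected remaining time in the queue, from $(k,\ell)$. Let $\bar\gamma^t$ be the distribution of $(k,\ell)$ for an agent who joined a time $t$ ago in the steady state $p$, conditional on her still being in the queue; at $t=0$ it is obtained from the steady-state entry flows $p_k\lambda_kx_k$, an entrant taking the last position. An information rule is a family $I=(I^t)_{t\ge0}$ of probability distributions over beliefs about $(k,\ell)$ such that the mean of $I^t$ is $\bar\gamma^t$ for every $t$; the *no-information rule* $I^*$ puts mass one on $\bar\gamma^t$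 at each $t$. Obedience at $t$ is $$(IC_t)\qquad \sum_{k,\ell}\gamma_{k,\ell}\,(V\sigma_{k,\ell}-C\tau_{k,\ell})\ge0\quad\text{for all }\gamma\in\operatorname{supp}(I^t).$$ (If the steady-state entry flow $\sum_kp_k\lambda_kx_k$ is zero, so that nobody ever joins, the conditions on beliefs are void.) The pair $(q,I)$ *implements* $(x,y,z,p)$ if $(IC_t)$ holds for every $t\ge0$. Let $W(p)=(1-\alpha)R\sum_kp_k\mu_k+\alpha\sum_kp_k(\mu_kV-kC)$. Problem $[P]$ is to maximize $W(p)$ over all $(p,x,y,z,q,I)$ as above subject to $(B)$ and to $(IC_t)$ for all $t\ge0$. The relaxed problem $[P']$ is to maximize $W(p)$ over probability distributions $p$ on $\mathbb Z_+$ subject to $\sum_kp_k(\mu_kV-kC)\ge0$ and $\lambda_kp_k\ge\mu_{k+1}p_{k+1}$ for all $k$. **Theorem.** Assume that the primitive process is regular. Let $x^*$ be a cutoff policy (with $y^*=z^*=0$) generating a distribution $p^*$ that solves $[P']$. Then FCFS with no information $(q^*,I^*)$ implements $(x^*,p^*)$, that is, $q^*$ is a queueing rule, $I^*$ is an information rule,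 and $(IC_t)$ holds for every $t\ge0$. Consequently $(x^*,q^*,I^*)$, with $p^*$, is an optimal solution of $[P]$. -/

import Mathlib

open MeasureTheory
open scoped ENNReal

noncomputable section

namespace QueueDesign

/-! ## Primitives -/

/-- Arrival rates `arr k`, maximal service rates `srv k` (both indexed by the queue length `k`),
the surplus `V` from service, the waiting cost `C` per unit of time, the provider's profit `R` per
served agent and the welfare weight `α`. -/
structure QueueModel where
  arr : ℕ → ℝ
  srv : ℕ → ℝ
  V : ℝ
  C : ℝ
  R : ℝ
  α : ℝ
  arr_nonneg : ∀ k, 0 ≤ arr k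
  arr_zero_pos : 0 < arr 0
  srv_zero : srv 0 = 0
  srv_pos : ∀ k, 1 ≤ k → 0 < srv k
  srv_mono : Monotone srv
  srv_bdd : BddAbove (Set.range srv)
  V_pos : 0 < V
  C_pos : 0 < C
  R_pos : 0 < R
  α_nonneg : 0 ≤ α
  α_le_one : α ≤ 1

/-- The service process is regular: `srv k - srv (k - 1)` is nonincreasing in `k ≥ 1`. -/
def QueueModel.IsRegularService (M : QueueModel) : Prop :=
  ∀ k, 1 ≤ k → M.srv (k + 1) - M.srv k ≤ M.srv k - M.srv (k - 1)

/-- The primitive process is regular. -/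
def QueueModel.IsRegular (M : QueueModel) : Prop :=
  M.IsRegularService ∧ ∀ k, 2 ≤ k → M.arr k - M.arr (k - 1) ≤ M.srv k - M.srv (k - 1)

/-! ## Entry, exit and queueing rules -/

/-- An entry/exit policy. With `k` agents in the queue, an arriving agent is asked to join with
probability `x k`; the agent in position `ℓ ∈ {1, …, k}` is removed at Poisson rate `y k ℓ`, and is
removed with probability `z k ℓ` when another agent joins. -/
structure EntryExit where
  x : ℕ → ℝ
  y : ℕ → ℕ → ℝ
  z : ℕ → ℕ → ℝ

/-- Probability that a joining agent replaces somebody, when `k` agents are already present. -/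
def EntryExit.zTot (π : EntryExit) (k : ℕ) : ℝ := ∑ ℓ ∈ Finset.Icc 1 k, π.z k ℓ

/-- Total rate of (unconditional) removals when `k` agents are present. -/
def EntryExit.yTot (π : EntryExit) (k : ℕ) : ℝ := ∑ ℓ ∈ Finset.Icc 1 k, π.y k ℓ

/-- Admissible entry/exit policies; at most one agent is removed upon an entry. -/
structure EntryExit.Feasible (π : EntryExit) : Prop where
  x_mem : ∀ k, π.x k ∈ Set.Icc (0 : ℝ) 1
  y_nonneg : ∀ k, ∀ ℓ ∈ Finset.Icc 1 k, 0 ≤ π.y k ℓ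
  z_mem : ∀ k, ∀ ℓ ∈ Finset.Icc 1 k, π.z k ℓ ∈ Set.Icc (0 : ℝ) 1
  zTot_le : ∀ k, π.zTot k ≤ 1

/-- Cutoff policy with maximal queue length `K ∈ {0, 1, …, ∞}`. -/
def EntryExit.IsCutoffAt (π : EntryExit) (K : ℕ∞) : Prop :=
  (∀ k : ℕ, (k : ℕ∞) + 2 ≤ K → π.x k = 1) ∧
  (∀ k : ℕ, (k : ℕ∞) + 1 = K → 0 < π.x k ∧ π.x k ≤ 1) ∧
  (∀ k : ℕ, K ≤ (k : ℕ∞) → π.x k = 0) ∧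
  ∀ k ℓ, π.y k ℓ = 0 ∧ π.z k ℓ = 0

/-- Cutoff policies. -/
def EntryExit.IsCutoff (π : EntryExit) : Prop := ∃ K : ℕ∞, π.IsCutoffAt K

/-- Queueing rules (`q k ℓ` is the service rate of position `ℓ ∈ {1, …, k}` in a queue of length
`k`) that are feasible and work conserving. -/
structure QueueModel.IsQueueingRule (M : QueueModel) (q : ℕ → ℕ → ℝ) : Prop where
  nonneg : ∀ k, ∀ ℓ ∈ Finset.Icc 1 k, 0 ≤ q k ℓ
  feasible : ∀ k, ∀ S ⊆ Finset.Icc 1 k, ∑ ℓ ∈ S, q k ℓ ≤ M.srv S.card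
  workConserving : ∀ k, ∑ ℓ ∈ Finset.Icc 1 k, q k ℓ = M.srv k

/-- First-come-first-served. -/
def QueueModel.fcfs (M : QueueModel) : ℕ → ℕ → ℝ := fun _ ℓ => M.srv ℓ - M.srv (ℓ - 1)

/-! ## Steady state, objective, and the relaxed problem -/

/-- Probability distributions on the queue length. -/
def IsDistribution (p : ℕ → ℝ) : Prop := (∀ k, 0 ≤ p k) ∧ HasSum p 1

/-- The balance equation: the entry/exit policy generates the invariant distribution `p`. -/
def QueueModel.Generates (M : QueueModel) (π : EntryExit) (p : ℕ → ℝ) : Prop :=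
  ∀ k, M.arr k * π.x k * (1 - π.zTot k) * p k = (M.srv (k + 1) + π.yTot (k + 1)) * p (k + 1)

/-- The designer's objective
`(1 - α) R ∑ p_k μ_k + α (V ∑ p_k μ_k - C ∑ p_k k)`; it is `-∞` when `α > 0` and the mean queue
length is infinite. -/
def QueueModel.welfare (M : QueueModel) (p : ℕ → ℝ) : EReal :=
  (((1 - M.α) * M.R * ∑' k, p k * M.srv k + M.α * (M.V * ∑' k, p k * M.srv k) : ℝ) : EReal)
    - ((ENNReal.ofReal (M.α * M.C) * ∑' k : ℕ, ENNReal.ofReal (p k * k) : ℝ≥0∞) : EReal)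

/-- Feasible points of the relaxed problem. As `μ` is bounded, the series in the individual
rationality constraint is either absolutely convergent or equal to `-∞`; the latter is excluded. -/
structure QueueModel.RelaxedFeasible (M : QueueModel) (p : ℕ → ℝ) : Prop where
  dist : IsDistribution p
  ir_summable : Summable fun k : ℕ => p k * (M.srv k * M.V - k * M.C)
  ir : 0 ≤ ∑' k : ℕ, p k * (M.srv k * M.V - k * M.C)
  balance : ∀ k, 0 ≤ M.arr k * p k - M.srv (k + 1) * p (k + 1)

/-- Optimal solutions of the relaxed problem. -/
def QueueModel.RelaxedOptimal (M : QueueModel) (p : ℕ → ℝ) : Prop :=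
  M.RelaxedFeasible p ∧ ∀ p', M.RelaxedFeasible p' → M.welfare p' ≤ M.welfare p

/-! ## Continuous-time Markov chains -/

section Chain

variable {S : Type*}

open Classical in
/-- Probability that the chain with jump rates `Q` (and finite total exit rates), started at `s`,
is in state `s'` at time `t` after fewer than `n` jumps (first-jump decomposition). -/
def transIter (Q : S → S → ℝ≥0∞) : ℕ → ℝ → S → S → ℝ≥0∞
  | 0 => fun _ _ _ => 0
  | n + 1 => fun t s s' =>
      (if s = s' then ENNReal.ofReal (Real.exp (-(∑' w, Q s w).toReal * t)) else 0)
      + ∫⁻ u in Set.Ioc 0 t, ENNReal.ofReal (Real.exp (-(∑' w, Q s w).toReal * u))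
          * ∑' w, Q s w * transIter Q n (t - u) w s'

/-- Transition probabilities of the (minimal) chain with jump rates `Q`. -/
def transProb (Q : S → S → ℝ≥0∞) (t : ℝ) (s s' : S) : ℝ≥0∞ := ⨆ n, transIter Q n t s s'

end Chain

/-! ## The life of an agent in the queue -/

/-- Status of an agent who joined: waiting in a queue of length `k` at position `ℓ`, already
served, or removed without service. -/
inductive AgentState where
  | waiting (k ℓ : ℕ) : AgentState
  | served : AgentState
  | removed : AgentState

open Classical in
/-- Jump rates of the status of an agent. In state `(k, ℓ)`, `1 ≤ ℓ ≤ k`: the agent is served, or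
is removed (at rate `y`, or because somebody joins), an agent ahead (resp. behind) leaves, an agent
ahead is replaced by a joining one, or an agent joins and nobody is removed. (If an agent behind is
replaced, the state does not change.) -/
def QueueModel.jumpRate (M : QueueModel) (π : EntryExit) (q : ℕ → ℕ → ℝ) :
    AgentState → AgentState → ℝ≥0∞
  | .waiting k ℓ, w =>
      if 1 ≤ ℓ ∧ ℓ ≤ k then
        (if w = .served then ENNReal.ofReal (q k ℓ) else 0)
        + (if w = .removed then ENNReal.ofReal (π.y k ℓ + M.arr k * π.x k * π.z k ℓ) else 0)
        + (if w = .waiting (k - 1) (ℓ - 1) then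
            ENNReal.ofReal (∑ j ∈ Finset.Ico 1 ℓ, (q k j + π.y k j)) else 0)
        + (if w = .waiting (k - 1) ℓ then
            ENNReal.ofReal (∑ j ∈ Finset.Ioc ℓ k, (q k j + π.y k j)) else 0)
        + (if w = .waiting k (ℓ - 1) then
            ENNReal.ofReal (M.arr k * π.x k * ∑ j ∈ Finset.Ico 1 ℓ, π.z k j) else 0)
        + (if w = .waiting (k + 1) ℓ then
            ENNReal.ofReal (M.arr k * π.x k * (1 - π.zTot k)) else 0)
      else 0
  | .served, _ => 0
  | .removed, _ => 0

/-- Transition probabilities of the status of an agent. -/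
def QueueModel.agentProb (M : QueueModel) (π : EntryExit) (q : ℕ → ℕ → ℝ) (t : ℝ)
    (s s' : AgentState) : ℝ≥0∞ :=
  transProb (M.jumpRate π q) t s s'

/-- Probability that an agent in state `(k, ℓ)` is eventually served. -/
def QueueModel.serviceProb (M : QueueModel) (π : EntryExit) (q : ℕ → ℕ → ℝ) (s : ℕ × ℕ) : ℝ≥0∞ :=
  ⨆ t : Set.Ici (0 : ℝ), M.agentProb π q t (.waiting s.1 s.2) .served

/-- Expected residual time that an agent in state `(k, ℓ)` spends in the queue: the integral over
`t` of the probability of being still in the queue after a further time `t`. -/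
def QueueModel.waitTime (M : QueueModel) (π : EntryExit) (q : ℕ → ℕ → ℝ) (s : ℕ × ℕ) : ℝ≥0∞ :=
  ∫⁻ t in Set.Ici (0 : ℝ),
    ∑' s' : ℕ × ℕ, M.agentProb π q t (.waiting s.1 s.2) (.waiting s'.1 s'.2)

/-! ## Beliefs -/

/-- Flow of agents who join the queue. -/
def QueueModel.entryRate (M : QueueModel) (π : EntryExit) (p : ℕ → ℝ) : ℝ≥0∞ :=
  ∑' k, ENNReal.ofReal (p k * M.arr k * π.x k)

/-- Belief about `(k, ℓ)` of an agent who just joined and knows only this: an entrant who finds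
`k` agents becomes number `k + 1` of `k + 1`, or number `k` of `k` if somebody is replaced. -/
def QueueModel.entryBelief (M : QueueModel) (π : EntryExit) (p : ℕ → ℝ) (s : ℕ × ℕ) : ℝ≥0∞ :=
  (if 1 ≤ s.1 ∧ s.2 = s.1 then
    ENNReal.ofReal (p (s.1 - 1) * M.arr (s.1 - 1) * π.x (s.1 - 1) * (1 - π.zTot (s.1 - 1)))
    + ENNReal.ofReal (p s.1 * M.arr s.1 * π.x s.1 * π.zTot s.1)
  else 0) / M.entryRate π p

/-- Probability that an agent who joined a time `t` ago is still in the queue, in state `s`. -/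
def QueueModel.stayMass (M : QueueModel) (π : EntryExit) (q : ℕ → ℕ → ℝ) (p : ℕ → ℝ) (t : ℝ)
    (s : ℕ × ℕ) : ℝ≥0∞ :=
  ∑' s₀ : ℕ × ℕ,
    M.entryBelief π p s₀ * M.agentProb π q t (.waiting s₀.1 s₀.2) (.waiting s.1 s.2)

/-- Bayesian belief about `(k, ℓ)` of an agent who knows only that she joined a time `t` ago and
is still in the queue. -/
def QueueModel.noInfoBelief (M : QueueModel) (π : EntryExit) (q : ℕ → ℕ → ℝ) (p : ℕ → ℝ) (t : ℝ)
    (s : ℕ × ℕ) : ℝ≥0∞ :=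
  M.stayMass π q p t s / ∑' s', M.stayMass π q p t s'

/-! ## Information rules and obedience -/

/-- An information rule: for each time `t ≥ 0` spent in the queue, a distribution of posterior
beliefs about `(k, ℓ)`. -/
abbrev InfoRule : Type := ℝ → ProbabilityMeasure (ProbabilityMeasure (ℕ × ℕ))

/-- Consistency with Bayes' rule: at each `t`, the posteriors average to the belief of an agent who
is still in the queue. (Void if no agent ever joins.) -/
def QueueModel.IsInfoRule (M : QueueModel) (π : EntryExit) (q : ℕ → ℕ → ℝ) (p : ℕ → ℝ)
    (I : InfoRule) : Prop :=
  M.entryRate π p ≠ 0 → ∀ t, 0 ≤ t → ∀ s : ℕ × ℕ,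
    ∫⁻ γ : ProbabilityMeasure (ℕ × ℕ), (γ : Measure (ℕ × ℕ)) {s}
      ∂(I t : Measure (ProbabilityMeasure (ℕ × ℕ))) = M.noInfoBelief π q p t s

/-- The no-information rule: at each `t`, the posterior is surely the belief of an agent who knows
only that she is still in the queue. (Void if no agent ever joins.) -/
def QueueModel.IsNoInfo (M : QueueModel) (π : EntryExit) (q : ℕ → ℕ → ℝ) (p : ℕ → ℝ)
    (I : InfoRule) : Prop :=
  M.entryRate π p ≠ 0 → ∀ t, 0 ≤ t → ∃ γ : ProbabilityMeasure (ℕ × ℕ),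
    (∀ s : ℕ × ℕ, (γ : Measure (ℕ × ℕ)) {s} = M.noInfoBelief π q p t s) ∧
    (I t : Measure (ProbabilityMeasure (ℕ × ℕ))) = Measure.dirac γ

/-- The obedience constraint at time `t`: `∑ γ_{k,ℓ} (V σ_{k,ℓ} - C τ_{k,ℓ}) ≥ 0` for every
posterior `γ` in the support of `I t`. (Void if no agent ever joins.) -/
def QueueModel.ObedientAt (M : QueueModel) (π : EntryExit) (q : ℕ → ℕ → ℝ) (p : ℕ → ℝ)
    (I : InfoRule) (t : ℝ) : Prop :=
  M.entryRate π p ≠ 0 →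
    ∀ γ ∈ (I t : Measure (ProbabilityMeasure (ℕ × ℕ))).support,
      ∑' s : ℕ × ℕ, (γ : Measure (ℕ × ℕ)) {s} * (ENNReal.ofReal M.C * M.waitTime π q s)
        ≤ ∑' s : ℕ × ℕ, (γ : Measure (ℕ × ℕ)) {s} * (ENNReal.ofReal M.V * M.serviceProb π q s)

/-- Feasible points of the designer's problem. -/
structure QueueModel.DesignFeasible (M : QueueModel) (p : ℕ → ℝ) (π : EntryExit)
    (q : ℕ → ℕ → ℝ) (I : InfoRule) : Prop where
  dist : IsDistribution p
  entryExit : π.Feasible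
  queueing : M.IsQueueingRule q
  info : M.IsInfoRule π q p I
  balance : M.Generates π p
  obedience : ∀ t, 0 ≤ t → M.ObedientAt π q p I t

/-- Optimal solutions of the designer's problem. -/
def QueueModel.DesignOptimal (M : QueueModel) (p : ℕ → ℝ) (π : EntryExit)
    (q : ℕ → ℕ → ℝ) (I : InfoRule) : Prop :=
  M.DesignFeasible p π q I ∧
    ∀ p' π' q' I', M.DesignFeasible p' π' q' I' → M.welfare p' ≤ M.welfare p

end QueueDesign

end

/-! Two halves: every feasible design has a distribution feasible for the relaxed problem, and FCFS
without information attains the relaxed optimum.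

Upper bound. Obedience at time 0, averaged over posteriors (`lintegral_le_of_support`), says that
for a typical entrant the mean waiting cost is at most the mean value of service. Multiplied by the
entry flow, this becomes a statement about stocks: Little's law turns the waiting cost into `C`
times the mean queue length, and the flow of agents eventually served is at most the flow of
services. This is `QueueModel.DesignFeasible.waitingCost_le`. Little's law for arbitrary exit and
queueing rules rests on `occupation_waiting`: the expected occupation of state `(k, ℓ)` by
immigrants is `p k`. The occupation measure is the least solution of the stationary forward
equation, and `p` is another solution. The gap between them would be a stationary population that
nobody ever entered; `eq_zero_of_flow_balance` excludes it, since such a population would force a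
harmonic series to converge.

Obedience. Under FCFS without exit the position is an autonomous chain: from `ℓ` it moves to `ℓ - 1`
at rate `srv (ℓ - 1)` and service occurs at rate `srv ℓ - srv (ℓ - 1)`. Everybody is served, and the
mean remaining wait is at most `ℓ / srv ℓ`, which is nondecreasing in `ℓ` by concavity of `srv`. By
the balance equation, the entry flow into position `j` is `p j * srv j`, so obedience at time 0 is
the rationality constraint of the relaxed problem.

To go to later times, uniformize at a rate `B` above all service rates. One step multiplies the mass
`W j` by `g j = 1 + u j / B`, where `u j = srv j * (r j - 1)` and `W (j + 1) = r j * W j`. If `u` is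
nonincreasing, so is `g`: mass shifts to the front, where `V - C * j / srv j` is larger, and a
nonnegative mean stays nonnegative. Monotonicity of `u` is itself preserved by the step
(`IsImproving.step`). Initially `u j` is the drift of the queue length at `j`, nonincreasing by
regularity and the cutoff form. The mass at time `t` is a Poisson mixture of the step masses, so
obedience holds at every `t`. -/

set_option linter.unusedSectionVars false

noncomputable section

namespace QueueDesign

/-! ### Exponential holding times and convolutions -/

section Laplace

theorem measurable_lintegral_Ioc {F : ℝ × ℝ → ℝ≥0∞} (hF : Measurable F) :
    Measurable fun t : ℝ => ∫⁻ u in Set.Ioc 0 t, F (t, u) := by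
  have h : (fun t : ℝ => ∫⁻ u in Set.Ioc 0 t, F (t, u)) =
      fun t : ℝ => ∫⁻ u, ({p : ℝ × ℝ | 0 < p.2 ∧ p.2 ≤ p.1}.indicator F) (t, u) := by
    funext t
    rw [← lintegral_indicator measurableSet_Ioc]
    rfl
  rw [h]
  refine Measurable.lintegral_prod_right' (hF.indicator ?_)
  exact (measurableSet_lt measurable_const measurable_snd).inter
    (measurableSet_le measurable_snd measurable_fst)

/-- Tonelli and translation invariance, after extending `f` and `g` by zero to the line. The
endpoint 0 is a null set, so the half-open and closed ranges agree. -/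
theorem lintegral_convolution {f g : ℝ → ℝ≥0∞} (hf : Measurable f) (hg : Measurable g) :
    ∫⁻ t in Set.Ici (0 : ℝ), ∫⁻ u in Set.Ioc 0 t, f u * g (t - u)
      = (∫⁻ u in Set.Ici (0 : ℝ), f u) * ∫⁻ t in Set.Ici (0 : ℝ), g t := by
  have h1 : ∫⁻ t in Set.Ici (0 : ℝ), ∫⁻ u in Set.Ioc 0 t, f u * g (t - u)
      = ∫⁻ t, ∫⁻ u, (Set.Ioi (0 : ℝ)).indicator f u * (Set.Ici (0 : ℝ)).indicator g (t - u) := by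
    rw [← lintegral_indicator measurableSet_Ici]
    refine lintegral_congr fun t => ?_
    have h2 : (fun u => (Set.Ioi (0 : ℝ)).indicator f u * (Set.Ici (0 : ℝ)).indicator g (t - u))
        = (Set.Ioc 0 t).indicator fun u => f u * g (t - u) := by
      funext u
      by_cases h : 0 < u <;> by_cases h' : u ≤ t <;> simp [Set.indicator, h, h']
    rw [h2, lintegral_indicator measurableSet_Ioc]
    by_cases ht : 0 ≤ t
    · simp [Set.indicator, ht]
    · simp [Set.indicator, ht, Set.Ioc_eq_empty (fun h => ht h.le)]
  have hf' : Measurable ((Set.Ioi (0 : ℝ)).indicator f) := hf.indicator measurableSet_Ioi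
  have hg' : Measurable ((Set.Ici (0 : ℝ)).indicator g) := hg.indicator measurableSet_Ici
  rw [h1, lintegral_lintegral_swap]
  · have h3 : ∀ u, ∫⁻ t, (Set.Ioi (0 : ℝ)).indicator f u * (Set.Ici (0 : ℝ)).indicator g (t - u)
        = (Set.Ioi (0 : ℝ)).indicator f u * ∫⁻ t in Set.Ici (0 : ℝ), g t := by
      intro u
      rw [lintegral_const_mul _ ((show Measurable fun t => (Set.Ici (0 : ℝ)).indicator g (t - u) from
        hg'.comp (measurable_id.sub_const u))),
        lintegral_sub_right_eq_self ((Set.Ici (0 : ℝ)).indicator g) u,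
        lintegral_indicator measurableSet_Ici]
    simp_rw [h3]
    rw [lintegral_mul_const _ hf', lintegral_indicator measurableSet_Ioi,
      setLIntegral_congr Ioi_ae_eq_Ici]
  · exact ((hf'.comp measurable_snd).mul
      (hg'.comp (measurable_fst.sub measurable_snd))).aemeasurable

/-- An exponential clock rings either before `t` or after. The case `c = 0` is included, so that
absorbing states need no separate treatment. -/
theorem lintegral_Ioc_exp {c t : ℝ} (hc : 0 ≤ c) (ht : 0 ≤ t) :
    ENNReal.ofReal c * (∫⁻ u in Set.Ioc 0 t, ENNReal.ofReal (Real.exp (-c * u)))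
      + ENNReal.ofReal (Real.exp (-c * t)) = 1 := by
  have h0 : ∀ u, HasDerivAt (fun u => -Real.exp (-c * u)) (c * Real.exp (-c * u)) u := by
    intro u
    refine (((hasDerivAt_id' u).const_mul (-c)).exp.neg).congr_deriv ?_
    ring
  have hcont : Continuous fun u => c * Real.exp (-c * u) := by fun_prop
  have h1 : ∫ u in (0:ℝ)..t, c * Real.exp (-c * u) = 1 - Real.exp (-c * t) := by
    rw [intervalIntegral.integral_eq_sub_of_hasDerivAt (fun u _ => h0 u)
      (hcont.intervalIntegrable _ _)]
    simp; ring
  rw [intervalIntegral.integral_of_le ht] at h1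
  have h2 : ENNReal.ofReal c * ∫⁻ u in Set.Ioc 0 t, ENNReal.ofReal (Real.exp (-c * u))
      = ENNReal.ofReal (1 - Real.exp (-c * t)) := by
    rw [← h1, ofReal_integral_eq_lintegral_ofReal
      ((hcont.integrableOn_Icc).mono_set Set.Ioc_subset_Icc_self)
      (Filter.Eventually.of_forall fun u => by positivity)]
    rw [← lintegral_const_mul _ (by fun_prop)]
    simp_rw [ENNReal.ofReal_mul hc]
  rw [h2, ← ENNReal.ofReal_add _ (by positivity)]
  · simp
  · have : Real.exp (-c * t) ≤ 1 := Real.exp_le_one_iff.2 (by nlinarith)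
    linarith

theorem lintegral_Ioc_exp_le {c t : ℝ} (hc : 0 ≤ c) :
    ENNReal.ofReal c * ∫⁻ u in Set.Ioc 0 t, ENNReal.ofReal (Real.exp (-c * u)) ≤ 1 := by
  by_cases ht : 0 ≤ t
  · exact le_of_le_of_eq le_self_add (lintegral_Ioc_exp hc ht)
  · simp [Set.Ioc_eq_empty (fun h : (0:ℝ) < t => ht h.le)]

theorem lintegral_Ici_exp {c : ℝ} (hc : 0 < c) :
    ENNReal.ofReal c * ∫⁻ u in Set.Ici (0:ℝ), ENNReal.ofReal (Real.exp (-c * u)) = 1 := by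
  rw [← setLIntegral_congr Ioi_ae_eq_Ici, ← ofReal_integral_eq_lintegral_ofReal
    (exp_neg_integrableOn_Ioi 0 hc) (Filter.Eventually.of_forall fun u => by positivity),
    integral_exp_mul_Ioi (by linarith), ← ENNReal.ofReal_mul hc.le]
  simp [hc.ne']

end Laplace

/-! ### The first-jump decomposition and the backward equation -/

section Chain

variable {S : Type*}

/-- Total jump rate out of a state. -/
def exitRate (Q : S → S → ℝ≥0∞) (s : S) : ℝ≥0∞ := ∑' w, Q s w

/-- Expectation of `φ` at time `t`, on the event of fewer than `n` jumps. -/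
def transMean (Q : S → S → ℝ≥0∞) (φ : S → ℝ≥0∞) (n : ℕ) (t : ℝ) (s : S) : ℝ≥0∞ :=
  ∑' s', transIter Q n t s s' * φ s'

/-- Expected integral of `φ` along the path of the chain, up to the `n`-th jump. -/
def potentialIter (Q : S → S → ℝ≥0∞) (φ : S → ℝ≥0∞) (n : ℕ) (s : S) : ℝ≥0∞ :=
  ∫⁻ t in Set.Ici (0 : ℝ), transMean Q φ n t s

variable [Countable S] (Q : S → S → ℝ≥0∞)

theorem measurable_transIter (n : ℕ) (s s' : S) : Measurable fun t => transIter Q n t s s' := by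
  induction n generalizing s s' with
  | zero => exact measurable_const
  | succ n ih =>
    simp only [transIter]
    refine Measurable.add ?_ ?_
    · by_cases h : s = s'
      · simp only [h, if_true]; fun_prop
      · simp only [h, if_false]; fun_prop
    · refine measurable_lintegral_Ioc (F := fun p => ENNReal.ofReal
        (Real.exp (-(∑' w, Q s w).toReal * p.2)) * ∑' w, Q s w * transIter Q n (p.1 - p.2) w s') ?_
      refine Measurable.mul (by fun_prop) (Measurable.tsum fun w => ?_)
      exact ((ih w s').comp (measurable_fst.sub measurable_snd)).const_mul _

@[fun_prop]
theorem measurable_transMean (φ : S → ℝ≥0∞) (n : ℕ) (s : S) :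
    Measurable fun t => transMean Q φ n t s :=
  Measurable.tsum fun w => (measurable_transIter Q n s w).mul_const _

@[simp]
theorem transMean_zero (φ : S → ℝ≥0∞) (t : ℝ) (s : S) : transMean Q φ 0 t s = 0 := by
  simp [transMean, transIter]

/-- The first-jump recursion is linear in the final state, so it can be summed against `φ` by
Tonelli. -/
theorem transMean_succ (φ : S → ℝ≥0∞) (n : ℕ) (t : ℝ) (s : S) :
    transMean Q φ (n + 1) t s = ENNReal.ofReal (Real.exp (-(exitRate Q s).toReal * t)) * φ s
      + ∫⁻ u in Set.Ioc 0 t, ENNReal.ofReal (Real.exp (-(exitRate Q s).toReal * u))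
          * ∑' w, Q s w * transMean Q φ n (t - u) w := by
  classical
  have hm : ∀ s' w, Measurable fun u => transIter Q n (t - u) w s' := fun s' w =>
    (measurable_transIter Q n w s').comp (measurable_const.sub measurable_id)
  have hm' : ∀ s', Measurable fun u => ENNReal.ofReal (Real.exp (-(exitRate Q s).toReal * u))
          * ∑' w, Q s w * transIter Q n (t - u) w s' := fun s' =>
    Measurable.mul (by fun_prop) (Measurable.tsum fun w => (hm s' w).const_mul _)
  simp only [transMean, transIter, add_mul, ENNReal.tsum_add]
  congr 1
  · rw [tsum_eq_single s]
    · simp [exitRate]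
    · intro b hb; simp [hb.symm]
  · have h1 : ∀ s', (∫⁻ u in Set.Ioc 0 t, ENNReal.ofReal (Real.exp (-(exitRate Q s).toReal * u))
          * ∑' w, Q s w * transIter Q n (t - u) w s') * φ s'
        = ∫⁻ u in Set.Ioc 0 t, ENNReal.ofReal (Real.exp (-(exitRate Q s).toReal * u))
          * (∑' w, Q s w * transIter Q n (t - u) w s') * φ s' := fun s' => by
      rw [lintegral_mul_const _ (hm' s')]
    change ∑' s', (∫⁻ u in Set.Ioc 0 t, ENNReal.ofReal (Real.exp (-(exitRate Q s).toReal * u))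
          * ∑' w, Q s w * transIter Q n (t - u) w s') * φ s' = _
    simp_rw [h1]
    rw [← lintegral_tsum fun s' => ((hm' s').mul_const _).aemeasurable]
    refine lintegral_congr fun u => ?_
    simp_rw [mul_assoc, ENNReal.tsum_mul_left]
    congr 1
    simp_rw [← ENNReal.tsum_mul_left, ← ENNReal.tsum_mul_right]
    rw [ENNReal.tsum_comm]
    simp_rw [mul_assoc]

theorem transIter_le_succ (n : ℕ) (t : ℝ) (s s' : S) :
    transIter Q n t s s' ≤ transIter Q (n + 1) t s s' := by
  induction n generalizing t s s' with
  | zero => exact zero_le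
  | succ n ih =>
    rw [transIter, transIter]
    refine add_le_add le_rfl (lintegral_mono fun u => ?_)
    gcongr
    exact ih _ _ _

theorem transIter_mono (t : ℝ) (s s' : S) : Monotone fun n => transIter Q n t s s' :=
  monotone_nat_of_le_succ fun n => transIter_le_succ Q n t s s'

theorem transMean_mono (φ : S → ℝ≥0∞) (t : ℝ) (s : S) : Monotone fun n => transMean Q φ n t s :=
  fun _ _ h => ENNReal.tsum_le_tsum fun w => mul_le_mul_left (transIter_mono Q t s w h) _

/-- Monotone convergence for the counting measure. With the discrete σ-algebra measurability is
automatic. -/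
theorem tsum_iSup_of_monotone {ι : Type*} {f : ℕ → ι → ℝ≥0∞} (hf : ∀ i, Monotone fun n => f n i) :
    ∑' i, ⨆ n, f n i = ⨆ n, ∑' i, f n i := by
  let _ : MeasurableSpace ι := ⊤
  simp_rw [← lintegral_count]
  exact lintegral_iSup (fun n => measurable_from_top) (fun a b h i => hf i h)

theorem tsum_transProb_mul (φ : S → ℝ≥0∞) (t : ℝ) (s : S) :
    ∑' s', transProb Q t s s' * φ s' = ⨆ n, transMean Q φ n t s := by
  simp only [transProb, transMean, ENNReal.iSup_mul]
  exact tsum_iSup_of_monotone fun i _ _ h => mul_le_mul_left (transIter_mono Q t s i h) _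

theorem lintegral_transProb (φ : S → ℝ≥0∞) (s : S) :
    ∫⁻ t in Set.Ici (0 : ℝ), ∑' s', transProb Q t s s' * φ s' = ⨆ n, potentialIter Q φ n s := by
  simp_rw [tsum_transProb_mul]
  exact lintegral_iSup (fun n => measurable_transMean Q φ n s)
    fun _ _ h t => transMean_mono Q φ t s h

theorem potentialIter_mono (φ : S → ℝ≥0∞) (s : S) : Monotone fun n => potentialIter Q φ n s :=
  fun _ _ h => lintegral_mono fun t => transMean_mono Q φ t s h

theorem transIter_absorbing {s : S} (hs : exitRate Q s = 0) {s' : S} (h : s ≠ s') (n : ℕ) (t : ℝ) :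
    transIter Q n t s s' = 0 := by
  have hQ : ∀ w, Q s w = 0 := by simpa [exitRate] using hs
  cases n <;> simp [transIter, h, hQ]

theorem transProb_time_zero (s s' : S) [Decidable (s = s')] :
    transProb Q 0 s s' = if s = s' then 1 else 0 := by
  refine le_antisymm (iSup_le fun n => ?_) (le_trans ?_ (le_iSup _ 1))
  · cases n <;> simp [transIter]
  · simp [transIter]

theorem potentialIter_zero (φ : S → ℝ≥0∞) (s : S) : potentialIter Q φ 0 s = 0 := by
  simp [potentialIter]

/-- Integrating the first-jump recursion over time turns the convolution into a product, and the
exponential holding time integrates to the inverse of the exit rate. -/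
theorem potentialIter_succ {s : S} (h0 : exitRate Q s ≠ 0) (h1 : exitRate Q s ≠ ∞)
    (φ : S → ℝ≥0∞) (n : ℕ) :
    exitRate Q s * potentialIter Q φ (n + 1) s = φ s + ∑' w, Q s w * potentialIter Q φ n w := by
  have hm : Measurable fun t => ∑' w, Q s w * transMean Q φ n t w :=
    Measurable.tsum fun w => (measurable_transMean Q φ n w).const_mul _
  have hq : exitRate Q s = ENNReal.ofReal (exitRate Q s).toReal := (ENNReal.ofReal_toReal h1).symm
  have he := lintegral_Ici_exp (ENNReal.toReal_pos h0 h1)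
  rw [← hq] at he
  simp only [potentialIter, transMean_succ]
  rw [lintegral_add_left (by fun_prop), lintegral_mul_const _ (by fun_prop),
    lintegral_convolution (by fun_prop) hm, mul_add, ← mul_assoc, ← mul_assoc, he, one_mul, one_mul,
    lintegral_tsum fun w => ((measurable_transMean Q φ n w).const_mul _).aemeasurable]
  simp_rw [lintegral_const_mul _ (measurable_transMean Q φ n _)]

/-- A function dominating its one-jump average dominates absorption probabilities. -/
theorem transProb_le_of_superharmonic {a : S} (ha : exitRate Q a = 0) {h : S → ℝ≥0∞} (h1 : 1 ≤ h a)
    (hfin : ∀ s, exitRate Q s ≠ ∞)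
    (hh : ∀ s, ∑' w, Q s w * h w ≤ exitRate Q s * h s) (t : ℝ) (s : S) :
    transProb Q t s a ≤ h s := by
  by_cases hs : s = a
  · subst hs
    refine le_trans (iSup_le fun n => ?_) h1
    have hQ : ∀ w, Q s w = 0 := by simpa [exitRate] using ha
    cases n <;> simp [transIter, hQ]
  refine iSup_le fun n => ?_
  have key : ∀ n t s, s ≠ a → transIter Q n t s a ≤ h s := by
    intro n
    induction n with
    | zero => intros; exact zero_le
    | succ n ih =>
      intro t s hs
      have ih' : ∀ t w, transIter Q n t w a ≤ h w := by
        intro t w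
        by_cases hw : w = a
        · subst hw
          refine le_trans ?_ h1
          have hQ : ∀ w', Q w w' = 0 := by simpa [exitRate] using ha
          cases n with
          | zero => simp [transIter]
          | succ n =>
            by_cases ht : 0 ≤ t
            · simp [transIter, hQ]
            · simp [transIter, hQ]
        · exact ih t w hw
      simp only [transIter, hs, if_false, zero_add]
      calc ∫⁻ u in Set.Ioc 0 t, ENNReal.ofReal (Real.exp (-(∑' w, Q s w).toReal * u))
            * ∑' w, Q s w * transIter Q n (t - u) w a
          ≤ ∫⁻ u in Set.Ioc 0 t, ENNReal.ofReal (Real.exp (-(∑' w, Q s w).toReal * u))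
            * (exitRate Q s * h s) := by
            gcongr with u
            refine le_trans ?_ (hh s)
            gcongr
            exact ih' _ _
        _ = (exitRate Q s * ∫⁻ u in Set.Ioc 0 t,
              ENNReal.ofReal (Real.exp (-(exitRate Q s).toReal * u))) * h s := by
            rw [lintegral_mul_const _ (by fun_prop), exitRate]; ring
        -- The probability that the first jump occurs before `t` is at most one.
        _ ≤ 1 * h s := by
            gcongr
            have := lintegral_Ioc_exp_le (t := t) (ENNReal.toReal_nonneg (a := exitRate Q s))
            rwa [ENNReal.ofReal_toReal (hfin s)] at this
        _ = h s := one_mul _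
  exact key n t s hs

/-- With bounded jump rates, the backward equation has a unique bounded solution. -/
theorem tsum_transProb_eq_of_backward {B : ℝ} (hB : 0 < B)
    (hQB : ∀ s, exitRate Q s ≤ ENNReal.ofReal B) (φ : S → ℝ≥0∞) {ψ : ℝ → S → ℝ≥0∞} {m : ℝ≥0∞}
    (hm : m ≠ ∞) (hψm : ∀ t s, 0 ≤ t → ψ t s ≤ m)
    (hψ : ∀ t s, 0 ≤ t → ψ t s = ENNReal.ofReal (Real.exp (-(exitRate Q s).toReal * t)) * φ s
      + ∫⁻ u in Set.Ioc 0 t, ENNReal.ofReal (Real.exp (-(exitRate Q s).toReal * u))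
          * ∑' w, Q s w * ψ (t - u) w) {t : ℝ} (ht : 0 ≤ t) (s : S) :
    ∑' s', transProb Q t s s' * φ s' = ψ t s := by
  rw [tsum_transProb_mul]
  refine le_antisymm (iSup_le fun n => ?_) ?_
  · induction n generalizing t s with
    | zero => simp
    | succ n ih =>
      rw [transMean_succ, hψ t s ht]
      refine add_le_add le_rfl ?_
      refine setLIntegral_mono' measurableSet_Ioc fun u hu => ?_
      gcongr with w
      exact ih (sub_nonneg.2 hu.2) w
  -- The backward operator contracts by one half in the norm weighted by `exp (2 * B * t)`, because
  -- `B` times the integral of `exp (-(2 * B) * u)` is at most `1 / 2`. Hence the bounded solution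
  -- exceeds the `n`-jump approximation by a vanishing amount.
  · have key : ∀ n t s, 0 ≤ t → ψ t s ≤ transMean Q φ n t s
        + m * (2⁻¹ ^ n * ENNReal.ofReal (Real.exp (2 * B * t))) := by
      intro n
      induction n with
      | zero =>
        intro t s ht
        refine (hψm t s ht).trans ?_
        simp only [transMean_zero, pow_zero, one_mul, zero_add]
        refine le_mul_of_one_le_right' ?_
        rw [← ENNReal.ofReal_one]
        exact ENNReal.ofReal_le_ofReal (Real.one_le_exp (by positivity))
      | succ n ih =>
        intro t s ht
        rw [hψ t s ht, transMean_succ, add_assoc]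
        refine add_le_add le_rfl ?_
        have hexp : ∀ u : ℝ, ENNReal.ofReal (Real.exp (2 * B * (t - u)))
            = ENNReal.ofReal (Real.exp (2 * B * t)) * ENNReal.ofReal (Real.exp (-(2 * B) * u)) := by
          intro u
          rw [← ENNReal.ofReal_mul (by positivity), ← Real.exp_add]
          congr 2; ring
        calc ∫⁻ u in Set.Ioc 0 t, ENNReal.ofReal (Real.exp (-(exitRate Q s).toReal * u))
              * ∑' w, Q s w * ψ (t - u) w
            ≤ ∫⁻ u in Set.Ioc 0 t, (ENNReal.ofReal (Real.exp (-(exitRate Q s).toReal * u))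
              * ∑' w, Q s w * transMean Q φ n (t - u) w
              + m * 2⁻¹ ^ n * ENNReal.ofReal (Real.exp (2 * B * t)) * ENNReal.ofReal B
                * ENNReal.ofReal (Real.exp (-(2 * B) * u))) := by
              refine setLIntegral_mono' measurableSet_Ioc fun u hu => ?_
              calc _ ≤ ENNReal.ofReal (Real.exp (-(exitRate Q s).toReal * u))
                    * ∑' w, Q s w * (transMean Q φ n (t - u) w
                      + m * (2⁻¹ ^ n * ENNReal.ofReal (Real.exp (2 * B * (t - u))))) := by
                    gcongr with w
                    exact ih _ _ (sub_nonneg.2 hu.2)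
                _ = ENNReal.ofReal (Real.exp (-(exitRate Q s).toReal * u))
                      * ∑' w, Q s w * transMean Q φ n (t - u) w
                    + ENNReal.ofReal (Real.exp (-(exitRate Q s).toReal * u)) * (exitRate Q s
                      * (m * (2⁻¹ ^ n * ENNReal.ofReal (Real.exp (2 * B * (t - u)))))) := by
                    simp_rw [mul_add, ENNReal.tsum_add, ENNReal.tsum_mul_right, mul_add]
                    rfl
                _ ≤ ENNReal.ofReal (Real.exp (-(exitRate Q s).toReal * u))
                      * ∑' w, Q s w * transMean Q φ n (t - u) w
                    + 1 * (ENNReal.ofReal B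
                      * (m * (2⁻¹ ^ n * ENNReal.ofReal (Real.exp (2 * B * (t - u)))))) := by
                    gcongr
                    · rw [← ENNReal.ofReal_one]
                      refine ENNReal.ofReal_le_ofReal (Real.exp_le_one_iff.2 ?_)
                      have := ENNReal.toReal_nonneg (a := exitRate Q s)
                      nlinarith [hu.1]
                    · exact hQB s
                _ = _ := by rw [hexp u]; ring
          _ = (∫⁻ u in Set.Ioc 0 t, ENNReal.ofReal (Real.exp (-(exitRate Q s).toReal * u))
              * ∑' w, Q s w * transMean Q φ n (t - u) w)
              + m * 2⁻¹ ^ n * ENNReal.ofReal (Real.exp (2 * B * t)) * (ENNReal.ofReal B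
                * ∫⁻ u in Set.Ioc 0 t, ENNReal.ofReal (Real.exp (-(2 * B) * u))) := by
              rw [lintegral_add_right _ (by fun_prop), lintegral_const_mul _ (by fun_prop)]
              ring
          _ ≤ (∫⁻ u in Set.Ioc 0 t, ENNReal.ofReal (Real.exp (-(exitRate Q s).toReal * u))
              * ∑' w, Q s w * transMean Q φ n (t - u) w)
              + m * 2⁻¹ ^ n * ENNReal.ofReal (Real.exp (2 * B * t)) * 2⁻¹ := by
              gcongr
              have h2 := lintegral_Ioc_exp_le (t := t) (by positivity : 0 ≤ 2 * B)
              rw [ENNReal.ofReal_mul (by norm_num), mul_assoc] at h2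
              have h3 := ENNReal.le_div_iff_mul_le (a := ENNReal.ofReal B
                * ∫⁻ u in Set.Ioc 0 t, ENNReal.ofReal (Real.exp (-(2 * B) * u))) (b := 2) (c := 1)
                (by simp) (by simp)
              rw [one_div] at h3
              refine h3.2 ?_
              rw [mul_comm]
              simpa using h2
          _ = _ := by ring
    have hlim : Filter.Tendsto (fun n : ℕ => (⨆ n, transMean Q φ n t s)
        + m * (2⁻¹ ^ n * ENNReal.ofReal (Real.exp (2 * B * t)))) Filter.atTop
        (nhds ((⨆ n, transMean Q φ n t s)
          + m * (0 * ENNReal.ofReal (Real.exp (2 * B * t))))) := by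
      refine tendsto_const_nhds.add (ENNReal.Tendsto.const_mul (ENNReal.Tendsto.mul_const ?_
        (Or.inr ENNReal.ofReal_ne_top)) (Or.inr hm))
      exact ENNReal.tendsto_pow_atTop_nhds_zero_of_lt_one (by simp)
    rw [zero_mul, mul_zero, add_zero] at hlim
    refine ge_of_tendsto' hlim fun n => (key n t s ht).trans ?_
    gcongr
    exact le_iSup (fun n => transMean Q φ n t s) n

/-- Bounded rates exclude explosion: the constant 1 is a bounded solution of the backward equation,
hence the only one with that initial value. -/
theorem tsum_transProb_eq_one {B : ℝ} (hB : 0 < B)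
    (hQB : ∀ s, exitRate Q s ≤ ENNReal.ofReal B) {t : ℝ} (ht : 0 ≤ t) (s : S) :
    ∑' s', transProb Q t s s' = 1 := by
  have := tsum_transProb_eq_of_backward Q hB hQB (fun _ => 1) (ψ := fun _ _ => 1) (m := 1)
    (by simp) (fun _ _ _ => le_rfl) ?_ ht s
  · simpa using this
  · intro t s ht
    have hfin : exitRate Q s ≠ ∞ := ne_top_of_le_ne_top ENNReal.ofReal_ne_top (hQB s)
    have h := lintegral_Ioc_exp (ENNReal.toReal_nonneg (a := exitRate Q s)) ht
    rw [ENNReal.ofReal_toReal hfin] at h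
    simp only [mul_one]
    change _ = _ + ∫⁻ u in Set.Ioc 0 t, ENNReal.ofReal (Real.exp (-(exitRate Q s).toReal * u))
      * exitRate Q s
    rw [lintegral_mul_const _ (by fun_prop), mul_comm _ (exitRate Q s), add_comm, h]

end Chain

/-! ### Green functions, occupation measures and expected costs -/

section Green

variable {S : Type*} [Countable S] (Q : S → S → ℝ≥0∞)

/-- Expected time spent in `s'` before the `n`-th jump, starting from `s`. -/
def greenIter (n : ℕ) (s s' : S) : ℝ≥0∞ := ∫⁻ t in Set.Ici (0 : ℝ), transIter Q n t s s'

theorem potentialIter_eq_tsum (φ : S → ℝ≥0∞) (n : ℕ) (s : S) :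
    potentialIter Q φ n s = ∑' s', greenIter Q n s s' * φ s' := by
  simp only [potentialIter, transMean, greenIter]
  rw [lintegral_tsum fun w => ((measurable_transIter Q n s w).mul_const _).aemeasurable]
  simp_rw [lintegral_mul_const _ (measurable_transIter Q n s _)]

theorem greenIter_mono (s s' : S) : Monotone fun n => greenIter Q n s s' :=
  fun _ _ h => lintegral_mono fun t => transIter_mono Q t s s' h

@[simp]
theorem greenIter_zero (s s' : S) : greenIter Q 0 s s' = 0 := by simp [greenIter, transIter]

theorem greenIter_absorbing {s s' : S} (hs : exitRate Q s = 0) (h : s ≠ s') (n : ℕ) :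
    greenIter Q n s s' = 0 := by
  simp [greenIter, transIter_absorbing Q hs h]

open Classical in
theorem greenIter_succ_backward {s : S} (h0 : exitRate Q s ≠ 0) (h1 : exitRate Q s ≠ ∞)
    (s' : S) (n : ℕ) :
    exitRate Q s * greenIter Q (n + 1) s s'
      = (if s = s' then 1 else 0) + ∑' w, Q s w * greenIter Q n w s' := by
  simpa [potentialIter_eq_tsum] using
    potentialIter_succ Q h0 h1 (fun w => if w = s' then 1 else 0) n

-- Last-jump decomposition. With `D` the diagonal of exit rates and `G n` the truncated Green
-- operators, the backward recursion is `D * G (n + 1) = 1 + Q * G n`. By induction it yields the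
-- forward form `G (n + 1) * D = 1 + G n * Q` at non-absorbing target states.
open Classical in
theorem greenIter_succ_forward (hfin : ∀ s, exitRate Q s ≠ ∞) {s' : S} (hs' : exitRate Q s' ≠ 0)
    (n : ℕ) (s : S) :
    greenIter Q (n + 1) s s' * exitRate Q s'
      = (if s = s' then 1 else 0) + ∑' w, greenIter Q n s w * Q w s' := by
  induction n generalizing s with
  | zero =>
    by_cases hs : exitRate Q s = 0
    · have hne : s ≠ s' := by rintro rfl; exact hs' hs
      simp [greenIter_absorbing Q hs hne, hne]
    · have h := greenIter_succ_backward Q hs (hfin s) s' 0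
      by_cases hne : s = s'
      · subst hne
        rw [mul_comm]; simpa using h
      · simp only [hne, if_false, greenIter_zero, mul_zero, tsum_zero, add_zero, mul_eq_zero, hs,
          false_or] at h
        simp [h, hne]
  | succ n ih =>
    by_cases hs : exitRate Q s = 0
    · have hne : s ≠ s' := by rintro rfl; exact hs' hs
      have hQ : ∀ w, Q s w = 0 := by simpa [exitRate] using hs
      rw [greenIter_absorbing Q hs hne]
      simp only [hne, if_false, zero_mul, zero_add]
      refine (ENNReal.tsum_eq_zero.2 fun w => ?_).symm
      by_cases hw : s = w
      · subst hw; simp [hQ]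
      · simp [greenIter_absorbing Q hs hw]
    · rw [← ENNReal.mul_right_inj hs (hfin s), ← mul_assoc,
        greenIter_succ_backward Q hs (hfin s) s' (n + 1), mul_add, ← ENNReal.tsum_mul_left]
      simp_rw [← mul_assoc, greenIter_succ_backward Q hs (hfin s) _ n, add_mul,
        ENNReal.tsum_add, ← ENNReal.tsum_mul_right]
      have e1 : ∀ w, Q s w * greenIter Q (n + 1) w s' * exitRate Q s'
          = Q s w * (if w = s' then 1 else 0) + ∑' v, Q s w * (greenIter Q n w v * Q v s') := by
        intro w
        rw [mul_assoc, ih w, mul_add, ENNReal.tsum_mul_left]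
      simp_rw [e1, ENNReal.tsum_add]
      rw [ENNReal.tsum_comm]
      have e2 : ∑' w, Q s w * (if w = s' then 1 else 0) = Q s s' := by simp
      have e3 : ∑' w, (if s = w then 1 else 0) * Q w s' = Q s s' := by simp
      have e4 : (if s = s' then (1 : ℝ≥0∞) else 0) * exitRate Q s'
          = exitRate Q s * if s = s' then 1 else 0 := by
        split_ifs with h
        · subst h; ring
        · simp
      rw [e2, e3, e4]
      simp_rw [mul_assoc]

/-- Expected total time spent in `s'` by a population immigrating according to `e`. -/
def occupation (e : S → ℝ≥0∞) (s' : S) : ℝ≥0∞ := ⨆ n, ∑' s, e s * greenIter Q n s s'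

variable (e : S → ℝ≥0∞)

theorem tsum_greenIter_succ (hfin : ∀ s, exitRate Q s ≠ ∞) {s' : S} (hs' : exitRate Q s' ≠ 0)
    (n : ℕ) :
    (∑' s, e s * greenIter Q (n + 1) s s') * exitRate Q s'
      = e s' + ∑' w, (∑' s, e s * greenIter Q n s w) * Q w s' := by
  classical
  rw [← ENNReal.tsum_mul_right]
  simp_rw [mul_assoc, greenIter_succ_forward Q hfin hs', mul_add, ENNReal.tsum_add]
  congr 1
  · simp
  · simp_rw [← ENNReal.tsum_mul_left, ← ENNReal.tsum_mul_right]
    rw [ENNReal.tsum_comm]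
    simp_rw [mul_assoc]

theorem tsum_greenIter_mono (s' : S) : Monotone fun n => ∑' s, e s * greenIter Q n s s' :=
  fun _ _ h => ENNReal.tsum_le_tsum fun s => mul_le_mul_right (greenIter_mono Q s s' h) _

/-- The stationary forward equation, obtained as the monotone limit of the truncated ones: outflow
equals immigration plus inflow. -/
theorem occupation_mul_exitRate (hfin : ∀ s, exitRate Q s ≠ ∞) {s' : S}
    (hs' : exitRate Q s' ≠ 0) :
    occupation Q e s' * exitRate Q s' = e s' + ∑' w, occupation Q e w * Q w s' := by
  have h1 : occupation Q e s' = ⨆ n, ∑' s, e s * greenIter Q (n + 1) s s' :=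
    ((tsum_greenIter_mono Q e s').iSup_nat_add 1).symm
  rw [h1, ENNReal.iSup_mul]
  simp_rw [tsum_greenIter_succ Q e hfin hs']
  rw [← ENNReal.add_iSup]
  congr 1
  simp_rw [occupation, ENNReal.iSup_mul]
  exact (tsum_iSup_of_monotone (f := fun n w => (∑' s, e s * greenIter Q n s w) * Q w s')
    fun w _ _ h => mul_le_mul_left (tsum_greenIter_mono Q e w h) _).symm

/-- Minimality: the truncated occupations start at zero and each forward step preserves domination
by a supersolution. -/
theorem occupation_le (hfin : ∀ s, exitRate Q s ≠ ∞) {ν : S → ℝ≥0∞}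
    (hν : ∀ s', exitRate Q s' ≠ 0 → e s' + ∑' w, ν w * Q w s' ≤ ν s' * exitRate Q s')
    {s' : S} (hs' : exitRate Q s' ≠ 0) : occupation Q e s' ≤ ν s' := by
  refine iSup_le fun n => ?_
  induction n generalizing s' with
  | zero => simp
  | succ n ih =>
    rw [← ENNReal.mul_le_mul_iff_left hs' (hfin s'), tsum_greenIter_succ Q e hfin hs']
    refine le_trans ?_ (hν s' hs')
    refine add_le_add le_rfl (ENNReal.tsum_le_tsum fun w => ?_)
    by_cases hw : exitRate Q w = 0
    · have hQ : ∀ v, Q w v = 0 := by simpa [exitRate] using hw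
      simp [hQ]
    · exact mul_le_mul_left (ih hw) _

/-- Duality behind Little's law: the cost accrued over the lives of all immigrants equals the cost
rate integrated over the occupation measure. -/
theorem tsum_mul_iSup_potentialIter (φ : S → ℝ≥0∞) :
    ∑' s, e s * ⨆ n, potentialIter Q φ n s = ∑' s', occupation Q e s' * φ s' := by
  simp_rw [occupation, ENNReal.iSup_mul, ENNReal.mul_iSup]
  rw [tsum_iSup_of_monotone (f := fun n s => e s * potentialIter Q φ n s)
      fun s _ _ h => mul_le_mul_right (potentialIter_mono Q φ s h) _,
    tsum_iSup_of_monotone (f := fun n s' => (∑' s, e s * greenIter Q n s s') * φ s')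
      fun s _ _ h => mul_le_mul_left (tsum_greenIter_mono Q e s h) _]
  congr 1
  funext n
  simp_rw [potentialIter_eq_tsum, ← ENNReal.tsum_mul_left, ← ENNReal.tsum_mul_right]
  rw [ENNReal.tsum_comm]
  simp_rw [mul_assoc]

theorem iSup_potentialIter_eq {s : S} (h0 : exitRate Q s ≠ 0) (h1 : exitRate Q s ≠ ∞)
    (φ : S → ℝ≥0∞) :
    exitRate Q s * ⨆ n, potentialIter Q φ n s
      = φ s + ∑' w, Q s w * ⨆ n, potentialIter Q φ n w := by
  have h2 : (⨆ n, potentialIter Q φ n s) = ⨆ n, potentialIter Q φ (n + 1) s :=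
    ((potentialIter_mono Q φ s).iSup_nat_add 1).symm
  rw [h2, ENNReal.mul_iSup]
  simp_rw [potentialIter_succ Q h0 h1]
  rw [← ENNReal.add_iSup]
  congr 1
  simp_rw [ENNReal.mul_iSup]
  exact (tsum_iSup_of_monotone (f := fun n w => Q s w * potentialIter Q φ n w)
    fun w _ _ h => mul_le_mul_right (potentialIter_mono Q φ w h) _).symm

/-- Absorption at `a` costs at least the rate of jumping to `a` integrated along the path: that
potential, reset to 1 at `a`, is superharmonic. -/
theorem transProb_le_potential (hfin : ∀ s, exitRate Q s ≠ ∞) {a : S} (ha : exitRate Q a = 0)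
    {s : S} (hs : s ≠ a) (t : ℝ) :
    transProb Q t s a ≤ ⨆ n, potentialIter Q (fun w => Q w a) n s := by
  classical
  set u : S → ℝ≥0∞ := fun s => ⨆ n, potentialIter Q (fun w => Q w a) n s
  have h := transProb_le_of_superharmonic Q ha (h := fun s => if s = a then 1 else u s) (by simp)
    hfin (fun s => ?_) t s
  · simpa [hs] using h
  · by_cases h0 : exitRate Q s = 0
    · have hQ : ∀ v, Q s v = 0 := by simpa [exitRate] using h0
      simp [hQ]
    have hsa : s ≠ a := by rintro rfl; exact h0 ha
    simp only [hsa, if_false]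
    rw [iSup_potentialIter_eq Q h0 (hfin s)]
    calc ∑' w, Q s w * (if w = a then 1 else u w)
        ≤ ∑' w, (Q s w * (if w = a then 1 else 0) + Q s w * u w) := by
          refine ENNReal.tsum_le_tsum fun w => ?_
          split_ifs <;> simp
      _ = _ := by
          rw [ENNReal.tsum_add]; simp [u]

/-- A state that cannot be entered has probability zero. -/
theorem transProb_eq_zero (hfin : ∀ s, exitRate Q s ≠ ∞) {a : S} (ha : exitRate Q a = 0)
    (hQ : ∀ s, Q s a = 0) {s : S} (hs : s ≠ a) (t : ℝ) : transProb Q t s a = 0 := by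
  classical
  have h := transProb_le_of_superharmonic Q ha (h := fun s => if s = a then 1 else 0) (by simp)
    hfin (fun s => by simp [hQ]) t s
  simpa [hs] using h

/-- A supersolution of the expected-cost equation bounds the expected cost. -/
theorem iSup_potentialIter_le (hfin : ∀ s, exitRate Q s ≠ ∞) {φ g : S → ℝ≥0∞}
    (hφ : ∀ s, exitRate Q s = 0 → φ s = 0 ∨ g s = ∞)
    (hg : ∀ s, exitRate Q s ≠ 0 → φ s + ∑' w, Q s w * g w ≤ exitRate Q s * g s) (s : S) :
    ⨆ n, potentialIter Q φ n s ≤ g s := by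
  refine iSup_le fun n => ?_
  induction n generalizing s with
  | zero => simp [potentialIter_zero]
  | succ n ih =>
    by_cases h0 : exitRate Q s = 0
    · obtain hφs | hgs := hφ s h0
      swap
      · simp [hgs]
      rw [potentialIter_eq_tsum]
      refine le_of_eq_of_le (ENNReal.tsum_eq_zero.2 fun w => ?_) zero_le
      by_cases hw : s = w
      · subst hw; simp [hφs]
      · simp [greenIter_absorbing Q h0 hw]
    · rw [← ENNReal.mul_le_mul_iff_right h0 (hfin s), potentialIter_succ Q h0 (hfin s)]
      refine le_trans ?_ (hg s h0)
      gcongr with w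
      exact ih w

end Green

/-! ## States and jump rates of an agent -/

/-- The states of an agent are pairs (length, position) and two absorbing states. -/
def agentStateEquiv : AgentState ≃ (ℕ × ℕ) ⊕ Bool where
  toFun
    | .waiting k ℓ => .inl (k, ℓ)
    | .served => .inr true
    | .removed => .inr false
  invFun
    | .inl s => .waiting s.1 s.2
    | .inr true => .served
    | .inr false => .removed
  left_inv s := by cases s <;> rfl
  right_inv s := by rcases s with _ | _ | _ <;> rfl

instance : Countable AgentState := agentStateEquiv.injective.countable

theorem tsum_agentState (f : AgentState → ℝ≥0∞) :
    ∑' s, f s = (∑' s : ℕ × ℕ, f (.waiting s.1 s.2)) + (f .served + f .removed) := by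
  rw [← agentStateEquiv.symm.tsum_eq, ENNReal.summable.tsum_sum ENNReal.summable]
  congr 1
  rw [tsum_fintype]
  simp [agentStateEquiv]

variable (M : QueueModel) (π : EntryExit) (q : ℕ → ℕ → ℝ)

theorem jumpRate_served (w : AgentState) : M.jumpRate π q .served w = 0 := rfl

theorem jumpRate_removed (w : AgentState) : M.jumpRate π q .removed w = 0 := rfl

theorem jumpRate_invalid {k ℓ : ℕ} (h : ¬(1 ≤ ℓ ∧ ℓ ≤ k)) (w : AgentState) :
    M.jumpRate π q (.waiting k ℓ) w = 0 := by simp only [QueueModel.jumpRate, if_neg h]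

theorem tsum_jumpRate_mul {k ℓ : ℕ} (h : 1 ≤ ℓ ∧ ℓ ≤ k) (g : AgentState → ℝ≥0∞) :
    ∑' w, M.jumpRate π q (.waiting k ℓ) w * g w
      = ENNReal.ofReal (q k ℓ) * g .served
        + ENNReal.ofReal (π.y k ℓ + M.arr k * π.x k * π.z k ℓ) * g .removed
        + ENNReal.ofReal (∑ j ∈ Finset.Ico 1 ℓ, (q k j + π.y k j)) * g (.waiting (k - 1) (ℓ - 1))
        + ENNReal.ofReal (∑ j ∈ Finset.Ioc ℓ k, (q k j + π.y k j)) * g (.waiting (k - 1) ℓ)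
        + ENNReal.ofReal (M.arr k * π.x k * ∑ j ∈ Finset.Ico 1 ℓ, π.z k j)
          * g (.waiting k (ℓ - 1))
        + ENNReal.ofReal (M.arr k * π.x k * (1 - π.zTot k)) * g (.waiting (k + 1) ℓ) := by
  simp only [QueueModel.jumpRate, if_pos h, add_mul, ENNReal.tsum_add, ite_mul, zero_mul,
    tsum_ite_eq]

/-! ### Distributions over posteriors on a countable discrete space -/

section Posteriors

open Filter Topology

variable {X : Type*} [Countable X] [TopologicalSpace X] [DiscreteTopology X] [MeasurableSpace X]
  [BorelSpace X]

/-- Convergence of the point masses to those of a probability measure is weak convergence. Finite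
subsets of an open set give lower bounds that converge and approximate its limit mass from below,
which is the liminf criterion. -/
theorem tendsto_probabilityMeasure_of_singletons {L : Filter (ProbabilityMeasure X)}
    [L.IsCountablyGenerated] {γ : ProbabilityMeasure X}
    (h : ∀ s, Tendsto (fun γ' : ProbabilityMeasure X => (γ' : Measure X) {s}) L
      (𝓝 ((γ : Measure X) {s}))) : L ≤ 𝓝 γ := by
  refine tendsto_id'.1 (tendsto_of_forall_isOpen_le_liminf' (μs := id) fun G _ => ?_)
  rcases L.eq_or_neBot with rfl | hL
  · simp
  classical
  rw [← Measure.tsum_indicator_apply_singleton (γ : Measure X) G (isOpen_discrete G).measurableSet,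
    ENNReal.tsum_eq_iSup_sum]
  refine iSup_le fun F => ?_
  have hF : Tendsto (fun γ' : ProbabilityMeasure X => ∑ s ∈ F with s ∈ G, (γ' : Measure X) {s}) L
      (𝓝 (∑ s ∈ F with s ∈ G, (γ : Measure X) {s})) := tendsto_finsetSum _ fun s _ => h s
  simp_rw [Set.indicator_apply, ← Finset.sum_filter]
  rw [← hF.liminf_eq]
  refine liminf_le_liminf (Eventually.of_forall fun γ' => ?_)
  rw [sum_measure_singleton]
  exact measure_mono fun s hs => (Finset.mem_filter.1 hs).2

theorem continuous_probabilityMeasure_singleton (s : X) :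
    Continuous fun γ : ProbabilityMeasure X => (γ : Measure X) {s} := by
  refine continuous_iff_continuousAt.2 fun γ => ?_
  exact ProbabilityMeasure.tendsto_measure_of_null_frontier_of_tendsto' tendsto_id
    (by simp)

theorem isInducing_probabilityMeasure_singletons :
    IsInducing fun (γ : ProbabilityMeasure X) (s : X) => (γ : Measure X) {s} := by
  refine isInducing_iff_nhds.2 fun γ => le_antisymm ?_ ?_
  · exact (continuous_pi continuous_probabilityMeasure_singleton).continuousAt.tendsto.le_comap
  · exact tendsto_probabilityMeasure_of_singletons fun s =>
      (((continuous_apply s).tendsto (fun s => (γ : Measure X) {s})).comp tendsto_comap :)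

/-- Needed to know that a measure on posteriors is carried by its support. -/
theorem secondCountableTopology_probabilityMeasure :
    SecondCountableTopology (ProbabilityMeasure X) :=
  isInducing_probabilityMeasure_singletons.secondCountableTopology

theorem measurable_probabilityMeasure_singleton (s : X) :
    Measurable fun γ : ProbabilityMeasure X => (γ : Measure X) {s} :=
  (Measure.measurable_coe (measurableSet_singleton s)).comp measurable_subtype_coe

/-- Two distinct posteriors differ at some point mass, and evaluation there is both continuous and
measurable, so a measurable open neighbourhood of `γ'` misses `γ`. -/
theorem support_dirac_probabilityMeasure {γ γ' : ProbabilityMeasure X}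
    (h : γ' ∈ (Measure.dirac γ).support) : γ' = γ := by
  by_contra hne
  obtain ⟨s, hs⟩ : ∃ s, (γ' : Measure X) {s} ≠ (γ : Measure X) {s} := by
    by_contra! hall
    exact hne (Subtype.ext (Measure.ext_of_singleton hall))
  obtain ⟨u, v, hu, hv, hγ', hγ, huv⟩ := t2_separation hs
  have hpos := (Measure.mem_support_iff_forall _).1 h _
    ((hu.preimage (continuous_probabilityMeasure_singleton s)).mem_nhds hγ')
  rw [Measure.dirac_apply' _ (measurable_probabilityMeasure_singleton s hu.measurableSet)] at hpos
  have : γ ∉ (fun γ : ProbabilityMeasure X => (γ : Measure X) {s}) ⁻¹' u :=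
    fun hmem => Set.disjoint_left.1 huv hmem hγ
  simp [this] at hpos

/-- An inequality between expectations that holds for all posteriors in the support holds for their
average. -/
theorem lintegral_le_of_support (P : Measure (ProbabilityMeasure X)) {b : X → ℝ≥0∞}
    (hb : ∀ s, ∫⁻ γ : ProbabilityMeasure X, (γ : Measure X) {s} ∂P = b s) {f g : X → ℝ≥0∞}
    (h : ∀ γ ∈ P.support,
      ∑' s, (γ : Measure X) {s} * f s ≤ ∑' s, (γ : Measure X) {s} * g s) :
    ∑' s, b s * f s ≤ ∑' s, b s * g s := by
  have := secondCountableTopology_probabilityMeasure (X := X)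
  have hsum : ∀ f : X → ℝ≥0∞, ∑' s, b s * f s
      = ∫⁻ γ : ProbabilityMeasure X, ∑' s, (γ : Measure X) {s} * f s ∂P := by
    intro f
    rw [lintegral_tsum fun s =>
      ((measurable_probabilityMeasure_singleton s).mul_const _).aemeasurable]
    simp_rw [lintegral_mul_const _ (measurable_probabilityMeasure_singleton _), hb]
  rw [hsum, hsum]
  refine lintegral_mono_ae ?_
  filter_upwards [Measure.support_mem_ae (μ := P)] with γ hγ using h γ hγ

end Posteriors

/-- A flow through the levels of a stationary birth-death process that has losses, but no
immigration, and is dominated by `k * p k` at level `k`, vanishes. -/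
theorem eq_zero_of_flow_balance {p dep b a own oz : ℕ → ℝ} {Λ : ℝ} (hs : Summable p)
    (hp : ∀ k, 0 ≤ p k) (hb0 : ∀ k, 0 ≤ b k) (hbΛ : ∀ k, b k ≤ Λ) (hdep : ∀ k, 0 < dep (k + 1))
    (hbal : ∀ k, b k * p k = dep (k + 1) * p (k + 1)) (ha0 : ∀ k, 0 ≤ a k)
    (hap : ∀ k, a k ≤ k * p k) (hown : ∀ k, 0 ≤ own k) (hoz : ∀ k, 0 ≤ oz k)
    (hown1 : own 1 = dep 1 * a 1)
    (hflow : ∀ n, dep (n + 1) * a (n + 1) + oz (n + 1) + b (n + 1) * a (n + 1)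
      = dep (n + 2) * a (n + 2) - own (n + 2) + b n * a n) (k : ℕ) : a k = 0 := by
  have hazero : a 0 = 0 := le_antisymm (by simpa using hap 0) (ha0 0)
  -- `Φ n` is the net downward flux of the population from level `n + 1` to level `n`. It starts at
  -- 0 and grows by the losses at each level.
  set Φ : ℕ → ℝ := fun n => dep (n + 1) * a (n + 1) - own (n + 1) - b n * a n with hΦ
  have hstep : ∀ n, Φ (n + 1) = Φ n + own (n + 1) + oz (n + 1) := fun n => by
    simp only [hΦ]; linarith [hflow n]
  have hΦ0 : Φ 0 = 0 := by simp [hΦ, hazero, hown1]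
  have hmono : Monotone Φ := monotone_nat_of_le_succ fun n => by
    linarith [hstep n, hown (n + 1), hoz (n + 1)]
  have hΦp : ∀ n, Φ n ≤ Λ * ((n + 1) * p n) := fun n => by
    have h1 : dep (n + 1) * a (n + 1) ≤ dep (n + 1) * ((n + 1) * p (n + 1)) := by
      have := hap (n + 1)
      push_cast at this
      exact mul_le_mul_of_nonneg_left this (hdep n).le
    have h2 : b n * p n * (n + 1) ≤ Λ * p n * (n + 1) := by
      have := mul_le_mul_of_nonneg_right (hbΛ n) (hp n)
      exact mul_le_mul_of_nonneg_right this (by positivity)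
    have h3 := mul_nonneg (hb0 n) (ha0 n)
    have h4 := hbal n
    simp only [hΦ]
    nlinarith [hown (n + 1)]
  have hΦzero : ∀ n, Φ n = 0 := by
    intro N
    refine le_antisymm ?_ (hΦ0 ▸ hmono (Nat.zero_le N))
    by_contra! hpos
    have hΛ : 0 ≤ Λ := (hb0 0).trans (hbΛ 0)
    -- A positive flux at `N` persists at all higher levels, where it is at most `Λ * (n + N + 1) *
    -- p (n + N)`. Summability of `p` would then make the harmonic series converge.
    have hsum : Summable fun n : ℕ => Φ N * (1 / ((n : ℝ) + (N + 1))) := by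
      refine Summable.of_nonneg_of_le (fun n => by positivity) (fun n => ?_)
        (((summable_nat_add_iff N).2 hs).mul_left Λ)
      have h1 := (hmono (Nat.le_add_left N n)).trans (hΦp (n + N))
      push_cast at h1
      rw [mul_one_div, div_le_iff₀ (by positivity)]
      linarith
    rw [summable_mul_left_iff hpos.ne'] at hsum
    have h2 : Summable fun n : ℕ => 1 / (((n + (N + 1) : ℕ) : ℝ)) := by
      simpa using hsum
    exact Real.not_summable_one_div_natCast
      ((summable_nat_add_iff (f := fun n : ℕ => 1 / (n : ℝ)) (N + 1)).1 h2)
  have hown' : ∀ n, own (n + 1) = 0 := fun n => by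
    have := hstep n
    rw [hΦzero, hΦzero] at this
    linarith [hown (n + 1), hoz (n + 1)]
  induction k with
  | zero => exact hazero
  | succ n ih =>
    have := hΦzero n
    simp only [hΦ, hown', ih, mul_zero, sub_zero, mul_eq_zero, (hdep n).ne', false_or] at this
    exact this

/-! ### Flows into and out of the states of an agent -/

section Rates

variable (M : QueueModel) (π : EntryExit) (q : ℕ → ℕ → ℝ)

/-- Rate at which agents join a queue of length `k`. -/
def QueueModel.joinRate (k : ℕ) : ℝ := M.arr k * π.x k

/-- Rate of upward jumps of the queue length. -/
def QueueModel.growthRate (k : ℕ) : ℝ := M.arr k * π.x k * (1 - π.zTot k)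

/-- Rate of downward jumps of the queue length. -/
def QueueModel.departureRate (k : ℕ) : ℝ := M.srv k + π.yTot k

/-- Rate at which the first `i` agents leave a queue of length `k`. -/
def aheadRate (k i : ℕ) : ℝ := ∑ j ∈ Finset.Ico 1 (i + 1), (q k j + π.y k j)

/-- Probability that a joining agent replaces one of the first `i` agents. -/
def aheadReplaced (k i : ℕ) : ℝ := ∑ j ∈ Finset.Ico 1 (i + 1), π.z k j

/-- Rate at which the state of an agent changes. -/
def QueueModel.changeRate (k ℓ : ℕ) : ℝ :=
  M.departureRate π k + M.joinRate π k * aheadReplaced π k ℓ + M.growthRate π k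

/-- Flow into the state `(k, ℓ)` from other states, when the mass of states is `g`. -/
def QueueModel.inflow (g : ℕ → ℕ → ℝ) (k ℓ : ℕ) : ℝ :=
  g (k + 1) (ℓ + 1) * aheadRate π q (k + 1) ℓ
    + g (k + 1) ℓ * (M.departureRate π (k + 1) - aheadRate π q (k + 1) ℓ)
    + if ℓ < k then g k (ℓ + 1) * (M.joinRate π k * aheadReplaced π k ℓ)
        + g (k - 1) ℓ * M.growthRate π (k - 1) else 0

variable {M π q}

theorem QueueModel.joinRate_nonneg (hπ : π.Feasible) (k : ℕ) : 0 ≤ M.joinRate π k :=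
  mul_nonneg (M.arr_nonneg k) (hπ.x_mem k).1

theorem QueueModel.growthRate_nonneg (hπ : π.Feasible) (k : ℕ) : 0 ≤ M.growthRate π k :=
  mul_nonneg (M.joinRate_nonneg hπ k) (sub_nonneg.2 (hπ.zTot_le k))

theorem EntryExit.Feasible.zTot_nonneg (hπ : π.Feasible) (k : ℕ) : 0 ≤ π.zTot k :=
  Finset.sum_nonneg fun ℓ h => (hπ.z_mem k ℓ h).1

theorem EntryExit.Feasible.yTot_nonneg (hπ : π.Feasible) (k : ℕ) : 0 ≤ π.yTot k :=
  Finset.sum_nonneg fun ℓ h => hπ.y_nonneg k ℓ h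

theorem QueueModel.growthRate_le (hπ : π.Feasible) (k : ℕ) : M.growthRate π k ≤ M.arr k := by
  have h1 := mul_le_of_le_one_right (M.joinRate_nonneg hπ k)
    (show 1 - π.zTot k ≤ 1 by linarith [hπ.zTot_nonneg k])
  have h2 := mul_le_of_le_one_right (M.arr_nonneg k) (hπ.x_mem k).2
  exact h1.trans h2

theorem QueueModel.departureRate_pos (hπ : π.Feasible) (k : ℕ) :
    0 < M.departureRate π (k + 1) :=
  add_pos_of_pos_of_nonneg (M.srv_pos _ (by omega)) (hπ.yTot_nonneg _)

theorem leaveRate_nonneg (hπ : π.Feasible) (hq : M.IsQueueingRule q) {k j : ℕ}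
    (hj : j ∈ Finset.Icc 1 k) : 0 ≤ q k j + π.y k j :=
  add_nonneg (hq.nonneg k j hj) (hπ.y_nonneg k j hj)

@[simp]
theorem aheadRate_zero (k : ℕ) : aheadRate π q k 0 = 0 := by simp [aheadRate]

@[simp]
theorem aheadReplaced_zero (k : ℕ) : aheadReplaced π k 0 = 0 := by simp [aheadReplaced]

theorem aheadRate_succ (k i : ℕ) :
    aheadRate π q k (i + 1) = aheadRate π q k i + (q k (i + 1) + π.y k (i + 1)) :=
  Finset.sum_Ico_succ_top (by omega) _

theorem aheadReplaced_succ (k i : ℕ) :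
    aheadReplaced π k (i + 1) = aheadReplaced π k i + π.z k (i + 1) :=
  Finset.sum_Ico_succ_top (by omega) _

theorem Ico_one_succ (k : ℕ) : Finset.Ico 1 (k + 1) = Finset.Icc 1 k := by
  ext; simp

theorem aheadRate_self (hq : M.IsQueueingRule q) (k : ℕ) :
    aheadRate π q k k = M.departureRate π k := by
  simp only [aheadRate, Ico_one_succ, Finset.sum_add_distrib, hq.workConserving,
    QueueModel.departureRate, EntryExit.yTot]

theorem aheadReplaced_self (k : ℕ) : aheadReplaced π k k = π.zTot k := by
  simp [aheadReplaced, Ico_one_succ, EntryExit.zTot]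

theorem aheadRate_nonneg (hπ : π.Feasible) (hq : M.IsQueueingRule q) {k i : ℕ} (h : i ≤ k) :
    0 ≤ aheadRate π q k i :=
  Finset.sum_nonneg fun j hj => leaveRate_nonneg hπ hq (by
    simp only [Finset.mem_Ico, Finset.mem_Icc] at hj ⊢; omega)

theorem aheadReplaced_nonneg (hπ : π.Feasible) {k i : ℕ} (h : i ≤ k) :
    0 ≤ aheadReplaced π k i :=
  Finset.sum_nonneg fun j hj => (hπ.z_mem k j (by
    simp only [Finset.mem_Ico, Finset.mem_Icc] at hj ⊢; omega)).1

theorem aheadRate_add_behind (hq : M.IsQueueingRule q) {k i : ℕ} (h : i ≤ k) :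
    ∑ j ∈ Finset.Ioc i k, (q k j + π.y k j) = M.departureRate π k - aheadRate π q k i := by
  rw [← aheadRate_self hq, eq_sub_iff_add_eq, add_comm, aheadRate, aheadRate]
  have : Finset.Ioc i k = Finset.Ico (i + 1) (k + 1) := by ext; simp
  rw [this, Finset.sum_Ico_consecutive _ (by omega) (by omega)]

theorem behind_nonneg (hπ : π.Feasible) (hq : M.IsQueueingRule q) {k i : ℕ} (h : i ≤ k) :
    0 ≤ M.departureRate π k - aheadRate π q k i := by
  rw [← aheadRate_add_behind hq h]
  exact Finset.sum_nonneg fun j hj => leaveRate_nonneg hπ hq (by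
    simp only [Finset.mem_Ioc, Finset.mem_Icc] at hj ⊢; omega)

theorem QueueModel.changeRate_pos (hπ : π.Feasible) {k ℓ : ℕ} (h : 1 ≤ ℓ ∧ ℓ ≤ k) :
    0 < M.changeRate π k ℓ := by
  obtain ⟨n, rfl⟩ : ∃ n, k = n + 1 := ⟨k - 1, by omega⟩
  have h1 := M.departureRate_pos hπ n
  have h2 := mul_nonneg (M.joinRate_nonneg hπ (n + 1)) (aheadReplaced_nonneg hπ h.2)
  have h3 := M.growthRate_nonneg hπ (n + 1)
  unfold QueueModel.changeRate
  linarith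

theorem exitRate_waiting (hπ : π.Feasible) (hq : M.IsQueueingRule q) {k ℓ : ℕ}
    (h : 1 ≤ ℓ ∧ ℓ ≤ k) :
    exitRate (M.jumpRate π q) (.waiting k ℓ) = ENNReal.ofReal (M.changeRate π k ℓ) := by
  obtain ⟨i, rfl⟩ : ∃ i, ℓ = i + 1 := ⟨ℓ - 1, by omega⟩
  have hmem : i + 1 ∈ Finset.Icc 1 k := Finset.mem_Icc.2 h
  have h1 := hq.nonneg k _ hmem
  have h2 := hπ.y_nonneg k _ hmem
  have h3 := (hπ.z_mem k _ hmem).1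
  have h4 := M.joinRate_nonneg hπ k
  have h5 := aheadRate_nonneg hπ hq (show i ≤ k by omega)
  have h6 := behind_nonneg hπ hq h.2
  have h7 := aheadReplaced_nonneg hπ (show i ≤ k by omega)
  have h8 := M.growthRate_nonneg hπ k
  have hsum := tsum_jumpRate_mul M π q h fun _ => 1
  simp only [mul_one] at hsum
  rw [exitRate, hsum, aheadRate_add_behind hq h.2]
  change ENNReal.ofReal (q k (i + 1)) +
    ENNReal.ofReal (π.y k (i + 1) + M.joinRate π k * π.z k (i + 1))
    + ENNReal.ofReal (aheadRate π q k i) + _ +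
    ENNReal.ofReal (M.joinRate π k * aheadReplaced π k i) + ENNReal.ofReal (M.growthRate π k) = _
  have h9 := mul_nonneg h4 h3
  have h10 := mul_nonneg h4 h7
  rw [← ENNReal.ofReal_add h1 (by positivity), ← ENNReal.ofReal_add (by positivity) h5,
    ← ENNReal.ofReal_add (by positivity) h6, ← ENNReal.ofReal_add (by positivity) h10,
    ← ENNReal.ofReal_add (by positivity) h8]
  congr 1
  rw [QueueModel.changeRate, aheadRate_succ, aheadReplaced_succ]
  ring

theorem exitRate_served : exitRate (M.jumpRate π q) .served = 0 := by
  simp [exitRate, jumpRate_served]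

theorem exitRate_removed : exitRate (M.jumpRate π q) .removed = 0 := by
  simp [exitRate, jumpRate_removed]

theorem exitRate_invalid {k ℓ : ℕ} (h : ¬(1 ≤ ℓ ∧ ℓ ≤ k)) :
    exitRate (M.jumpRate π q) (.waiting k ℓ) = 0 := by
  simp [exitRate, jumpRate_invalid M π q h]

theorem exitRate_ne_top (hπ : π.Feasible) (hq : M.IsQueueingRule q) (s : AgentState) :
    exitRate (M.jumpRate π q) s ≠ ∞ := by
  match s with
  | .served => simp [exitRate_served]
  | .removed => simp [exitRate_removed]
  | .waiting k ℓ =>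
    by_cases h : 1 ≤ ℓ ∧ ℓ ≤ k
    · simp [exitRate_waiting hπ hq h]
    · simp [exitRate_invalid h]

theorem exitRate_ne_zero_iff (hπ : π.Feasible) (hq : M.IsQueueingRule q) (s : AgentState) :
    exitRate (M.jumpRate π q) s ≠ 0 ↔ ∃ k ℓ, s = .waiting k ℓ ∧ 1 ≤ ℓ ∧ ℓ ≤ k := by
  match s with
  | .served => simp [exitRate_served]
  | .removed => simp [exitRate_removed]
  | .waiting k ℓ =>
    by_cases h : 1 ≤ ℓ ∧ ℓ ≤ k
    · simp [exitRate_waiting hπ hq h, M.changeRate_pos hπ h, h]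
    · simpa [exitRate_invalid h] using h

-- The column of the rate matrix, as the forward equation requires. The guard `ℓ < k` excludes
-- sources `(k, k + 1)` and `(k - 1, k)`, whose position exceeds the length.
open Classical in
theorem jumpRate_to_waiting {k ℓ : ℕ} (h : 1 ≤ ℓ ∧ ℓ ≤ k) (w : AgentState) :
    M.jumpRate π q w (.waiting k ℓ)
      = (if w = .waiting (k + 1) (ℓ + 1) then ENNReal.ofReal (aheadRate π q (k + 1) ℓ) else 0)
      + (if w = .waiting (k + 1) ℓ then
          ENNReal.ofReal (∑ j ∈ Finset.Ioc ℓ (k + 1), (q (k + 1) j + π.y (k + 1) j)) else 0)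
      + (if w = .waiting k (ℓ + 1) then
          (if ℓ < k then ENNReal.ofReal (M.joinRate π k * aheadReplaced π k ℓ) else 0) else 0)
      + (if w = .waiting (k - 1) ℓ then
          (if ℓ < k then ENNReal.ofReal (M.growthRate π (k - 1)) else 0) else 0) := by
  match w with
  | .served => simp [jumpRate_served]
  | .removed => simp [jumpRate_removed]
  | .waiting k' ℓ' =>
    by_cases h' : 1 ≤ ℓ' ∧ ℓ' ≤ k'
    · simp only [QueueModel.jumpRate, if_pos h', reduceCtorEq, if_false, zero_add]
      congr 1
      congr 1
      congr 1
      · by_cases h1 : k' = k + 1 ∧ ℓ' = ℓ + 1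
        · obtain ⟨rfl, rfl⟩ := h1
          simp [aheadRate]
        · rw [if_neg, if_neg]
          · simpa using h1
          · simp only [AgentState.waiting.injEq]; omega
      · by_cases h1 : k' = k + 1 ∧ ℓ' = ℓ
        · obtain ⟨rfl, rfl⟩ := h1
          simp
        · rw [if_neg, if_neg]
          · simpa using h1
          · simp only [AgentState.waiting.injEq]; omega
      · by_cases h1 : k' = k ∧ ℓ' = ℓ + 1
        · obtain ⟨rfl, rfl⟩ := h1
          have : ℓ < k' := by omega
          simp [aheadReplaced, QueueModel.joinRate, this]
        · rw [if_neg, if_neg]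
          · simpa using h1
          · simp only [AgentState.waiting.injEq]; omega
      · by_cases h1 : k = k' + 1 ∧ ℓ' = ℓ
        · obtain ⟨rfl, rfl⟩ := h1
          have : ℓ' < k' + 1 := by omega
          simp [QueueModel.growthRate, this]
        · rw [if_neg]
          · by_cases h2 : ℓ < k
            · rw [if_neg]
              simp only [AgentState.waiting.injEq]; omega
            · simp [h2]
          · simp only [AgentState.waiting.injEq]; omega
    · rw [jumpRate_invalid M π q h', if_neg, if_neg]
      · by_cases h2 : ℓ < k
        · rw [if_neg, if_neg]
          · simp
          · simp only [AgentState.waiting.injEq]; omega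
          · simp only [AgentState.waiting.injEq]; omega
        · simp [h2]
      · simp only [AgentState.waiting.injEq]; omega
      · simp only [AgentState.waiting.injEq]; omega

theorem tsum_mul_jumpRate_to_waiting {k ℓ : ℕ} (h : 1 ≤ ℓ ∧ ℓ ≤ k) (G : AgentState → ℝ≥0∞) :
    ∑' w, G w * M.jumpRate π q w (.waiting k ℓ)
      = G (.waiting (k + 1) (ℓ + 1)) * ENNReal.ofReal (aheadRate π q (k + 1) ℓ)
      + G (.waiting (k + 1) ℓ) *
          ENNReal.ofReal (∑ j ∈ Finset.Ioc ℓ (k + 1), (q (k + 1) j + π.y (k + 1) j))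
      + G (.waiting k (ℓ + 1)) *
          (if ℓ < k then ENNReal.ofReal (M.joinRate π k * aheadReplaced π k ℓ) else 0)
      + G (.waiting (k - 1) ℓ) *
          (if ℓ < k then ENNReal.ofReal (M.growthRate π (k - 1)) else 0) := by
  simp only [jumpRate_to_waiting h, mul_add, ENNReal.tsum_add, mul_ite, mul_zero, tsum_ite_eq]

theorem tsum_mul_jumpRate_eq_inflow (hπ : π.Feasible) (hq : M.IsQueueingRule q) {k ℓ : ℕ}
    (h : 1 ≤ ℓ ∧ ℓ ≤ k) {G : AgentState → ℝ≥0∞} {g : ℕ → ℕ → ℝ}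
    (hg : ∀ k ℓ, 1 ≤ ℓ ∧ ℓ ≤ k → 0 ≤ g k ℓ)
    (hG : ∀ k ℓ, 1 ≤ ℓ ∧ ℓ ≤ k → G (.waiting k ℓ) = ENNReal.ofReal (g k ℓ)) :
    0 ≤ M.inflow π q g k ℓ ∧
    ∑' w, G w * M.jumpRate π q w (.waiting k ℓ) = ENNReal.ofReal (M.inflow π q g k ℓ) := by
  have h1 := mul_nonneg (hg (k + 1) (ℓ + 1) (by omega))
    (aheadRate_nonneg hπ hq (show ℓ ≤ k + 1 by omega))
  have h2 := mul_nonneg (hg (k + 1) ℓ (by omega)) (behind_nonneg hπ hq (show ℓ ≤ k + 1 by omega))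
  have h3 := mul_nonneg (M.joinRate_nonneg hπ k) (aheadReplaced_nonneg hπ h.2)
  have h4 := M.growthRate_nonneg hπ (k - 1)
  rw [tsum_mul_jumpRate_to_waiting h, hG (k + 1) (ℓ + 1) (by omega), hG (k + 1) ℓ (by omega),
    aheadRate_add_behind hq (show ℓ ≤ k + 1 by omega), QueueModel.inflow,
    ← ENNReal.ofReal_mul (hg _ _ (by omega)), ← ENNReal.ofReal_mul (hg _ _ (by omega)),
    ← ENNReal.ofReal_add h1 h2]
  by_cases hl : ℓ < k
  · simp only [if_pos hl]
    have h5 := mul_nonneg (hg k (ℓ + 1) (by omega)) h3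
    have h6 := mul_nonneg (hg (k - 1) ℓ (by omega)) h4
    refine ⟨by positivity, ?_⟩
    rw [hG k (ℓ + 1) (by omega), hG (k - 1) ℓ (by omega), ← ENNReal.ofReal_mul (hg _ _ (by omega)),
      ← ENNReal.ofReal_mul (hg _ _ (by omega)), ← ENNReal.ofReal_add (by positivity) h5,
      ← ENNReal.ofReal_add (by positivity) h6, add_assoc _ _ (g (k - 1) ℓ * _)]
  · simp only [if_neg hl, mul_zero, add_zero]
    exact ⟨by positivity, trivial⟩

end Rates

/-! ### Little's law for arbitrary exit and queueing rules -/

section Little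

variable {M : QueueModel} {π : EntryExit} {q : ℕ → ℕ → ℝ} {p : ℕ → ℝ} {Λ : ℝ}

variable (M π p) in
/-- Flow of agents who enter the queue in state `(k, ℓ)`. -/
def QueueModel.entryFlow (k ℓ : ℕ) : ℝ :=
  if ℓ = k then p (k - 1) * M.growthRate π (k - 1) + p k * (M.joinRate π k * π.zTot k) else 0

theorem QueueModel.Generates.growthRate_mul (hgen : M.Generates π p) (k : ℕ) :
    M.growthRate π k * p k = M.departureRate π (k + 1) * p (k + 1) := hgen k

/-- When each position of a queue of length `k` carries mass `p k`, the departures ahead and behind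
add up to the total departure rate, so `q` drops out. What remains combines two consecutive balance
equations of the queue length. -/
theorem queueLength_balance (q : ℕ → ℕ → ℝ) (hgen : M.Generates π p) {k ℓ : ℕ}
    (h : 1 ≤ ℓ ∧ ℓ ≤ k) :
    p k * M.changeRate π k ℓ = M.entryFlow π p k ℓ + M.inflow π q (fun k _ => p k) k ℓ := by
  obtain ⟨n, rfl⟩ : ∃ n, k = n + 1 := ⟨k - 1, by omega⟩
  have h1 := hgen.growthRate_mul n
  have h2 := hgen.growthRate_mul (n + 1)
  have h3 : M.growthRate π (n + 1) = M.joinRate π (n + 1) * (1 - π.zTot (n + 1)) := rfl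
  simp only [QueueModel.changeRate, QueueModel.entryFlow, QueueModel.inflow, Nat.add_sub_cancel]
  by_cases hl : ℓ = n + 1
  · subst hl
    simp only [if_true, lt_irrefl, if_false, aheadReplaced_self]
    linear_combination h2 - h1
  · have hl' : ℓ < n + 1 := by omega
    simp only [hl, hl', if_true, if_false]
    linear_combination h2 - h1

/-- A stationary population without entrants. Summing over positions leaves a flow between queue
lengths whose only losses are the members' own departures and replacements, to which
`eq_zero_of_flow_balance` applies. -/
theorem eq_zero_of_inflow_eq (hπ : π.Feasible) (hq : M.IsQueueingRule q)
    (hΛ : ∀ k, M.arr k ≤ Λ) (hp : IsDistribution p) (hgen : M.Generates π p) {ρ : ℕ → ℕ → ℝ}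
    (hρ0 : ∀ k ℓ, 1 ≤ ℓ ∧ ℓ ≤ k → 0 ≤ ρ k ℓ) (hρp : ∀ k ℓ, 1 ≤ ℓ ∧ ℓ ≤ k → ρ k ℓ ≤ p k)
    (hρ : ∀ k ℓ, 1 ≤ ℓ ∧ ℓ ≤ k → ρ k ℓ * M.changeRate π k ℓ = M.inflow π q ρ k ℓ)
    {k ℓ : ℕ} (h : 1 ≤ ℓ ∧ ℓ ≤ k) : ρ k ℓ = 0 := by
  have hmem : ∀ {k i}, i ∈ Finset.range k → 1 ≤ i + 1 ∧ i + 1 ≤ k := fun hi => by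
    simp only [Finset.mem_range] at hi; omega
  set a : ℕ → ℝ := fun k => ∑ i ∈ Finset.range k, ρ k (i + 1) with ha
  set own : ℕ → ℝ := fun k => ∑ i ∈ Finset.range k, ρ k (i + 1) * (q k (i + 1) + π.y k (i + 1))
    with hown
  set oz : ℕ → ℝ := fun k => ∑ i ∈ Finset.range k, ρ k (i + 1) * (M.joinRate π k * π.z k (i + 1))
    with hoz
  have hzero : a k = 0 := by
    refine eq_zero_of_flow_balance (p := p) (dep := M.departureRate π) (b := M.growthRate π)
      (own := own) (oz := oz) (Λ := Λ) hp.2.summable hp.1 (M.growthRate_nonneg hπ)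
      (fun k => (M.growthRate_le hπ k).trans (hΛ k)) (M.departureRate_pos hπ)
      hgen.growthRate_mul ?_ ?_ ?_ ?_ ?_ ?_ k
    · exact fun k => Finset.sum_nonneg fun i hi => hρ0 _ _ (hmem hi)
    · intro k
      refine (Finset.sum_le_card_nsmul _ _ (p k) fun i hi => hρp _ _ (hmem hi)).trans ?_
      simp
    · exact fun k => Finset.sum_nonneg fun i hi => mul_nonneg (hρ0 _ _ (hmem hi))
        (leaveRate_nonneg hπ hq (Finset.mem_Icc.2 (hmem hi)))
    · exact fun k => Finset.sum_nonneg fun i hi => mul_nonneg (hρ0 _ _ (hmem hi))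
        (mul_nonneg (M.joinRate_nonneg hπ k) (hπ.z_mem k _ (Finset.mem_Icc.2 (hmem hi))).1)
    · have h1 := aheadRate_self (π := π) hq 1
      rw [show (1 : ℕ) = 0 + 1 from rfl, aheadRate_succ] at h1
      simp only [aheadRate_zero, zero_add] at h1
      simp [hown, ha, ← h1, mul_comm]
    · intro n
      have hsum : ∑ i ∈ Finset.range (n + 1), ρ (n + 1) (i + 1) * M.changeRate π (n + 1) (i + 1)
          = ∑ i ∈ Finset.range (n + 1), M.inflow π q ρ (n + 1) (i + 1) :=
        Finset.sum_congr rfl fun i hi => hρ _ _ (hmem hi)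
      simp only [QueueModel.inflow, Finset.sum_add_distrib] at hsum
      -- The added term is zero because nobody is ahead of the first position; in the next sum,
      -- nobody is behind the last one.
      have e1 : ∑ i ∈ Finset.range (n + 1),
            ρ (n + 1 + 1) (i + 1 + 1) * aheadRate π q (n + 1 + 1) (i + 1)
          = ∑ i ∈ Finset.range (n + 2), ρ (n + 2) (i + 1) * aheadRate π q (n + 2) i := by
        rw [Finset.sum_range_succ' _ (n + 1)]; simp
      have e2 : ∑ i ∈ Finset.range (n + 1), ρ (n + 1 + 1) (i + 1)
            * (M.departureRate π (n + 1 + 1) - aheadRate π q (n + 1 + 1) (i + 1))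
          = ∑ i ∈ Finset.range (n + 2), ρ (n + 2) (i + 1)
            * (M.departureRate π (n + 2) - aheadRate π q (n + 2) (i + 1)) := by
        rw [Finset.sum_range_succ _ (n + 1), aheadRate_self hq]; simp
      have e3 : ∑ i ∈ Finset.range (n + 1), (if i + 1 < n + 1 then
            ρ (n + 1) (i + 1 + 1) * (M.joinRate π (n + 1) * aheadReplaced π (n + 1) (i + 1))
            + ρ (n + 1 - 1) (i + 1) * M.growthRate π (n + 1 - 1) else 0)
          = (∑ i ∈ Finset.range (n + 1),
              ρ (n + 1) (i + 1) * (M.joinRate π (n + 1) * aheadReplaced π (n + 1) i))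
            + M.growthRate π n * a n := by
        rw [Finset.sum_range_succ, Finset.sum_range_succ' _ n]
        simp only [lt_irrefl, if_false, add_zero, aheadReplaced_zero, mul_zero]
        rw [ha, Finset.mul_sum, ← Finset.sum_add_distrib]
        refine Finset.sum_congr rfl fun i hi => ?_
        have : i + 1 < n + 1 := by simp only [Finset.mem_range] at hi; omega
        simp only [if_pos this, Nat.add_sub_cancel]
        ring
      rw [e1, e2, e3] at hsum
      have e4 : ∑ i ∈ Finset.range (n + 1), ρ (n + 1) (i + 1) * M.changeRate π (n + 1) (i + 1)
          = M.departureRate π (n + 1) * a (n + 1) + oz (n + 1) + (∑ i ∈ Finset.range (n + 1),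
              ρ (n + 1) (i + 1) * (M.joinRate π (n + 1) * aheadReplaced π (n + 1) i))
            + M.growthRate π (n + 1) * a (n + 1) := by
        rw [ha, hoz, Finset.mul_sum, Finset.mul_sum, ← Finset.sum_add_distrib,
          ← Finset.sum_add_distrib, ← Finset.sum_add_distrib]
        refine Finset.sum_congr rfl fun i _ => ?_
        rw [QueueModel.changeRate, aheadReplaced_succ]
        ring
      -- A member passes from level `n + 2` to `n + 1` at each departure other than her own.
      have e5 : ∑ i ∈ Finset.range (n + 2), ρ (n + 2) (i + 1) * aheadRate π q (n + 2) i
          + ∑ i ∈ Finset.range (n + 2), ρ (n + 2) (i + 1)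
            * (M.departureRate π (n + 2) - aheadRate π q (n + 2) (i + 1))
          = M.departureRate π (n + 2) * a (n + 2) - own (n + 2) := by
        rw [ha, hown, Finset.mul_sum, ← Finset.sum_add_distrib, ← Finset.sum_sub_distrib]
        refine Finset.sum_congr rfl fun i _ => ?_
        rw [aheadRate_succ]
        ring
      linarith
  obtain ⟨i, rfl⟩ : ∃ i, ℓ = i + 1 := ⟨ℓ - 1, by omega⟩
  exact (Finset.sum_eq_zero_iff_of_nonneg fun i hi => hρ0 _ _ (hmem hi)).1 hzero i
    (Finset.mem_range.2 (by omega))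

variable (M π p) in
/-- Flow of agents who enter the queue, by their state on entry. -/
def QueueModel.immigration : AgentState → ℝ≥0∞
  | .waiting k ℓ => if 1 ≤ k ∧ ℓ = k then ENNReal.ofReal (M.entryFlow π p k ℓ) else 0
  | .served => 0
  | .removed => 0

theorem QueueModel.entryFlow_nonneg (hπ : π.Feasible) (hp : IsDistribution p) (k ℓ : ℕ) :
    0 ≤ M.entryFlow π p k ℓ := by
  have h1 := mul_nonneg (hp.1 (k - 1)) (M.growthRate_nonneg hπ (k - 1))
  have h2 := mul_nonneg (hp.1 k) (mul_nonneg (M.joinRate_nonneg hπ k) (hπ.zTot_nonneg k))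
  unfold QueueModel.entryFlow
  split_ifs <;> positivity

theorem QueueModel.immigration_waiting {k ℓ : ℕ} (h : 1 ≤ ℓ ∧ ℓ ≤ k) :
    M.immigration π p (.waiting k ℓ) = ENNReal.ofReal (M.entryFlow π p k ℓ) := by
  unfold QueueModel.immigration QueueModel.entryFlow
  by_cases hl : ℓ = k
  · simp [hl, show 1 ≤ k by omega]
  · simp [hl]

/-- In steady state, the mean number of agents in position `ℓ` of a queue of length `k` is `p k`. -/
theorem occupation_waiting (hπ : π.Feasible) (hq : M.IsQueueingRule q)
    (hΛ : ∀ k, M.arr k ≤ Λ) (hp : IsDistribution p) (hgen : M.Generates π p)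
    {k ℓ : ℕ} (h : 1 ≤ ℓ ∧ ℓ ≤ k) :
    occupation (M.jumpRate π q) (M.immigration π p) (.waiting k ℓ) = ENNReal.ofReal (p k) := by
  set Q := M.jumpRate π q
  set e := M.immigration π p
  have he : ∀ {k ℓ : ℕ}, 1 ≤ ℓ ∧ ℓ ≤ k →
      e (.waiting k ℓ) = ENNReal.ofReal (M.entryFlow π p k ℓ) := M.immigration_waiting
  have hfin := exitRate_ne_top (M := M) hπ hq
  have hne : ∀ {k ℓ : ℕ}, 1 ≤ ℓ ∧ ℓ ≤ k → exitRate Q (.waiting k ℓ) ≠ 0 := fun {k ℓ} h =>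
    (exitRate_ne_zero_iff hπ hq _).2 ⟨k, ℓ, rfl, h⟩
  -- By minimality of the occupation measure, as `p` solves the same forward equation.
  have hle : ∀ k ℓ, 1 ≤ ℓ ∧ ℓ ≤ k → occupation Q e (.waiting k ℓ) ≤ ENNReal.ofReal (p k) := by
    intro k ℓ h
    refine occupation_le Q e hfin (ν := fun s => match s with
      | .waiting k _ => ENNReal.ofReal (p k)
      | .served => 0
      | .removed => 0) (fun s' hs' => ?_) (hne h)
    obtain ⟨k, ℓ, rfl, h⟩ := (exitRate_ne_zero_iff hπ hq _).1 hs'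
    obtain ⟨h1, h2⟩ := tsum_mul_jumpRate_eq_inflow hπ hq h (G := fun s => match s with
      | .waiting k _ => ENNReal.ofReal (p k)
      | .served => 0
      | .removed => 0) (g := fun k _ => p k) (fun k _ _ => hp.1 k) (fun _ _ _ => rfl)
    rw [h2, he h, exitRate_waiting hπ hq h,
      ← ENNReal.ofReal_add (M.entryFlow_nonneg hπ hp k ℓ) h1, ← queueLength_balance q hgen h,
      ENNReal.ofReal_mul (hp.1 k)]
  set v : ℕ → ℕ → ℝ := fun k ℓ => (occupation Q e (.waiting k ℓ)).toReal
  have hv : ∀ k ℓ, 1 ≤ ℓ ∧ ℓ ≤ k → occupation Q e (.waiting k ℓ) = ENNReal.ofReal (v k ℓ) :=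
    fun k ℓ h => (ENNReal.ofReal_toReal
      (ne_top_of_le_ne_top ENNReal.ofReal_ne_top (hle k ℓ h))).symm
  have hv0 : ∀ k ℓ, 0 ≤ v k ℓ := fun _ _ => ENNReal.toReal_nonneg
  have hveq : ∀ k ℓ, 1 ≤ ℓ ∧ ℓ ≤ k →
      v k ℓ * M.changeRate π k ℓ = M.entryFlow π p k ℓ + M.inflow π q v k ℓ := by
    intro k ℓ h
    have h0 := occupation_mul_exitRate Q e hfin (hne h)
    obtain ⟨h1, h2⟩ := tsum_mul_jumpRate_eq_inflow hπ hq h (fun k ℓ _ => hv0 k ℓ) hv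
    rw [h2, hv k ℓ h, exitRate_waiting hπ hq h, he h,
      ← ENNReal.ofReal_add (M.entryFlow_nonneg hπ hp k ℓ) h1, ← ENNReal.ofReal_mul (hv0 k ℓ)] at h0
    exact (ENNReal.ofReal_eq_ofReal_iff (mul_nonneg (hv0 k ℓ) (M.changeRate_pos hπ h).le)
      (add_nonneg (M.entryFlow_nonneg hπ hp k ℓ) h1)).1 h0
  -- Subtracting the two forward equations cancels the immigration term, so the gap is a population
  -- without entrants.
  have hzero := eq_zero_of_inflow_eq hπ hq hΛ hp hgen (ρ := fun k ℓ => p k - v k ℓ)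
    (fun k ℓ h => ?_) (fun k ℓ h => ?_) (fun k ℓ h => ?_) h
  · rw [hv k ℓ h, ← sub_eq_zero.1 hzero]
  · exact sub_nonneg.2 ((ENNReal.ofReal_le_ofReal_iff (hp.1 k)).1 (hv k ℓ h ▸ hle k ℓ h))
  · linarith [hv0 k ℓ]
  · have h1 := queueLength_balance q hgen h
    have h2 := hveq k ℓ h
    simp only [QueueModel.inflow] at h1 h2 ⊢
    split_ifs at h1 h2 ⊢ <;> linear_combination h1 - h2

theorem tsum_triangle (f : ℕ → ℕ → ℝ≥0∞) :
    ∑' s : ℕ × ℕ, (if 1 ≤ s.2 ∧ s.2 ≤ s.1 then f s.1 s.2 else 0)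
      = ∑' k, ∑ ℓ ∈ Finset.Icc 1 k, f k ℓ := by
  rw [ENNReal.tsum_prod']
  refine tsum_congr fun k => ?_
  rw [tsum_eq_sum (s := Finset.Icc 1 k) (fun ℓ hℓ => by
    rw [Finset.mem_Icc] at hℓ; simp only [if_neg hℓ])]
  refine Finset.sum_congr rfl fun ℓ hℓ => ?_
  rw [Finset.mem_Icc] at hℓ
  simp only [if_pos hℓ]

/-- The indicator function of the states in which the agent is in the queue. -/
def waitingIndicator : AgentState → ℝ≥0∞
  | .waiting _ _ => 1
  | _ => 0

theorem waitTime_eq (s : ℕ × ℕ) : M.waitTime π q s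
    = ⨆ n, potentialIter (M.jumpRate π q) waitingIndicator n (.waiting s.1 s.2) := by
  rw [← lintegral_transProb, QueueModel.waitTime]
  refine lintegral_congr fun t => ?_
  rw [tsum_agentState]
  simp [waitingIndicator, QueueModel.agentProb]

/-- An upper bound suffices for the aggregate constraint, and as a potential it can be integrated
against the occupation measure. -/
theorem serviceProb_le (hπ : π.Feasible) (hq : M.IsQueueingRule q) (s : ℕ × ℕ) :
    M.serviceProb π q s ≤ ⨆ n, potentialIter (M.jumpRate π q)
      (fun w => M.jumpRate π q w .served) n (.waiting s.1 s.2) :=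
  iSup_le fun t => transProb_le_potential _ (exitRate_ne_top hπ hq) exitRate_served (by simp) t

theorem tsum_immigration_mul (g : AgentState → ℝ≥0∞) :
    ∑' s, M.immigration π p s * g s
      = ∑' s : ℕ × ℕ, M.immigration π p (.waiting s.1 s.2) * g (.waiting s.1 s.2) := by
  rw [tsum_agentState]
  simp [QueueModel.immigration]

/-- Little's law: the mean number of agents in the queue is the entry flow times the mean wait. -/
theorem meanQueueLength_le (hπ : π.Feasible) (hq : M.IsQueueingRule q)
    (hΛ : ∀ k, M.arr k ≤ Λ) (hp : IsDistribution p) (hgen : M.Generates π p) :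
    ∑' k : ℕ, (k : ℝ≥0∞) * ENNReal.ofReal (p k)
      ≤ ∑' s : ℕ × ℕ, M.immigration π p (.waiting s.1 s.2) * M.waitTime π q s := by
  simp_rw [waitTime_eq]
  rw [← tsum_immigration_mul (fun s => ⨆ n, potentialIter (M.jumpRate π q) waitingIndicator n s),
    tsum_mul_iSup_potentialIter, tsum_agentState]
  refine le_trans ?_ le_self_add
  have h := tsum_triangle fun k _ => ENNReal.ofReal (p k)
  simp only [Finset.sum_const, Nat.card_Icc, Nat.add_sub_cancel, nsmul_eq_mul] at h
  rw [← h]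
  refine ENNReal.tsum_le_tsum fun s => ?_
  split_ifs with hs
  · simp [occupation_waiting hπ hq hΛ hp hgen hs, waitingIndicator]
  · exact zero_le

/-- The flow of agents who enter and are eventually served is at most the flow of services. -/
theorem serviceFlow_le (hπ : π.Feasible) (hq : M.IsQueueingRule q)
    (hΛ : ∀ k, M.arr k ≤ Λ) (hp : IsDistribution p) (hgen : M.Generates π p) :
    ∑' s : ℕ × ℕ, M.immigration π p (.waiting s.1 s.2) * M.serviceProb π q s
      ≤ ∑' k : ℕ, ENNReal.ofReal (p k * M.srv k) := by
  refine (ENNReal.tsum_le_tsum fun s => mul_le_mul_right (serviceProb_le hπ hq s) _).trans ?_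
  rw [← tsum_immigration_mul (fun s => ⨆ n, potentialIter (M.jumpRate π q)
      (fun w => M.jumpRate π q w .served) n s),
    tsum_mul_iSup_potentialIter, tsum_agentState]
  simp only [jumpRate_served, jumpRate_removed, mul_zero, add_zero]
  refine le_of_eq ?_
  trans ∑' s : ℕ × ℕ, (if 1 ≤ s.2 ∧ s.2 ≤ s.1 then ENNReal.ofReal (p s.1 * q s.1 s.2) else 0)
  · refine tsum_congr fun s => ?_
    split_ifs with hs
    · have h1 : M.jumpRate π q (.waiting s.1 s.2) .served = ENNReal.ofReal (q s.1 s.2) := by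
        simp [QueueModel.jumpRate, if_pos hs]
      rw [h1, occupation_waiting hπ hq hΛ hp hgen hs, ENNReal.ofReal_mul (hp.1 _)]
    · simp [jumpRate_invalid M π q hs]
  · rw [tsum_triangle fun k ℓ => ENNReal.ofReal (p k * q k ℓ)]
    refine tsum_congr fun k => ?_
    rw [← ENNReal.ofReal_sum_of_nonneg fun ℓ hℓ => mul_nonneg (hp.1 k) (hq.nonneg k ℓ hℓ),
      ← Finset.mul_sum, hq.workConserving]

end Little

/-! ### Feasible designs are feasible for the relaxed problem -/

section Relaxed

variable {M : QueueModel} {π : EntryExit} {q : ℕ → ℕ → ℝ} {p : ℕ → ℝ} {Λ : ℝ}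

/-- Regularity makes `arr - srv` nonincreasing from length 1 on, and `srv` is bounded. -/
theorem QueueModel.IsRegular.arr_bounded (hreg : M.IsRegular) : ∃ Λ, ∀ k, M.arr k ≤ Λ := by
  obtain ⟨b, hb⟩ := M.srv_bdd
  have hb' : ∀ k, M.srv k ≤ b := fun k => hb ⟨k, rfl⟩
  have h : ∀ k, M.arr (k + 1) ≤ M.arr 1 + M.srv (k + 1) - M.srv 1 := by
    intro k
    induction k with
    | zero => simp
    | succ n ih =>
      have := hreg.2 (n + 2) (by omega)
      simp only [show n + 2 - 1 = n + 1 by omega] at this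
      linarith
  refine ⟨max (M.arr 0) (M.arr 1 + b - M.srv 1), fun k => ?_⟩
  cases k with
  | zero => exact le_max_left _ _
  | succ n => exact le_max_of_le_right (by linarith [h n, hb' (n + 1)])

theorem entryBelief_mul_entryRate (hπ : π.Feasible) (hp : IsDistribution p)
    (hE0 : M.entryRate π p ≠ 0) (hE1 : M.entryRate π p ≠ ∞) (s : ℕ × ℕ) :
    M.entryBelief π p s * M.entryRate π p = M.immigration π p (.waiting s.1 s.2) := by
  rw [QueueModel.entryBelief, ENNReal.div_mul_cancel hE0 hE1]
  simp only [QueueModel.immigration]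
  split_ifs with h
  · rw [QueueModel.entryFlow, if_pos h.2, ENNReal.ofReal_add
      (mul_nonneg (hp.1 _) (M.growthRate_nonneg hπ _))
      (mul_nonneg (hp.1 _) (mul_nonneg (M.joinRate_nonneg hπ _) (hπ.zTot_nonneg _)))]
    simp only [QueueModel.growthRate, QueueModel.joinRate, mul_assoc]
  · rfl

theorem entryRate_ne_top (hπ : π.Feasible) (hΛ : ∀ k, M.arr k ≤ Λ) (hp : IsDistribution p) :
    M.entryRate π p ≠ ∞ := by
  have hs : Summable fun k => p k * Λ := hp.2.summable.mul_right Λ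
  refine ne_top_of_le_ne_top hs.tsum_ofReal_ne_top (ENNReal.tsum_le_tsum fun k => ?_)
  refine ENNReal.ofReal_le_ofReal ?_
  rw [mul_assoc]
  exact mul_le_mul_of_nonneg_left
    ((mul_le_of_le_one_right (M.arr_nonneg k) (hπ.x_mem k).2).trans (hΛ k)) (hp.1 k)

theorem tsum_diagonal (f : ℕ → ℝ≥0∞) :
    ∑' s : ℕ × ℕ, (if 1 ≤ s.1 ∧ s.2 = s.1 then f s.1 else 0) = ∑' k, f (k + 1) := by
  rw [ENNReal.tsum_prod']
  have : ∀ k, ∑' ℓ, (if 1 ≤ k ∧ ℓ = k then f k else 0) = if 1 ≤ k then f k else 0 := by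
    intro k
    rw [tsum_eq_single k (fun ℓ hℓ => by simp [hℓ])]
    simp
  simp only [this]
  rw [tsum_eq_zero_add' ENNReal.summable]
  simp

theorem tsum_immigration (hπ : π.Feasible) (hp : IsDistribution p) :
    ∑' s : ℕ × ℕ, M.immigration π p (.waiting s.1 s.2) = M.entryRate π p := by
  have h1 : ∀ k, 0 ≤ p k * M.growthRate π k := fun k =>
    mul_nonneg (hp.1 _) (M.growthRate_nonneg hπ _)
  have h2 : ∀ k, 0 ≤ p k * (M.joinRate π k * π.zTot k) := fun k =>
    mul_nonneg (hp.1 _) (mul_nonneg (M.joinRate_nonneg hπ _) (hπ.zTot_nonneg _))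
  have h3 : ∀ s : ℕ × ℕ, M.immigration π p (.waiting s.1 s.2) = if 1 ≤ s.1 ∧ s.2 = s.1 then
      ENNReal.ofReal (p (s.1 - 1) * M.growthRate π (s.1 - 1))
        + ENNReal.ofReal (p s.1 * (M.joinRate π s.1 * π.zTot s.1)) else 0 := by
    intro s
    simp only [QueueModel.immigration]
    split_ifs with h
    · rw [QueueModel.entryFlow, if_pos h.2, ENNReal.ofReal_add (h1 _) (h2 _)]
    · rfl
  simp only [h3]
  rw [tsum_diagonal fun k => ENNReal.ofReal (p (k - 1) * M.growthRate π (k - 1))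
        + ENNReal.ofReal (p k * (M.joinRate π k * π.zTot k)), ENNReal.tsum_add]
  have h4 : ∑' k, ENNReal.ofReal (p (k + 1) * (M.joinRate π (k + 1) * π.zTot (k + 1)))
      = ∑' k, ENNReal.ofReal (p k * (M.joinRate π k * π.zTot k)) := by
    rw [tsum_eq_zero_add' (f := fun k => ENNReal.ofReal (p k * (M.joinRate π k * π.zTot k)))
      ENNReal.summable]
    simp [EntryExit.zTot]
  rw [h4, ← ENNReal.tsum_add]
  refine tsum_congr fun k => ?_
  rw [Nat.add_sub_cancel, ← ENNReal.ofReal_add (h1 k) (h2 k)]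
  congr 1
  simp only [QueueModel.growthRate, QueueModel.joinRate]
  ring

theorem tsum_entryBelief (hπ : π.Feasible) (hp : IsDistribution p)
    (hE0 : M.entryRate π p ≠ 0) (hE1 : M.entryRate π p ≠ ∞) :
    ∑' s, M.entryBelief π p s = 1 := by
  rw [← ENNReal.mul_left_inj hE0 hE1, ← ENNReal.tsum_mul_right, one_mul]
  simp_rw [entryBelief_mul_entryRate hπ hp hE0 hE1]
  exact tsum_immigration hπ hp

theorem noInfoBelief_zero (q : ℕ → ℕ → ℝ) (hπ : π.Feasible) (hp : IsDistribution p)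
    (hE0 : M.entryRate π p ≠ 0) (hE1 : M.entryRate π p ≠ ∞) (s : ℕ × ℕ) :
    M.noInfoBelief π q p 0 s = M.entryBelief π p s := by
  classical
  have h : ∀ s, M.stayMass π q p 0 s = M.entryBelief π p s := by
    intro s
    simp only [QueueModel.stayMass, QueueModel.agentProb, transProb_time_zero]
    rw [tsum_eq_single s]
    · simp
    · intro s' hs'
      have : ¬(s'.1 = s.1 ∧ s'.2 = s.2) := fun h => hs' (Prod.ext h.1 h.2)
      simp [this]
  simp only [QueueModel.noInfoBelief, h, tsum_entryBelief hπ hp hE0 hE1, div_one]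

/-- Obedience on entry implies individual rationality in the aggregate. -/
theorem QueueModel.DesignFeasible.waitingCost_le {I : InfoRule} (hΛ : ∀ k, M.arr k ≤ Λ)
    (h : M.DesignFeasible p π q I) :
    ENNReal.ofReal M.C * ∑' k : ℕ, (k : ℝ≥0∞) * ENNReal.ofReal (p k)
      ≤ ENNReal.ofReal M.V * ∑' k : ℕ, ENNReal.ofReal (p k * M.srv k) := by
  have hπ := h.entryExit
  have hp := h.dist
  -- Without entry, balance empties every positive length, so there is no waiting cost.
  by_cases hE0 : M.entryRate π p = 0
  · have h1 : ∀ k, p (k + 1) = 0 := by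
      intro k
      have h2 := ENNReal.tsum_eq_zero.1 hE0 k
      rw [ENNReal.ofReal_eq_zero, mul_assoc] at h2
      have h3 : p k * M.joinRate π k = 0 :=
        le_antisymm h2 (mul_nonneg (hp.1 k) (M.joinRate_nonneg hπ k))
      have h4 := h.balance.growthRate_mul k
      have h5 : M.growthRate π k * p k = 0 := by
        rw [show M.growthRate π k = M.joinRate π k * (1 - π.zTot k) from rfl]
        linear_combination (1 - π.zTot k) * h3
      rw [h5] at h4
      simpa [(M.departureRate_pos hπ k).ne'] using h4.symm
    have h2 : ∑' k : ℕ, (k : ℝ≥0∞) * ENNReal.ofReal (p k) = 0 := by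
      refine ENNReal.tsum_eq_zero.2 fun k => ?_
      cases k with
      | zero => simp
      | succ n => simp [h1]
    simp [h2]
  have hE1 := entryRate_ne_top hπ hΛ hp
  have hIC := lintegral_le_of_support _ (h.info hE0 0 le_rfl) (h.obedience 0 le_rfl hE0)
  simp_rw [noInfoBelief_zero q hπ hp hE0 hE1] at hIC
  -- Multiplication by the entry rate turns averages over entrants into flows, which Little's law
  -- converts into stocks.
  have hIC' := mul_le_mul_left hIC (M.entryRate π p)
  simp_rw [← ENNReal.tsum_mul_right, mul_right_comm (M.entryBelief π p _),
    entryBelief_mul_entryRate hπ hp hE0 hE1, mul_left_comm _ (ENNReal.ofReal _),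
    ENNReal.tsum_mul_left] at hIC'
  calc _ ≤ _ := mul_le_mul_right (meanQueueLength_le hπ h.queueing hΛ hp h.balance) _
    _ ≤ _ := hIC'
    _ ≤ _ := mul_le_mul_right (serviceFlow_le hπ h.queueing hΛ hp h.balance) _

theorem summable_mul_srv (hp : IsDistribution p) : Summable fun k => p k * M.srv k := by
  obtain ⟨b, hb⟩ := M.srv_bdd
  refine Summable.of_nonneg_of_le (fun k => mul_nonneg (hp.1 k) ?_) (fun k => ?_)
    (hp.2.summable.mul_right b)
  · exact M.srv_zero ▸ M.srv_mono (Nat.zero_le k)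
  · exact mul_le_mul_of_nonneg_left (hb ⟨k, rfl⟩) (hp.1 k)

theorem QueueModel.srv_nonneg (M : QueueModel) (k : ℕ) : 0 ≤ M.srv k :=
  M.srv_zero ▸ M.srv_mono (Nat.zero_le k)

/-- The service term is finite, so the cost bound forces a finite mean queue length; this gives the
summability in the rationality constraint. The balance inequality follows since exit can only lower
growth and raise departures. -/
theorem QueueModel.DesignFeasible.relaxedFeasible {I : InfoRule} (hΛ : ∀ k, M.arr k ≤ Λ)
    (h : M.DesignFeasible p π q I) : M.RelaxedFeasible p := by
  have hp := h.dist
  have hπ := h.entryExit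
  have hs := summable_mul_srv (M := M) hp
  have hcost := h.waitingCost_le hΛ
  have hC : ENNReal.ofReal M.C ≠ 0 := by simpa using M.C_pos
  have hcast : ∀ k : ℕ, (k : ℝ≥0∞) * ENNReal.ofReal (p k) = ENNReal.ofReal (k * p k) := fun k => by
    rw [ENNReal.ofReal_mul (Nat.cast_nonneg k), ENNReal.ofReal_natCast]
  simp_rw [hcast] at hcost
  have hfin : ∑' k : ℕ, ENNReal.ofReal (k * p k) ≠ ∞ := by
    intro htop
    rw [htop, ENNReal.mul_top hC, top_le_iff] at hcost
    exact ENNReal.mul_ne_top ENNReal.ofReal_ne_top hs.tsum_ofReal_ne_top hcost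
  have hk : Summable fun k : ℕ => (k : ℝ) * p k := by
    have h1 := ENNReal.summable_toReal hfin
    refine h1.congr fun k => ENNReal.toReal_ofReal (mul_nonneg (Nat.cast_nonneg k) (hp.1 k))
  have hsum : HasSum (fun k : ℕ => p k * (M.srv k * M.V - k * M.C))
      (M.V * (∑' k, p k * M.srv k) - M.C * ∑' k : ℕ, (k : ℝ) * p k) := by
    refine ((hs.hasSum.mul_left M.V).sub (hk.hasSum.mul_left M.C)).congr_fun fun k => ?_
    ring
  refine ⟨hp, hsum.summable, ?_, fun k => ?_⟩
  · rw [hsum.tsum_eq, sub_nonneg]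
    rw [← ENNReal.ofReal_tsum_of_nonneg (fun k => mul_nonneg (Nat.cast_nonneg k) (hp.1 k)) hk,
      ← ENNReal.ofReal_tsum_of_nonneg (fun k => mul_nonneg (hp.1 k) (M.srv_nonneg k)) hs,
      ← ENNReal.ofReal_mul M.C_pos.le, ← ENNReal.ofReal_mul M.V_pos.le] at hcost
    exact (ENNReal.ofReal_le_ofReal_iff (mul_nonneg M.V_pos.le (tsum_nonneg fun k =>
      mul_nonneg (hp.1 k) (M.srv_nonneg k)))).1 hcost
  · have h1 := h.balance.growthRate_mul k
    have h2 := mul_le_mul_of_nonneg_right (M.growthRate_le hπ k) (hp.1 k)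
    have h3 : M.srv (k + 1) * p (k + 1) ≤ M.departureRate π (k + 1) * p (k + 1) :=
      mul_le_mul_of_nonneg_right (le_add_of_nonneg_right (hπ.yTot_nonneg _)) (hp.1 _)
    linarith

end Relaxed

/-! ### First-come-first-served: feasibility, waits and certain service -/

section FCFS

variable {M : QueueModel} {π : EntryExit} {p : ℕ → ℝ} {Λ : ℝ}

theorem QueueModel.IsRegularService.antitone (hreg : M.IsRegularService) {i j : ℕ} (hi : 1 ≤ i)
    (hij : i ≤ j) : M.srv j - M.srv (j - 1) ≤ M.srv i - M.srv (i - 1) := by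
  induction j, hij using Nat.le_induction with
  | base => rfl
  | succ n hn ih =>
    have := hreg n (by omega)
    rw [Nat.add_sub_cancel]
    exact this.trans ih

/-- Concavity from zero: the next increment is at most the average of the earlier ones. -/
theorem QueueModel.IsRegularService.mul_le (hreg : M.IsRegularService) (j : ℕ) :
    j * (M.srv (j + 1) - M.srv j) ≤ M.srv j := by
  induction j with
  | zero => simp [M.srv_zero]
  | succ n ih =>
    have h1 := hreg (n + 1) (by omega)
    rw [Nat.add_sub_cancel] at h1
    have h2 := mul_le_mul_of_nonneg_left h1 (by positivity : (0 : ℝ) ≤ n + 1)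
    push_cast
    linarith

theorem QueueModel.IsRegularService.div_srv_mono (hreg : M.IsRegularService) {i j : ℕ}
    (hi : 1 ≤ i) (hij : i ≤ j) : (i : ℝ) / M.srv i ≤ j / M.srv j := by
  induction j, hij using Nat.le_induction with
  | base => rfl
  | succ n hn ih =>
    refine ih.trans ?_
    rw [div_le_div_iff₀ (M.srv_pos n (by omega)) (M.srv_pos _ (by omega))]
    have := hreg.mul_le n
    push_cast
    linarith

/-- Remove the last position `k + 1` from `S`: its increment is at most the increment of `srv` at
`S.card`, because `S.card ≤ k + 1` and increments are nonincreasing. -/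
theorem QueueModel.IsRegularService.sum_fcfs_le (hreg : M.IsRegularService) (k : ℕ) :
    ∀ S ⊆ Finset.Icc 1 k, ∑ ℓ ∈ S, (M.srv ℓ - M.srv (ℓ - 1)) ≤ M.srv S.card := by
  induction k with
  | zero =>
    intro S hS
    have : S = ∅ := by simpa using hS
    simp [this, M.srv_zero]
  | succ k ih =>
    intro S hS
    have herase : S.erase (k + 1) ⊆ Finset.Icc 1 k := fun i hi => by
      have h1 := hS (Finset.mem_of_mem_erase hi)
      have h2 := Finset.ne_of_mem_erase hi
      simp only [Finset.mem_Icc] at h1 ⊢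
      omega
    by_cases hk : k + 1 ∈ S
    · rw [← Finset.add_sum_erase S _ hk]
      have h1 := ih _ herase
      have hcard := Finset.card_erase_add_one hk
      have hle : (S.erase (k + 1)).card ≤ k := by simpa using Finset.card_le_card herase
      have h2 := hreg.antitone (i := (S.erase (k + 1)).card + 1) (j := k + 1) (by omega) (by omega)
      rw [Nat.add_sub_cancel, Nat.add_sub_cancel] at h2
      rw [← hcard, Nat.add_sub_cancel]
      linarith
    · rw [Finset.erase_eq_of_notMem hk] at herase
      exact ih S herase

theorem sum_fcfs (M : QueueModel) (k : ℕ) :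
    ∑ ℓ ∈ Finset.Icc 1 k, (M.srv ℓ - M.srv (ℓ - 1)) = M.srv k := by
  induction k with
  | zero => simp [M.srv_zero]
  | succ k ih => rw [Finset.sum_Icc_succ_top (by omega), ih, Nat.add_sub_cancel]; ring

theorem QueueModel.IsRegularService.isQueueingRule_fcfs (hreg : M.IsRegularService) :
    M.IsQueueingRule M.fcfs where
  nonneg _ ℓ _ := sub_nonneg.2 (M.srv_mono (Nat.sub_le ℓ 1))
  feasible k := hreg.sum_fcfs_le k
  workConserving := sum_fcfs M

theorem zTot_eq_zero (hyz : ∀ k ℓ, π.y k ℓ = 0 ∧ π.z k ℓ = 0) (k : ℕ) : π.zTot k = 0 := by simp [EntryExit.zTot, hyz]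

theorem yTot_eq_zero (hyz : ∀ k ℓ, π.y k ℓ = 0 ∧ π.z k ℓ = 0) (k : ℕ) : π.yTot k = 0 := by simp [EntryExit.yTot, hyz]

theorem aheadRate_fcfs (hyz : ∀ k ℓ, π.y k ℓ = 0 ∧ π.z k ℓ = 0) (k i : ℕ) : aheadRate π M.fcfs k i = M.srv i := by
  simp only [aheadRate, QueueModel.fcfs, hyz, add_zero, Ico_one_succ, sum_fcfs]

/-- Under first-come-first-served without exit, the position of an agent is an autonomous chain. -/
theorem tsum_jumpRate_fcfs_mul (hyz : ∀ k ℓ, π.y k ℓ = 0 ∧ π.z k ℓ = 0)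
    (hπ : π.Feasible) (hreg : M.IsRegularService) {k ℓ : ℕ}
    (h : 1 ≤ ℓ ∧ ℓ ≤ k) {g : AgentState → ℝ≥0∞} {f : ℕ → ℝ≥0∞}
    (hgf : ∀ k ℓ, 1 ≤ ℓ ∧ ℓ ≤ k → g (.waiting k ℓ) = f ℓ) :
    ∑' w, M.jumpRate π M.fcfs (.waiting k ℓ) w * g w
      = ENNReal.ofReal (M.srv ℓ - M.srv (ℓ - 1)) * g .served
        + ENNReal.ofReal (M.srv (ℓ - 1)) * f (ℓ - 1)
        + ENNReal.ofReal (M.srv k - M.srv ℓ + M.joinRate π k) * f ℓ := by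
  have hq := hreg.isQueueingRule_fcfs
  have hahead := aheadRate_fcfs (M := M) hyz k (ℓ - 1)
  simp only [aheadRate, Nat.sub_add_cancel h.1] at hahead
  rw [tsum_jumpRate_mul M π _ h, hahead, aheadRate_add_behind hq h.2, aheadRate_fcfs hyz,
    QueueModel.departureRate, yTot_eq_zero hyz, zTot_eq_zero hyz, hgf (k + 1) ℓ (by omega)]
  simp only [hyz, mul_zero, add_zero, Finset.sum_const_zero, ENNReal.ofReal_zero, zero_mul,
    sub_zero, mul_one]
  rw [ENNReal.ofReal_add (sub_nonneg.2 (M.srv_mono h.2)) (M.joinRate_nonneg hπ k), add_mul,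
    ← add_assoc]
  have e1 : ENNReal.ofReal (M.srv (ℓ - 1)) * g (.waiting (k - 1) (ℓ - 1))
      = ENNReal.ofReal (M.srv (ℓ - 1)) * f (ℓ - 1) := by
    by_cases hl : ℓ = 1
    · simp [hl, M.srv_zero]
    · rw [hgf _ _ (by omega)]
  have e2 : ENNReal.ofReal (M.srv k - M.srv ℓ) * g (.waiting (k - 1) ℓ)
      = ENNReal.ofReal (M.srv k - M.srv ℓ) * f ℓ := by
    by_cases hl : ℓ = k
    · simp [hl]
    · rw [hgf _ _ (by omega)]
  rw [e1, e2]
  rfl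

theorem exitRate_fcfs (hyz : ∀ k ℓ, π.y k ℓ = 0 ∧ π.z k ℓ = 0)
    (hπ : π.Feasible) (hreg : M.IsRegularService) {k ℓ : ℕ}
    (h : 1 ≤ ℓ ∧ ℓ ≤ k) :
    exitRate (M.jumpRate π M.fcfs) (.waiting k ℓ)
      = ENNReal.ofReal (M.srv k + M.joinRate π k) := by
  rw [exitRate_waiting hπ hreg.isQueueingRule_fcfs h]
  simp [QueueModel.changeRate, QueueModel.departureRate, yTot_eq_zero hyz, aheadReplaced, hyz,
    QueueModel.growthRate, zTot_eq_zero hyz, QueueModel.joinRate]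

/-- The candidate `ℓ / srv ℓ` solves the expected-time equation: at a real change of position, `1 +
(ℓ - 1) = srv ℓ * (ℓ / srv ℓ)`, and jumps of the length alone cancel. -/
theorem waitTime_fcfs_le (hyz : ∀ k ℓ, π.y k ℓ = 0 ∧ π.z k ℓ = 0)
    (hπ : π.Feasible) (hreg : M.IsRegularService) {s : ℕ × ℕ}
    (hs : 1 ≤ s.2 ∧ s.2 ≤ s.1) :
    M.waitTime π M.fcfs s ≤ ENNReal.ofReal (s.2 / M.srv s.2) := by
  have hq := hreg.isQueueingRule_fcfs
  rw [waitTime_eq]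
  -- Invalid pairs are absorbing but count as waiting, hence the value `∞` there.
  have key := iSup_potentialIter_le (M.jumpRate π M.fcfs) (exitRate_ne_top hπ hq)
    (φ := waitingIndicator) (g := fun s => match s with
      | .waiting k ℓ => if 1 ≤ ℓ ∧ ℓ ≤ k then ENNReal.ofReal (ℓ / M.srv ℓ) else ∞
      | _ => 0) ?_ ?_ (.waiting s.1 s.2)
  · simpa [hs] using key
  · intro s h0
    match s with
    | .served => left; rfl
    | .removed => left; rfl
    | .waiting k ℓ =>
      right
      by_contra hne
      refine (exitRate_ne_zero_iff (M := M) hπ hq (.waiting k ℓ)).2 ⟨k, ℓ, rfl, ?_⟩ h0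
      by_contra hv
      simp [hv] at hne
  · intro s h0
    obtain ⟨k, ℓ, rfl, h⟩ := (exitRate_ne_zero_iff hπ hq _).1 h0
    rw [tsum_jumpRate_fcfs_mul hyz hπ hreg h (f := fun ℓ => ENNReal.ofReal (ℓ / M.srv ℓ))
      (fun k ℓ h => by simp [h]), exitRate_fcfs hyz hπ hreg h]
    simp only [waitingIndicator, h, and_self, if_true, mul_zero, zero_add]
    have hℓ := M.srv_pos ℓ h.1
    have h1 : 0 ≤ (ℓ : ℝ) / M.srv ℓ := by positivity
    have h2 : 0 ≤ M.srv k - M.srv ℓ + M.joinRate π k :=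
      add_nonneg (sub_nonneg.2 (M.srv_mono h.2)) (M.joinRate_nonneg hπ k)
    have h3 : M.srv (ℓ - 1) * (((ℓ - 1 : ℕ) : ℝ) / M.srv (ℓ - 1)) = (ℓ - 1 : ℕ) := by
      by_cases hl : ℓ = 1
      · simp [hl]
      · exact mul_div_cancel₀ _ (M.srv_pos _ (by omega)).ne'
    rw [← ENNReal.ofReal_mul (M.srv_nonneg _), h3, ← ENNReal.ofReal_mul h2, ← ENNReal.ofReal_one,
      ← ENNReal.ofReal_add (Nat.cast_nonneg _) (mul_nonneg h2 h1),
      ← ENNReal.ofReal_add zero_le_one (add_nonneg (Nat.cast_nonneg _) (mul_nonneg h2 h1)),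
      ← ENNReal.ofReal_mul (add_nonneg (M.srv_nonneg k) (M.joinRate_nonneg hπ k))]
    refine ENNReal.ofReal_le_ofReal (le_of_eq ?_)
    rw [Nat.cast_sub h.1]
    field_simp
    push_cast
    ring

theorem jumpRate_removed_eq_zero (hyz : ∀ k ℓ, π.y k ℓ = 0 ∧ π.z k ℓ = 0)
    (s : AgentState) :
    M.jumpRate π M.fcfs s .removed = 0 := by
  match s with
  | .served => rfl
  | .removed => rfl
  | .waiting k ℓ => simp [QueueModel.jumpRate, hyz]

theorem exitRate_le_of_bounds (hyz : ∀ k ℓ, π.y k ℓ = 0 ∧ π.z k ℓ = 0)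
    (hπ : π.Feasible) (hreg : M.IsRegularService)
    {B : ℝ}
    (hB : ∀ k, M.srv k + M.joinRate π k ≤ B) (s : AgentState) :
    exitRate (M.jumpRate π M.fcfs) s ≤ ENNReal.ofReal B := by
  match s with
  | .served => simp [exitRate_served]
  | .removed => simp [exitRate_removed]
  | .waiting k ℓ =>
    by_cases h : 1 ≤ ℓ ∧ ℓ ≤ k
    · rw [exitRate_fcfs hyz hπ hreg h]
      exact ENNReal.ofReal_le_ofReal (hB k)
    · simp [exitRate_invalid h]

/-- Nobody is removed and no mass is lost, so a service probability below 1 would leave a fixed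
positive probability of waiting at every time. The mean wait would be infinite, against
`waitTime_fcfs_le`. -/
theorem one_le_serviceProb_fcfs (hyz : ∀ k ℓ, π.y k ℓ = 0 ∧ π.z k ℓ = 0)
    (hπ : π.Feasible) (hreg : M.IsRegularService) {B : ℝ}
    (hB0 : 0 < B) (hB : ∀ k, M.srv k + M.joinRate π k ≤ B) {s : ℕ × ℕ}
    (hs : 1 ≤ s.2 ∧ s.2 ≤ s.1) : 1 ≤ M.serviceProb π M.fcfs s := by
  have hq := hreg.isQueueingRule_fcfs
  by_contra! hlt
  have hmass : ∀ t : ℝ, 0 ≤ t → 1 - M.serviceProb π M.fcfs s ≤ ∑' s' : ℕ × ℕ,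
      M.agentProb π M.fcfs t (.waiting s.1 s.2) (.waiting s'.1 s'.2) := by
    intro t ht
    have h1 := tsum_transProb_eq_one (M.jumpRate π M.fcfs) hB0
      (exitRate_le_of_bounds hyz hπ hreg hB) ht (.waiting s.1 s.2)
    rw [tsum_agentState, transProb_eq_zero _ (exitRate_ne_top hπ hq) exitRate_removed
      (jumpRate_removed_eq_zero hyz) (by simp), add_zero] at h1
    rw [tsub_le_iff_right, ← h1]
    refine add_le_add le_rfl ?_
    exact le_iSup (fun t : Set.Ici (0 : ℝ) =>
      M.agentProb π M.fcfs t (.waiting s.1 s.2) .served) ⟨t, ht⟩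
  have hle := waitTime_fcfs_le hyz hπ hreg hs
  have htop : M.waitTime π M.fcfs s = ∞ := by
    rw [eq_top_iff]
    refine le_trans ?_ (setLIntegral_mono' measurableSet_Ici fun t ht => hmass t ht)
    rw [lintegral_const, Measure.restrict_apply_univ, Real.volume_Ici, ENNReal.mul_top]
    exact (tsub_pos_of_lt hlt).ne'
  rw [htop] at hle
  simp at hle

end FCFS

/-! ### Differentiation of exponential series with bounded coefficients -/

section ExponentialSeries

open Nat in
theorem summable_exponentialSeries {a : ℕ → ℝ} (ha : ∀ n, |a n| ≤ 1) (x : ℝ) :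
    Summable fun n => x ^ n / n ! * a n := by
  refine Summable.of_norm_bounded (Real.summable_pow_div_factorial |x|) fun n => ?_
  rw [Real.norm_eq_abs, abs_mul, abs_div, abs_pow, Nat.abs_cast]
  exact mul_le_of_le_one_right (by positivity) (ha n)

open Nat in
theorem hasDerivAt_exponentialSeries {a : ℕ → ℝ} (ha : ∀ n, |a n| ≤ 1) (x : ℝ) :
    HasDerivAt (fun x => ∑' n, x ^ n / n ! * a n) (∑' n, x ^ n / n ! * a (n + 1)) x := by
  set R := |x| + 1
  have hR : 0 ≤ R := by positivity
  set g' : ℕ → ℝ → ℝ := fun n y => n * y ^ (n - 1) / n ! * a n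
  have hg'succ : ∀ n y, g' (n + 1) y = y ^ n / n ! * a (n + 1) := by
    intro n y
    simp only [g', Nat.add_sub_cancel, Nat.factorial_succ]
    push_cast
    field_simp
  have hu : Summable fun n : ℕ => (n : ℝ) * R ^ (n - 1) / n ! := by
    rw [← summable_nat_add_iff 1]
    refine (Real.summable_pow_div_factorial R).congr fun n => ?_
    rw [Nat.add_sub_cancel, Nat.factorial_succ]
    push_cast
    field_simp
  have h := hasDerivAt_tsum_of_isPreconnected (g := fun n y => y ^ n / n ! * a n) (g' := g')
    (t := Metric.ball 0 R) (y₀ := 0) (y := x) hu Metric.isOpen_ball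
    (convex_ball (0 : ℝ) R).isPreconnected (fun n y _ => ?_) (fun n y hy => ?_)
    (Metric.mem_ball_self (by positivity)) (summable_exponentialSeries ha 0) (by simp [R])
  · refine h.congr_deriv ?_
    rw [tsum_eq_zero_add' (f := fun n => g' n x)]
    · simp only [hg'succ]
      simp [g']
    · simp only [hg'succ]
      exact summable_exponentialSeries (a := fun n => a (n + 1)) (fun n => ha (n + 1)) x
  · exact ((hasDerivAt_pow n y).div_const _).mul_const _
  · rw [Metric.mem_ball, _root_.dist_zero_right, Real.norm_eq_abs] at hy
    simp only [g', Real.norm_eq_abs, abs_mul, abs_div, abs_pow, Nat.abs_cast]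
    refine (mul_le_of_le_one_right (by positivity) (ha n)).trans ?_
    gcongr

end ExponentialSeries

/-! ### The position as an autonomous uniformized chain -/

section Position

variable (M : QueueModel) (B : ℝ)

/-- `n`-step transition probabilities of the position of an agent under first-come-first-served,
for the chain uniformized at rate `B`. -/
def positionKernel : ℕ → ℕ → ℕ → ℝ
  | 0, ℓ, j => if ℓ = j then 1 else 0
  | n + 1, ℓ, j => (1 - M.srv ℓ / B) * positionKernel n ℓ j
      + M.srv (ℓ - 1) / B * positionKernel n (ℓ - 1) j

/-- Probability that an agent in position `ℓ` is in position `j` after a time `t`. -/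
def positionProb (j : ℕ) (t : ℝ) (ℓ : ℕ) : ℝ :=
  Real.exp (-(B * t)) * ∑' n, (B * t) ^ n / n.factorial * positionKernel M B n ℓ j

variable {M B}

theorem positionKernel_mem (hB0 : 0 < B) (hB : ∀ k, M.srv k ≤ B) (n ℓ j : ℕ) :
    0 ≤ positionKernel M B n ℓ j ∧ positionKernel M B n ℓ j ≤ 1 := by
  induction n generalizing ℓ with
  | zero => simp only [positionKernel]; split_ifs <;> norm_num
  | succ n ih =>
    have h1 : 0 ≤ 1 - M.srv ℓ / B := sub_nonneg.2 ((div_le_one hB0).2 (hB ℓ))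
    have h2 : 0 ≤ M.srv (ℓ - 1) / B := div_nonneg (M.srv_nonneg _) hB0.le
    have h3 : M.srv (ℓ - 1) / B ≤ M.srv ℓ / B :=
      div_le_div_of_nonneg_right (M.srv_mono (Nat.sub_le ℓ 1)) hB0.le
    have h4 := mul_le_mul_of_nonneg_left (ih ℓ).2 h1
    have h5 := mul_le_mul_of_nonneg_left (ih (ℓ - 1)).2 h2
    rw [positionKernel]
    exact ⟨add_nonneg (mul_nonneg h1 (ih ℓ).1) (mul_nonneg h2 (ih (ℓ - 1)).1), by linarith⟩

theorem abs_positionKernel_le (hB0 : 0 < B) (hB : ∀ k, M.srv k ≤ B) (n ℓ j : ℕ) :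
    |positionKernel M B n ℓ j| ≤ 1 := by
  rw [abs_of_nonneg (positionKernel_mem hB0 hB n ℓ j).1]
  exact (positionKernel_mem hB0 hB n ℓ j).2

/-- The one-step kernel commutes with its powers, so the last step can be split off instead of the
first. -/
theorem positionKernel_succ_forward (n ℓ j : ℕ) :
    positionKernel M B (n + 1) ℓ j = (1 - M.srv j / B) * positionKernel M B n ℓ j
      + M.srv j / B * positionKernel M B n ℓ (j + 1) := by
  induction n generalizing ℓ with
  | zero =>
    simp only [positionKernel]
    by_cases h1 : ℓ = j
    · subst h1
      by_cases h2 : ℓ = 0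
      · simp [h2, M.srv_zero]
      · simp [show ℓ - 1 ≠ ℓ by omega]
    · by_cases h2 : ℓ = j + 1
      · subst h2; simp
      · by_cases h3 : ℓ = 0
        · subst h3
          simp [M.srv_zero, show (0 : ℕ) ≠ j by omega]
        · simp [h1, h2, show ℓ - 1 ≠ j by omega]
  | succ n ih =>
    have h1 : ∀ i, positionKernel M B (n + 1) ℓ i = (1 - M.srv ℓ / B) * positionKernel M B n ℓ i
      + M.srv (ℓ - 1) / B * positionKernel M B n (ℓ - 1) i := fun i => rfl
    rw [positionKernel]
    linear_combination (1 - M.srv ℓ / B) * ih ℓ + M.srv (ℓ - 1) / B * ih (ℓ - 1)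
      - (1 - M.srv j / B) * h1 j - M.srv j / B * h1 (j + 1)

theorem positionProb_nonneg (hB0 : 0 < B) (hB : ∀ k, M.srv k ≤ B) (j : ℕ) {t : ℝ} (ht : 0 ≤ t)
    (ℓ : ℕ) : 0 ≤ positionProb M B j t ℓ :=
  mul_nonneg (Real.exp_pos _).le (tsum_nonneg fun n => mul_nonneg
    (by positivity) (positionKernel_mem hB0 hB n ℓ j).1)

theorem positionProb_le_one (hB0 : 0 < B) (hB : ∀ k, M.srv k ≤ B) (j : ℕ) {t : ℝ} (ht : 0 ≤ t)
    (ℓ : ℕ) : positionProb M B j t ℓ ≤ 1 := by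
  have h1 : ∑' n, (B * t) ^ n / n.factorial * positionKernel M B n ℓ j ≤ Real.exp (B * t) := by
    rw [Real.exp_eq_exp_ℝ, NormedSpace.exp_eq_tsum_div]
    refine Summable.tsum_le_tsum (fun n => ?_)
      (summable_exponentialSeries (fun n => abs_positionKernel_le hB0 hB n ℓ j) _)
      (Real.summable_pow_div_factorial _)
    exact mul_le_of_le_one_right (by positivity) (positionKernel_mem hB0 hB n ℓ j).2
  calc _ ≤ Real.exp (-(B * t)) * Real.exp (B * t) :=
        mul_le_mul_of_nonneg_left h1 (Real.exp_pos _).le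
    _ = 1 := by rw [← Real.exp_add]; simp

theorem positionProb_zero (j ℓ : ℕ) : positionProb M B j 0 ℓ = if ℓ = j then 1 else 0 := by
  rw [positionProb, tsum_eq_single 0 (fun n hn => by simp [hn])]
  simp [positionKernel]

/-- Differentiating the Poisson series shifts the step index by one; splitting off the first step
cancels the terms in `B` and leaves the Kolmogorov backward equation. -/
theorem hasDerivAt_positionProb (hB0 : 0 < B) (hB : ∀ k, M.srv k ≤ B) (j : ℕ) (t : ℝ) (ℓ : ℕ) :
    HasDerivAt (fun t => positionProb M B j t ℓ) (-(M.srv ℓ * positionProb M B j t ℓ)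
      + M.srv (ℓ - 1) * positionProb M B j t (ℓ - 1)) t := by
  have hK := fun ℓ => summable_exponentialSeries
    (fun n => abs_positionKernel_le hB0 hB n ℓ j) (B * t)
  have h1 : HasDerivAt (fun t : ℝ => B * t) B t := by simpa using (hasDerivAt_id t).const_mul B
  have h2 := (hasDerivAt_exponentialSeries (fun n => abs_positionKernel_le hB0 hB n ℓ j)
    (B * t)).comp t h1
  refine ((h1.neg.exp).mul h2).congr_deriv ?_
  have h3 : ∑' n, (B * t) ^ n / n.factorial * positionKernel M B (n + 1) ℓ j
      = (1 - M.srv ℓ / B) * (∑' n, (B * t) ^ n / n.factorial * positionKernel M B n ℓ j)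
        + M.srv (ℓ - 1) / B
          * ∑' n, (B * t) ^ n / n.factorial * positionKernel M B n (ℓ - 1) j := by
    rw [← tsum_mul_left, ← tsum_mul_left, ← ((hK ℓ).mul_left _).tsum_add ((hK (ℓ - 1)).mul_left _)]
    refine tsum_congr fun n => ?_
    rw [positionKernel]
    ring
  simp only [Function.comp, positionProb, Pi.neg_apply]
  rw [h3]
  field_simp
  ring

theorem continuous_positionProb (hB0 : 0 < B) (hB : ∀ k, M.srv k ≤ B) (j ℓ : ℕ) :
    Continuous fun t => positionProb M B j t ℓ :=
  continuous_iff_continuousAt.2 fun t => (hasDerivAt_positionProb hB0 hB j t ℓ).continuousAt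

/-- The backward equation, in integral form and with an arbitrary rate of fictitious jumps. -/
theorem positionProb_backward (hB0 : 0 < B) (hB : ∀ k, M.srv k ≤ B) (j : ℕ) {t : ℝ} (ht : 0 ≤ t)
    (ℓ : ℕ) {c : ℝ} (hc : M.srv ℓ ≤ c) :
    ENNReal.ofReal (positionProb M B j t ℓ)
      = ENNReal.ofReal (Real.exp (-c * t)) * ENNReal.ofReal (positionProb M B j 0 ℓ)
        + ∫⁻ u in Set.Ioc 0 t, ENNReal.ofReal (Real.exp (-c * u))
          * (ENNReal.ofReal (M.srv (ℓ - 1)) * ENNReal.ofReal (positionProb M B j (t - u) (ℓ - 1))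
            + ENNReal.ofReal (c - M.srv ℓ) * ENNReal.ofReal (positionProb M B j (t - u) ℓ)) := by
  set f : ℝ → ℝ := fun u => Real.exp (-c * u) * (M.srv (ℓ - 1) * positionProb M B j (t - u) (ℓ - 1)
    + (c - M.srv ℓ) * positionProb M B j (t - u) ℓ) with hf
  have hcont : Continuous f := by
    have h0 : Continuous fun u : ℝ => t - u := by fun_prop
    have h1 := (continuous_positionProb hB0 hB j ℓ).comp h0
    have h2 := (continuous_positionProb hB0 hB j (ℓ - 1)).comp h0
    simp only [Function.comp_def] at h1 h2
    fun_prop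
  -- Variation of constants: the integrand is an exact derivative for every `c`.
  have hderiv : ∀ u, HasDerivAt (fun u => -(Real.exp (-c * u) * positionProb M B j (t - u) ℓ))
      (f u) u := by
    intro u
    have h1 : HasDerivAt (fun u : ℝ => t - u) (-1) u := (hasDerivAt_id' u).const_sub t
    have h2 := (hasDerivAt_positionProb hB0 hB j (t - u) ℓ).comp u h1
    have h3 := ((hasDerivAt_id' u).const_mul (-c)).exp
    refine ((h3.mul h2).neg).congr_deriv ?_
    simp only [hf, Function.comp]
    ring
  have hint := intervalIntegral.integral_eq_sub_of_hasDerivAt (fun u _ => hderiv u)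
    (hcont.intervalIntegrable 0 t)
  rw [intervalIntegral.integral_of_le ht] at hint
  have hnn : ∀ u ∈ Set.Ioc 0 t, 0 ≤ f u := fun u hu => by
    have h1 := positionProb_nonneg hB0 hB j (sub_nonneg.2 hu.2) ℓ
    have h2 := positionProb_nonneg hB0 hB j (sub_nonneg.2 hu.2) (ℓ - 1)
    exact mul_nonneg (Real.exp_pos _).le (add_nonneg (mul_nonneg (M.srv_nonneg _) h2)
      (mul_nonneg (sub_nonneg.2 hc) h1))
  have hlint : ∫⁻ u in Set.Ioc 0 t, ENNReal.ofReal (Real.exp (-c * u))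
          * (ENNReal.ofReal (M.srv (ℓ - 1)) * ENNReal.ofReal (positionProb M B j (t - u) (ℓ - 1))
            + ENNReal.ofReal (c - M.srv ℓ) * ENNReal.ofReal (positionProb M B j (t - u) ℓ))
      = ENNReal.ofReal (∫ u in Set.Ioc 0 t, f u) := by
    rw [ofReal_integral_eq_lintegral_ofReal
      (hcont.integrableOn_Icc.mono_set Set.Ioc_subset_Icc_self)
      ((ae_restrict_iff' measurableSet_Ioc).2 (Filter.Eventually.of_forall hnn))]
    refine setLIntegral_congr_fun measurableSet_Ioc fun u hu => ?_
    have h1 := positionProb_nonneg hB0 hB j (sub_nonneg.2 hu.2) ℓ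
    have h2 := positionProb_nonneg hB0 hB j (sub_nonneg.2 hu.2) (ℓ - 1)
    simp only [hf]
    rw [ENNReal.ofReal_mul (Real.exp_pos _).le, ENNReal.ofReal_add
      (mul_nonneg (M.srv_nonneg _) h2) (mul_nonneg (sub_nonneg.2 hc) h1),
      ENNReal.ofReal_mul (M.srv_nonneg _), ENNReal.ofReal_mul (sub_nonneg.2 hc)]
  rw [hlint, ← ENNReal.ofReal_mul (Real.exp_pos _).le, ← ENNReal.ofReal_add
    (mul_nonneg (Real.exp_pos _).le (positionProb_nonneg hB0 hB j le_rfl ℓ))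
    (setIntegral_nonneg measurableSet_Ioc hnn), hint]
  congr 1
  simp

variable {π : EntryExit}

/-- Under first-come-first-served without exit, the law of the position of an agent does not
depend on the length of the queue. -/
theorem tsum_agentProb_position (hyz : ∀ k ℓ, π.y k ℓ = 0 ∧ π.z k ℓ = 0) (hπ : π.Feasible)
    (hreg : M.IsRegularService) (hB0 : 0 < B) (hB : ∀ k, M.srv k + M.joinRate π k ≤ B)
    {j : ℕ} (hj : 1 ≤ j) {t : ℝ} (ht : 0 ≤ t) {s : ℕ × ℕ} (hs : 1 ≤ s.2 ∧ s.2 ≤ s.1) :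
    ∑' k, (if j ≤ k then M.agentProb π M.fcfs t (.waiting s.1 s.2) (.waiting k j) else 0)
      = ENNReal.ofReal (positionProb M B j t s.2) := by
  have hq := hreg.isQueueingRule_fcfs
  have hsrv : ∀ k, M.srv k ≤ B := fun k =>
    (le_add_of_nonneg_right (M.joinRate_nonneg hπ k)).trans (hB k)
  -- Invalid pairs are absorbing, so `φ` and `ψ` must agree there at all times; both are set to 0.
  set φ : AgentState → ℝ≥0∞ := fun s => match s with
    | .waiting k ℓ => if 1 ≤ ℓ ∧ ℓ ≤ k then (if ℓ = j then 1 else 0) else 0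
    | _ => 0
  set ψ : ℝ → AgentState → ℝ≥0∞ := fun t s => match s with
    | .waiting k ℓ => if 1 ≤ ℓ ∧ ℓ ≤ k then ENNReal.ofReal (positionProb M B j t ℓ) else 0
    | _ => 0
  have key := tsum_transProb_eq_of_backward (M.jumpRate π M.fcfs) hB0
    (exitRate_le_of_bounds hyz hπ hreg hB) φ (ψ := ψ) (m := 1) (by simp) ?_ ?_ ht
    (.waiting s.1 s.2)
  · rw [tsum_agentState] at key
    simp only [φ, ψ, hs, and_self, if_true, mul_zero, add_zero] at key
    rw [← key, ENNReal.tsum_prod']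
    refine tsum_congr fun k => ?_
    rw [tsum_eq_single j (fun ℓ hℓ => by simp [hℓ])]
    simp [hj, QueueModel.agentProb]
  · intro t s ht
    match s with
    | .served => exact zero_le
    | .removed => exact zero_le
    | .waiting k ℓ =>
      simp only [ψ]
      split_ifs
      · exact ENNReal.ofReal_le_one.2 (positionProb_le_one hB0 hsrv j ht ℓ)
      · exact zero_le
  · intro t s ht
    match s with
    | .served => simp [ψ, φ, jumpRate_served]
    | .removed => simp [ψ, φ, jumpRate_removed]
    | .waiting k ℓ =>
      by_cases h : 1 ≤ ℓ ∧ ℓ ≤ k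
      · have hc : 0 ≤ M.srv k + M.joinRate π k :=
          add_nonneg (M.srv_nonneg k) (M.joinRate_nonneg hπ k)
        rw [exitRate_fcfs hyz hπ hreg h, ENNReal.toReal_ofReal hc]
        have hrow := fun u => tsum_jumpRate_fcfs_mul hyz hπ hreg h (g := ψ (t - u))
          (f := fun ℓ => ENNReal.ofReal (positionProb M B j (t - u) ℓ))
          (fun k ℓ h => by simp [ψ, h])
        simp_rw [hrow]
        simp only [φ, ψ, h, and_self, if_true, mul_zero, zero_add]
        -- The total exit rate depends on `k`, but jumps that change only the length are fictitious
        -- jumps of the position.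
        rw [positionProb_backward hB0 hsrv j ht ℓ (c := M.srv k + M.joinRate π k)
          ((M.srv_mono h.2).trans (le_add_of_nonneg_right (M.joinRate_nonneg hπ k))),
          positionProb_zero]
        congr 1
        · split_ifs <;> simp
        · simp_rw [add_sub_right_comm]
      · simp [ψ, φ, h, jumpRate_invalid M π M.fcfs h]

end Position

/-- Reweighting by a nonincreasing density preserves the sign of the mean of a nonincreasing
function with nonnegative mean. -/
theorem tsum_mul_antitone_nonneg {W f g : ℕ → ℝ} (hW : ∀ j, 0 ≤ W j) (hW0 : W 0 = 0)
    (hf : ∀ i j, 1 ≤ i → i ≤ j → f j ≤ f i) (hg : ∀ i j, 1 ≤ i → i ≤ j → g j ≤ g i)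
    (hg0 : ∀ j, 1 ≤ j → 0 ≤ g j) (hs : Summable fun j => W j * f j)
    (hs' : Summable fun j => W j * g j * f j) (h : 0 ≤ ∑' j, W j * f j) :
    0 ≤ ∑' j, W j * g j * f j := by
  by_cases hpos : ∀ j, 1 ≤ j → 0 ≤ f j
  · refine tsum_nonneg fun j => ?_
    rcases Nat.eq_zero_or_pos j with rfl | hj
    · simp [hW0]
    · exact mul_nonneg (mul_nonneg (hW j) (hg0 j hj)) (hpos j hj)
  · push Not at hpos
    classical
    -- `f` changes sign once, at `j₀`. Since `g` is nonincreasing, `f j * (g j - g j₀)` is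
    -- nonnegative on both sides of `j₀`.
    set j₀ := Nat.find hpos
    obtain ⟨h1, h2⟩ := Nat.find_spec hpos
    calc 0 ≤ g j₀ * ∑' j, W j * f j := mul_nonneg (hg0 _ h1) h
      _ = ∑' j, g j₀ * (W j * f j) := (tsum_mul_left).symm
      _ ≤ ∑' j, W j * g j * f j := by
        refine (hs.mul_left _).tsum_le_tsum (fun j => ?_) hs'
        rcases Nat.eq_zero_or_pos j with rfl | hj
        · simp [hW0]
        · have key : 0 ≤ f j * (g j - g j₀) := by
            rcases lt_or_ge j j₀ with hlt | hge
            · have h3 : 0 ≤ f j := by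
                by_contra! hneg
                exact Nat.find_min hpos hlt ⟨hj, hneg⟩
              exact mul_nonneg h3 (sub_nonneg.2 (hg _ _ hj hlt.le))
            · exact mul_nonneg_of_nonpos_of_nonpos ((hf _ _ h1 hge).trans h2.le)
                (sub_nonpos.2 (hg _ _ h1 hge))
          have := mul_nonneg (hW j) key
          linarith

/-! ### Preservation of the mean payoff along the steps -/

section PositionMass

variable (M : QueueModel) (B : ℝ)

/-- Mass of agents in each position after `n` steps of the uniformized chain, starting from `w`. -/
def positionMass (w : ℕ → ℝ) : ℕ → ℕ → ℝ
  | 0, j => w j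
  | n + 1, j => (1 - M.srv j / B) * positionMass w n j + M.srv j / B * positionMass w n (j + 1)

/-- A mass distribution over positions `j ≥ 1` whose rate of change per unit of mass,
`srv j * (W (j + 1) / W j - 1)`, is nonincreasing in the position, and for which the mean of
`V - C * j / srv j` is nonnegative. -/
structure IsImproving (W : ℕ → ℝ) : Prop where
  nonneg : ∀ j, 0 ≤ W j
  zero : W 0 = 0
  ratio : ∃ r : ℕ → ℝ, (∀ j, 1 ≤ j → 0 ≤ r j) ∧ (∀ j, 1 ≤ j → W (j + 1) = r j * W j) ∧
    ∀ j, 1 ≤ j → M.srv (j + 1) * (r (j + 1) - 1) ≤ M.srv j * (r j - 1)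
  summable : Summable W
  summable_wait : Summable fun j : ℕ => W j * (j / M.srv j)
  mean_nonneg : 0 ≤ ∑' j : ℕ, W j * (M.V - M.C * (j / M.srv j))

variable {M B}

/-- Links the two recursions: the forward form of the kernel is the one that acts on the mass
pointwise in `j`. -/
theorem hasSum_positionMass {w : ℕ → ℝ} (n j : ℕ) :
    HasSum (fun ℓ => w ℓ * positionKernel M B n ℓ j) (positionMass M B w n j) := by
  induction n generalizing j with
  | zero =>
    simp only [positionKernel, positionMass, mul_ite, mul_one, mul_zero]
    have := hasSum_single (f := fun ℓ => if ℓ = j then w ℓ else 0) j (fun ℓ hℓ => by simp [hℓ])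
    simpa using this
  | succ n ih =>
    refine (((ih j).mul_left (1 - M.srv j / B)).add
      ((ih (j + 1)).mul_left (M.srv j / B))).congr_fun fun ℓ => ?_
    rw [positionKernel_succ_forward]
    ring

/-- One step is a reweighting by a nonincreasing density `g`. It preserves the sign of the mean
payoff, and the new rates of change interlace with the old ones. -/
theorem IsImproving.step (hreg : M.IsRegularService) (hB0 : 0 < B) (hB : ∀ k, M.srv k < B)
    {W : ℕ → ℝ} (h : IsImproving M W) :
    IsImproving M fun j => (1 - M.srv j / B) * W j + M.srv j / B * W (j + 1) := by
  obtain ⟨r, hr0, hr, hu⟩ := h.ratio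
  set u : ℕ → ℝ := fun j => M.srv j * (r j - 1) with hudef
  set g : ℕ → ℝ := fun j => (B + u j) / B with hgdef
  have hsrv : ∀ j, 1 ≤ j → 0 < M.srv j := M.srv_pos
  -- `B + u j = (B - srv j) + srv j * r j`: the strict inequality `srv j < B` allows later division
  -- by `g j`, even when `r j = 0`.
  have hub : ∀ j, 1 ≤ j → 0 < B + u j := fun j hj => by
    have := mul_nonneg (hsrv j hj).le (hr0 j hj)
    simp only [hudef]
    linarith [hB j]
  have hg0 : ∀ j, 1 ≤ j → 0 < g j := fun j hj => div_pos (hub j hj) hB0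
  have huanti : ∀ i j, 1 ≤ i → i ≤ j → u j ≤ u i := by
    intro i j hi hij
    induction j, hij using Nat.le_induction with
    | base => rfl
    | succ n hn ih => exact (hu n (by omega)).trans ih
  have hganti : ∀ i j, 1 ≤ i → i ≤ j → g j ≤ g i := fun i j hi hij =>
    div_le_div_of_nonneg_right (by linarith [huanti i j hi hij]) hB0.le
  have hWg : ∀ j, (1 - M.srv j / B) * W j + M.srv j / B * W (j + 1) = W j * g j := by
    intro j
    rcases Nat.eq_zero_or_pos j with rfl | hj
    · simp [h.zero, M.srv_zero]
    · rw [hr j hj]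
      simp only [hgdef, hudef]
      field_simp
      ring
  simp only [hWg]
  have hbound : ∀ {φ : ℕ → ℝ}, (∀ j, 0 ≤ φ j) → Summable (fun j => W j * φ j) →
      Summable fun j => W j * g j * φ j := by
    intro φ hφ hs
    refine Summable.of_nonneg_of_le (fun j => ?_) (fun j => ?_) (hs.mul_left (g 1))
    · rcases Nat.eq_zero_or_pos j with rfl | hj
      · simp [h.zero]
      · exact mul_nonneg (mul_nonneg (h.nonneg j) (hg0 j hj).le) (hφ j)
    · rcases Nat.eq_zero_or_pos j with rfl | hj
      · simp [h.zero]
      · have := mul_le_mul_of_nonneg_left (hganti 1 j le_rfl hj)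
          (mul_nonneg (h.nonneg j) (hφ j))
        linarith
  have hwait0 : ∀ j : ℕ, 0 ≤ (j : ℝ) / M.srv j := fun j =>
    div_nonneg (Nat.cast_nonneg j) (M.srv_nonneg j)
  have hsum' : Summable fun j => W j * g j := by
    simpa using hbound (φ := fun _ => 1) (by simp) (by simpa using h.summable)
  have hwait' := hbound hwait0 h.summable_wait
  refine ⟨fun j => ?_, ?_, ⟨fun j => r j * g (j + 1) / g j, fun j hj => ?_, fun j hj => ?_,
    fun j hj => ?_⟩, hsum', hwait', ?_⟩
  · rcases Nat.eq_zero_or_pos j with rfl | hj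
    · simp [h.zero]
    · exact mul_nonneg (h.nonneg j) (hg0 j hj).le
  · simp [h.zero]
  · exact div_nonneg (mul_nonneg (hr0 j hj) (hg0 _ (by omega)).le) (hg0 j hj).le
  · rw [hr j hj]
    field_simp [(hg0 j hj).ne']
  -- The old value `u (j + 1)` separates the new rates at `j + 1` and `j`. The first bound holds
  -- because `g` is nonincreasing; in the second the gap is `(B - srv j) * (u j - u (j + 1)) / (B +
  -- u j)`.
  · have hmid1 : M.srv (j + 1) * (r (j + 1) * g (j + 1 + 1) / g (j + 1) - 1) ≤ u (j + 1) := by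
      refine mul_le_mul_of_nonneg_left (sub_le_sub_right ?_ 1) (hsrv _ (by omega)).le
      rw [div_le_iff₀ (hg0 _ (by omega))]
      exact mul_le_mul_of_nonneg_left (hganti _ _ (by omega) (by omega)) (hr0 _ (by omega))
    have hmid2 : u (j + 1) ≤ M.srv j * (r j * g (j + 1) / g j - 1) := by
      have hgg : g (j + 1) / g j = (B + u (j + 1)) / (B + u j) := by
        simp only [hgdef]
        rw [div_div_div_cancel_right₀ hB0.ne']
      rw [mul_div_assoc, hgg, ← sub_nonneg]
      have hμr : M.srv j * r j = u j + M.srv j := by simp only [hudef]; ring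
      have hpos := hub j hj
      have : M.srv j * (r j * ((B + u (j + 1)) / (B + u j)) - 1) - u (j + 1)
          = (B - M.srv j) * (u j - u (j + 1)) / (B + u j) := by
        rw [mul_sub, ← mul_assoc, hμr]
        field_simp
        ring
      rw [this]
      exact div_nonneg (mul_nonneg (by linarith [hB j]) (sub_nonneg.2 (hu j hj))) hpos.le
    exact hmid1.trans hmid2
  -- The payoff `V - C * (j / srv j)` is nonincreasing in `j` by `div_srv_mono`.
  · refine tsum_mul_antitone_nonneg h.nonneg h.zero (fun i j hi hij => ?_) hganti
      (fun j hj => (hg0 j hj).le) ?_ ?_ h.mean_nonneg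
    · have := mul_le_mul_of_nonneg_left (hreg.div_srv_mono hi hij) M.C_pos.le
      linarith
    · refine ((h.summable.mul_right M.V).sub (h.summable_wait.mul_right M.C)).congr fun j => ?_
      ring
    · refine ((hsum'.mul_right M.V).sub (hwait'.mul_right M.C)).congr fun j => ?_
      ring

theorem IsImproving.positionMass (hreg : M.IsRegularService) (hB0 : 0 < B)
    (hB : ∀ k, M.srv k < B) {w : ℕ → ℝ} (h : IsImproving M w) (n : ℕ) :
    IsImproving M (positionMass M B w n) := by
  induction n with
  | zero => exact h
  | succ n ih => exact ih.step hreg hB0 hB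

/-- The mean condition on an improving mass distribution, in extended nonnegative reals. -/
theorem IsImproving.tsum_ofReal_le {W : ℕ → ℝ} (h : IsImproving M W) :
    ∑' j : ℕ, ENNReal.ofReal (W j) * (ENNReal.ofReal M.C * ENNReal.ofReal (j / M.srv j))
      ≤ ∑' j, ENNReal.ofReal (W j) * ENNReal.ofReal M.V := by
  have hwait0 : ∀ j : ℕ, 0 ≤ (j : ℝ) / M.srv j := fun j =>
    div_nonneg (Nat.cast_nonneg j) (M.srv_nonneg j)
  simp_rw [mul_left_comm _ (ENNReal.ofReal M.C), ENNReal.tsum_mul_left, ENNReal.tsum_mul_right]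
  simp_rw [← ENNReal.ofReal_mul (h.nonneg _)]
  rw [← ENNReal.ofReal_tsum_of_nonneg (fun j => mul_nonneg (h.nonneg j) (hwait0 j)) h.summable_wait,
    ← ENNReal.ofReal_tsum_of_nonneg h.nonneg h.summable, ← ENNReal.ofReal_mul M.C_pos.le,
    ← ENNReal.ofReal_mul (tsum_nonneg h.nonneg)]
  refine ENNReal.ofReal_le_ofReal ?_
  have hsum : HasSum (fun j : ℕ => W j * (M.V - M.C * (j / M.srv j)))
      ((∑' j, W j) * M.V - M.C * ∑' j : ℕ, W j * (j / M.srv j)) := by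
    refine ((h.summable.hasSum.mul_right M.V).sub
      (h.summable_wait.hasSum.mul_left M.C)).congr_fun fun j => ?_
    ring
  have := h.mean_nonneg
  rw [hsum.tsum_eq] at this
  linarith

variable {π : EntryExit} {p : ℕ → ℝ}

theorem EntryExit.IsCutoffAt.feasible {K : ℕ∞} (hcut : π.IsCutoffAt K) : π.Feasible := by
  obtain ⟨h1, h2, h3, h4⟩ := hcut
  refine ⟨fun k => ?_, fun k ℓ _ => by simp [h4], fun k ℓ _ => by simp [h4],
    fun k => by simp [EntryExit.zTot, h4]⟩
  rcases lt_or_ge (k : ℕ∞) K with hlt | hge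
  · rcases (Order.add_one_le_of_lt hlt).lt_or_eq with hlt' | heq
    · have := Order.add_one_le_of_lt hlt'
      rw [add_assoc, one_add_one_eq_two] at this
      simp [h1 k this]
    · exact ⟨(h2 k heq).1.le, (h2 k heq).2⟩
  · simp [h3 k hge]

/-- Under a cutoff policy, the drift of the queue length is nonincreasing. -/
theorem joinRate_sub_srv_antitone (hreg : M.IsRegular) {K : ℕ∞} (hcut : π.IsCutoffAt K) (j : ℕ)
    (hj : 1 ≤ j) : M.joinRate π (j + 1) - M.srv (j + 1) ≤ M.joinRate π j - M.srv j := by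
  have hcut' := hcut.feasible
  obtain ⟨h1, -, h3, -⟩ := hcut
  have harr := hreg.2 (j + 1) (by omega)
  rw [Nat.add_sub_cancel] at harr
  have hmono := M.srv_mono (Nat.le_add_right j 1)
  have hx := hcut'.x_mem
  unfold QueueModel.joinRate
  rcases lt_or_ge ((j + 1 : ℕ) : ℕ∞) K with hlt | hge
  · have hxj : π.x j = 1 := by
      refine h1 j ?_
      have := Order.add_one_le_of_lt hlt
      push_cast at this
      rwa [add_assoc, one_add_one_eq_two] at this
    have := mul_le_of_le_one_right (M.arr_nonneg (j + 1)) (hx (j + 1)).2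
    rw [hxj]
    linarith
  · rw [h3 _ hge]
    have := mul_nonneg (M.arr_nonneg j) (hx j).1
    linarith

/-- By balance the ratio is `r j = joinRate j / srv j`, so the rate of change is the drift `joinRate
j - srv j`. It is defined even where the mass vanishes, beyond a finite cutoff. The mean condition
is the relaxed rationality constraint. -/
theorem isImproving_serviceFlow (hreg : M.IsRegular) {K : ℕ∞} (hcut : π.IsCutoffAt K)
    (hgen : M.Generates π p) (hp : M.RelaxedFeasible p) :
    IsImproving M fun j => p j * M.srv j := by
  have hπ := hcut.feasible
  have hyz := hcut.2.2.2
  have hs := summable_mul_srv (M := M) hp.dist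
  have hmul : ∀ j : ℕ, p j * M.srv j * ((j : ℝ) / M.srv j) = j * p j := by
    intro j
    rcases Nat.eq_zero_or_pos j with rfl | hj
    · simp
    · field_simp [(M.srv_pos j hj).ne']
  have hC := M.C_pos
  have hk : Summable fun j : ℕ => (j : ℝ) * p j := by
    refine (((hs.mul_right M.V).sub hp.ir_summable).mul_left M.C⁻¹).congr fun j => ?_
    field_simp
    ring
  refine ⟨fun j => mul_nonneg (hp.dist.1 j) (M.srv_nonneg j), by simp [M.srv_zero],
    ⟨fun j => M.joinRate π j / M.srv j, fun j _ => div_nonneg (M.joinRate_nonneg hπ j)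
      (M.srv_nonneg j), fun j hj => ?_, fun j hj => ?_⟩, hs, by simpa only [hmul] using hk, ?_⟩
  · have h1 := hgen.growthRate_mul j
    simp only [QueueModel.growthRate, QueueModel.departureRate, zTot_eq_zero hyz,
      yTot_eq_zero hyz, sub_zero, mul_one, add_zero] at h1
    have := (M.srv_pos j hj).ne'
    simp only [QueueModel.joinRate]
    field_simp
    linarith
  · rw [mul_sub, mul_sub, mul_div_cancel₀ _ (M.srv_pos j hj).ne',
      mul_div_cancel₀ _ (M.srv_pos (j + 1) (by omega)).ne', mul_one, mul_one]
    exact joinRate_sub_srv_antitone hreg hcut j hj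
  · refine hp.ir.trans_eq (tsum_congr fun j => ?_)
    linear_combination M.C * hmul j

end PositionMass

/-! ### Beliefs without information and obedience at all times -/

section NoInformation

variable {M : QueueModel} {π : EntryExit} {q : ℕ → ℕ → ℝ} {p : ℕ → ℝ} {Λ B : ℝ}

/-- A jump out of the valid triangle would need a departure or replacement ahead of the first
position, or a departure behind the last; these rates are empty sums. -/
theorem jumpRate_to_invalid {k ℓ : ℕ} (h : ¬(1 ≤ ℓ ∧ ℓ ≤ k)) (w : AgentState) :
    M.jumpRate π q w (.waiting k ℓ) = 0 := by
  match w with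
  | .served => rfl
  | .removed => rfl
  | .waiting k' ℓ' =>
    by_cases h' : 1 ≤ ℓ' ∧ ℓ' ≤ k'
    · simp only [QueueModel.jumpRate, if_pos h', reduceCtorEq, if_false, zero_add,
        AgentState.waiting.injEq, add_eq_zero, ite_eq_right_iff]
      refine ⟨⟨⟨fun h1 => ?_, fun h1 => ?_⟩, fun h1 => ?_⟩, fun h1 => ?_⟩
      · have : ℓ' = 1 := by omega
        simp [this]
      · have : ℓ' = k' := by omega
        simp [this]
      · have : ℓ' = 1 := by omega
        simp [this]
      · omega
    · exact jumpRate_invalid M π q h' _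

theorem entryBelief_eq_zero {s : ℕ × ℕ} (h : ¬(1 ≤ s.2 ∧ s.2 ≤ s.1)) :
    M.entryBelief π p s = 0 := by
  have : ¬(1 ≤ s.1 ∧ s.2 = s.1) := by omega
  simp [QueueModel.entryBelief, this]

theorem stayMass_eq_zero (hπ : π.Feasible) (hq : M.IsQueueingRule q) {s : ℕ × ℕ}
    (h : ¬(1 ≤ s.2 ∧ s.2 ≤ s.1)) (t : ℝ) : M.stayMass π q p t s = 0 := by
  refine ENNReal.tsum_eq_zero.2 fun s₀ => ?_
  by_cases h₀ : 1 ≤ s₀.2 ∧ s₀.2 ≤ s₀.1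
  · rw [QueueModel.agentProb, transProb_eq_zero _ (exitRate_ne_top hπ hq) (exitRate_invalid h)
      (jumpRate_to_invalid h), mul_zero]
    rintro heq
    simp only [AgentState.waiting.injEq] at heq
    omega
  · rw [entryBelief_eq_zero h₀, zero_mul]

theorem tsum_stayMass_le_one (hyz : ∀ k ℓ, π.y k ℓ = 0 ∧ π.z k ℓ = 0) (hπ : π.Feasible)
    (hreg : M.IsRegularService) (hB0 : 0 < B) (hB : ∀ k, M.srv k + M.joinRate π k ≤ B)
    (hp : IsDistribution p) (hE0 : M.entryRate π p ≠ 0) (hE1 : M.entryRate π p ≠ ∞)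
    {t : ℝ} (ht : 0 ≤ t) : ∑' s, M.stayMass π M.fcfs p t s ≤ 1 := by
  simp only [QueueModel.stayMass]
  rw [ENNReal.tsum_comm, ← tsum_entryBelief hπ hp hE0 hE1]
  simp_rw [ENNReal.tsum_mul_left]
  refine ENNReal.tsum_le_tsum fun s => mul_le_of_le_one_right' ?_
  rw [← tsum_transProb_eq_one (M.jumpRate π M.fcfs) hB0
    (exitRate_le_of_bounds hyz hπ hreg hB) ht (.waiting s.1 s.2), tsum_agentState]
  exact le_self_add

theorem tsum_stayMass_ne_zero (hπ : π.Feasible) (hp : IsDistribution p)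
    (hE0 : M.entryRate π p ≠ 0) (hE1 : M.entryRate π p ≠ ∞) (t : ℝ) :
    ∑' s, M.stayMass π q p t s ≠ 0 := by
  intro h
  have h1 : ∀ s, M.entryBelief π p s = 0 := by
    intro s
    have h2 := ENNReal.tsum_eq_zero.1 (ENNReal.tsum_eq_zero.1 h s) s
    refine (mul_eq_zero.1 h2).resolve_right fun h3 => ?_
    -- The event of no jump up to `t` alone has positive probability.
    have h4 : transIter (M.jumpRate π q) 1 t (.waiting s.1 s.2) (.waiting s.1 s.2) = 0 :=
      le_antisymm (h3 ▸ le_iSup (fun n => transIter (M.jumpRate π q) n t (.waiting s.1 s.2)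
        (.waiting s.1 s.2)) 1) zero_le
    simp only [transIter, if_true, add_eq_zero, ENNReal.ofReal_eq_zero] at h4
    exact absurd h4.1 (Real.exp_pos _).not_ge
  have h5 := tsum_entryBelief hπ hp hE0 hE1
  simp [h1] at h5

/-- Probability of being in the queue in position `j` a time `t` after joining. -/
def QueueModel.stayPosition (M : QueueModel) (π : EntryExit) (p : ℕ → ℝ) (t : ℝ) (j : ℕ) : ℝ≥0∞ :=
  ∑' k, if 1 ≤ j ∧ j ≤ k then M.stayMass π M.fcfs p t (k, j) else 0

theorem tsum_stayMass_mul (a : ℕ → ℝ≥0∞) (t : ℝ) :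
    ∑' s : ℕ × ℕ, (if 1 ≤ s.2 ∧ s.2 ≤ s.1 then M.stayMass π M.fcfs p t s * a s.2 else 0)
      = ∑' j, M.stayPosition π p t j * a j := by
  rw [ENNReal.tsum_prod', ENNReal.tsum_comm]
  refine tsum_congr fun j => ?_
  rw [QueueModel.stayPosition, ← ENNReal.tsum_mul_right]
  simp only [ite_mul, zero_mul]

/-- The mass in position `j` after time `t` is a Poisson mixture, over the number of uniformized
steps, of the step masses started from the service flow. This transfers step-by-step inequalities to
continuous time. -/
theorem entryRate_mul_stayPosition (hyz : ∀ k ℓ, π.y k ℓ = 0 ∧ π.z k ℓ = 0) (hπ : π.Feasible)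
    (hreg : M.IsRegularService) (hB0 : 0 < B) (hB : ∀ k, M.srv k + M.joinRate π k ≤ B)
    (hp : IsDistribution p) (hgen : M.Generates π p) (hE0 : M.entryRate π p ≠ 0)
    (hE1 : M.entryRate π p ≠ ∞) {t : ℝ} (ht : 0 ≤ t) (j : ℕ) :
    M.entryRate π p * M.stayPosition π p t j
      = ENNReal.ofReal (Real.exp (-(B * t))) * ∑' n : ℕ, ENNReal.ofReal ((B * t) ^ n / n.factorial)
        * ENNReal.ofReal (positionMass M B (fun j => p j * M.srv j) n j) := by
  have hsrv : ∀ k, M.srv k ≤ B := fun k =>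
    (le_add_of_nonneg_right (M.joinRate_nonneg hπ k)).trans (hB k)
  have hw0 : ∀ j, 0 ≤ p j * M.srv j := fun j => mul_nonneg (hp.1 j) (M.srv_nonneg j)
  rcases Nat.eq_zero_or_pos j with rfl | hj
  · have h0 : ∀ n, positionMass M B (fun j => p j * M.srv j) n 0 = 0 := by
      intro n
      induction n with
      | zero => simp [positionMass, M.srv_zero]
      | succ n ih => simp [positionMass, ih, M.srv_zero]
    simp [QueueModel.stayPosition, h0]
  · have h1 : M.stayPosition π p t j
        = ∑' s : ℕ × ℕ, M.entryBelief π p s * ENNReal.ofReal (positionProb M B j t s.2) := by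
      simp only [QueueModel.stayPosition, QueueModel.stayMass]
      have h2 : ∀ k, (if 1 ≤ j ∧ j ≤ k then ∑' s : ℕ × ℕ, M.entryBelief π p s
            * M.agentProb π M.fcfs t (.waiting s.1 s.2) (.waiting k j) else 0)
          = ∑' s : ℕ × ℕ, M.entryBelief π p s * (if j ≤ k then
              M.agentProb π M.fcfs t (.waiting s.1 s.2) (.waiting k j) else 0) := by
        intro k
        by_cases hk : j ≤ k <;> simp [hk, Nat.one_le_iff_ne_zero.1 hj]
      simp_rw [h2]
      rw [ENNReal.tsum_comm]
      refine tsum_congr fun s => ?_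
      rw [ENNReal.tsum_mul_left]
      by_cases hs : 1 ≤ s.2 ∧ s.2 ≤ s.1
      · rw [tsum_agentProb_position hyz hπ hreg hB0 hB hj ht hs]
      · rw [entryBelief_eq_zero hs, zero_mul, zero_mul]
    have h3 : ∀ s : ℕ × ℕ, M.entryRate π p * (M.entryBelief π p s
          * ENNReal.ofReal (positionProb M B j t s.2))
        = if 1 ≤ s.1 ∧ s.2 = s.1 then ENNReal.ofReal (p s.1 * M.srv s.1)
            * ENNReal.ofReal (positionProb M B j t s.1) else 0 := by
      intro s
      rw [← mul_assoc, mul_comm (M.entryRate π p), entryBelief_mul_entryRate hπ hp hE0 hE1]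
      simp only [QueueModel.immigration]
      split_ifs with h
      -- Balance converts the entry flow from length `ℓ - 1` into `p ℓ * srv ℓ`.
      · have h4 := hgen.growthRate_mul (s.1 - 1)
        rw [Nat.sub_add_cancel h.1, QueueModel.departureRate, yTot_eq_zero hyz, add_zero] at h4
        rw [QueueModel.entryFlow, if_pos h.2, zTot_eq_zero hyz, mul_zero, mul_zero, add_zero,
          mul_comm (p _), h4, h.2, mul_comm (M.srv _)]
      · exact zero_mul _
    have h5 : ∀ ℓ, ENNReal.ofReal (p ℓ * M.srv ℓ) * ENNReal.ofReal (positionProb M B j t ℓ)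
        = ENNReal.ofReal (Real.exp (-(B * t))) * ∑' n : ℕ,
          ENNReal.ofReal ((B * t) ^ n / n.factorial)
            * ENNReal.ofReal (p ℓ * M.srv ℓ * positionKernel M B n ℓ j) := by
      intro ℓ
      have hK := fun n => (positionKernel_mem hB0 hsrv n ℓ j).1
      rw [positionProb, ENNReal.ofReal_mul (Real.exp_pos _).le, ENNReal.ofReal_tsum_of_nonneg
        (fun n => mul_nonneg (by positivity) (hK n))
        (summable_exponentialSeries (fun n => abs_positionKernel_le hB0 hsrv n ℓ j) _),
        mul_left_comm, ← ENNReal.tsum_mul_left]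
      congr 1
      refine tsum_congr fun n => ?_
      rw [ENNReal.ofReal_mul (hw0 ℓ),
        ENNReal.ofReal_mul (show 0 ≤ (B * t) ^ n / (n.factorial : ℝ) by positivity), mul_left_comm]
    rw [h1, ← ENNReal.tsum_mul_left]
    simp_rw [h3]
    rw [tsum_diagonal fun ℓ => ENNReal.ofReal (p ℓ * M.srv ℓ)
      * ENNReal.ofReal (positionProb M B j t ℓ)]
    have h6 : ∑' ℓ, ENNReal.ofReal (p (ℓ + 1) * M.srv (ℓ + 1))
          * ENNReal.ofReal (positionProb M B j t (ℓ + 1))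
        = ∑' ℓ, ENNReal.ofReal (p ℓ * M.srv ℓ) * ENNReal.ofReal (positionProb M B j t ℓ) := by
      rw [tsum_eq_zero_add' (f := fun ℓ => ENNReal.ofReal (p ℓ * M.srv ℓ)
        * ENNReal.ofReal (positionProb M B j t ℓ)) ENNReal.summable]
      simp [M.srv_zero]
    rw [h6]
    simp_rw [h5]
    rw [ENNReal.tsum_mul_left, ENNReal.tsum_comm]
    simp_rw [ENNReal.tsum_mul_left]
    congr 1
    refine tsum_congr fun n => ?_
    have h7 := hasSum_positionMass (M := M) (B := B) (w := fun j => p j * M.srv j) n j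
    rw [← h7.tsum_eq, ENNReal.ofReal_tsum_of_nonneg (fun ℓ => mul_nonneg (hw0 ℓ)
      (positionKernel_mem hB0 hsrv n ℓ j).1) h7.summable]

/-- Under first-come-first-served, an agent who knows only the time since she joined is willing to
stay. -/
theorem fcfs_obedience (hreg : M.IsRegular) {K : ℕ∞} (hcut : π.IsCutoffAt K)
    (hgen : M.Generates π p) (hp : M.RelaxedFeasible p) (hB0 : 0 < B)
    (hBs : ∀ k, M.srv k < B) (hB : ∀ k, M.srv k + M.joinRate π k ≤ B)
    (hE0 : M.entryRate π p ≠ 0) (hE1 : M.entryRate π p ≠ ∞) {t : ℝ} (ht : 0 ≤ t) :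
    ∑' s, M.stayMass π M.fcfs p t s * (ENNReal.ofReal M.C * M.waitTime π M.fcfs s)
      ≤ ∑' s, M.stayMass π M.fcfs p t s * (ENNReal.ofReal M.V * M.serviceProb π M.fcfs s) := by
  have hπ := hcut.feasible
  have hyz := hcut.2.2.2
  have hq := hreg.1.isQueueingRule_fcfs
  have hpos : ∀ a : ℕ → ℝ≥0∞, M.entryRate π p * ∑' j, M.stayPosition π p t j * a j
      = ENNReal.ofReal (Real.exp (-(B * t))) * ∑' n : ℕ, ENNReal.ofReal ((B * t) ^ n / n.factorial)
        * ∑' j, ENNReal.ofReal (positionMass M B (fun j => p j * M.srv j) n j) * a j := by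
    intro a
    rw [← ENNReal.tsum_mul_left]
    simp_rw [← mul_assoc, entryRate_mul_stayPosition hyz hπ hreg.1 hB0 hB hp.dist hgen hE0 hE1 ht,
      mul_assoc, ENNReal.tsum_mul_left]
    congr 1
    simp_rw [← ENNReal.tsum_mul_left, ← ENNReal.tsum_mul_right]
    rw [ENNReal.tsum_comm]
    simp_rw [mul_assoc]
  calc ∑' s, M.stayMass π M.fcfs p t s * (ENNReal.ofReal M.C * M.waitTime π M.fcfs s)
      ≤ ∑' s : ℕ × ℕ, (if 1 ≤ s.2 ∧ s.2 ≤ s.1 then M.stayMass π M.fcfs p t s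
          * (ENNReal.ofReal M.C * ENNReal.ofReal (s.2 / M.srv s.2)) else 0) := by
        refine ENNReal.tsum_le_tsum fun s => ?_
        split_ifs with hs
        · gcongr
          exact waitTime_fcfs_le hyz hπ hreg.1 hs
        · simp [stayMass_eq_zero hπ hq hs]
    _ = ∑' j, M.stayPosition π p t j * (ENNReal.ofReal M.C * ENNReal.ofReal (j / M.srv j)) :=
        tsum_stayMass_mul (fun j => ENNReal.ofReal M.C * ENNReal.ofReal (j / M.srv j)) t
    _ ≤ ∑' j, M.stayPosition π p t j * ENNReal.ofReal M.V := by
        -- Both sides become Poisson mixtures with the same weights, so it suffices to compare them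
        -- for each number of steps.
        rw [← ENNReal.mul_le_mul_iff_right hE0 hE1, hpos, hpos]
        gcongr ENNReal.ofReal _ * ∑' n, ENNReal.ofReal _ * ?_ with n
        exact ((isImproving_serviceFlow hreg hcut hgen hp).positionMass hreg.1 hB0 hBs
          n).tsum_ofReal_le
    _ = ∑' s : ℕ × ℕ, (if 1 ≤ s.2 ∧ s.2 ≤ s.1 then M.stayMass π M.fcfs p t s
          * ENNReal.ofReal M.V else 0) := (tsum_stayMass_mul (fun _ => ENNReal.ofReal M.V) t).symm
    _ ≤ _ := by
        refine ENNReal.tsum_le_tsum fun s => ?_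
        split_ifs with hs
        · gcongr
          exact le_mul_of_one_le_right' (one_le_serviceProb_fcfs hyz hπ hreg.1 hB0 hB hs)
        · exact zero_le

theorem exists_probabilityMeasure_singleton {X : Type*} [MeasurableSpace X]
    [MeasurableSingletonClass X] {b : X → ℝ≥0∞} (hb : ∑' s, b s = 1) :
    ∃ γ : ProbabilityMeasure X, ∀ s, (γ : Measure X) {s} = b s := by
  set P : PMF X := ⟨b, hb ▸ ENNReal.summable.hasSum⟩
  refine ⟨⟨P.toMeasure, inferInstance⟩, fun s => ?_⟩
  exact P.toMeasure_apply_singleton s (measurableSet_singleton s)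

end NoInformation

end QueueDesign

end

/-! ### Implementation and optimality -/

theorem theorem3 (M : QueueDesign.QueueModel) (hreg : M.IsRegular)
    (π : QueueDesign.EntryExit) (p : ℕ → ℝ)
    (hcut : π.IsCutoff) (hgen : M.Generates π p) (hopt : M.RelaxedOptimal p) :
    ∃ I : QueueDesign.InfoRule,
      M.IsNoInfo π M.fcfs p I ∧
      (M.IsQueueingRule M.fcfs ∧ M.IsInfoRule π M.fcfs p I ∧
        ∀ t : ℝ, 0 ≤ t → M.ObedientAt π M.fcfs p I t) ∧
      M.DesignOptimal p π M.fcfs I := by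
  obtain ⟨K, hK⟩ := hcut
  obtain ⟨Λ, hΛ⟩ := hreg.arr_bounded
  obtain ⟨b, hb⟩ := M.srv_bdd
  have hb' : ∀ k, M.srv k ≤ b := fun k => hb ⟨k, rfl⟩
  have hΛ0 : 0 < Λ := M.arr_zero_pos.trans_le (hΛ 0)
  have hb0 : 0 ≤ b := (M.srv_nonneg 0).trans (hb' 0)
  have hπ := hK.feasible
  have hyz := hK.2.2.2
  have hp := hopt.1.dist
  have hq := hreg.1.isQueueingRule_fcfs
  have hjoin : ∀ k, M.joinRate π k ≤ Λ := fun k =>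
    (mul_le_of_le_one_right (M.arr_nonneg k) (hπ.x_mem k).2).trans (hΛ k)
  -- The uniformization rate `b + Λ` bounds all exit rates, and strictly exceeds every service rate
  -- because `Λ > 0`.
  have hB0 : 0 < b + Λ := by linarith
  have hBs : ∀ k, M.srv k < b + Λ := fun k => by linarith [hb' k]
  have hB : ∀ k, M.srv k + M.joinRate π k ≤ b + Λ := fun k => add_le_add (hb' k) (hjoin k)
  have hE1 := QueueDesign.entryRate_ne_top hπ hΛ hp
  have hmain : ∃ I : QueueDesign.InfoRule, M.IsNoInfo π M.fcfs p I ∧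
      M.IsInfoRule π M.fcfs p I ∧ ∀ t : ℝ, 0 ≤ t → M.ObedientAt π M.fcfs p I t := by
    by_cases hE0 : M.entryRate π p = 0
    · exact ⟨fun _ => default, fun h => absurd hE0 h, fun h => absurd hE0 h,
        fun _ _ h => absurd hE0 h⟩
    -- Negative times carry no condition; any default posterior serves there.
    have hbelief : ∀ t : ℝ, ∃ γ : ProbabilityMeasure (ℕ × ℕ), 0 ≤ t →
        ∀ s, (γ : Measure (ℕ × ℕ)) {s} = M.noInfoBelief π M.fcfs p t s := by
      intro t
      by_cases ht : 0 ≤ t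
      · have hsum : ∑' s, M.noInfoBelief π M.fcfs p t s = 1 := by
          simp only [QueueDesign.QueueModel.noInfoBelief, div_eq_mul_inv]
          rw [ENNReal.tsum_mul_right]
          refine ENNReal.mul_inv_cancel (QueueDesign.tsum_stayMass_ne_zero hπ hp hE0 hE1 t) ?_
          exact ne_top_of_le_ne_top ENNReal.one_ne_top
            (QueueDesign.tsum_stayMass_le_one hyz hπ hreg.1 hB0 hB hp hE0 hE1 ht)
        obtain ⟨γ, hγ⟩ := QueueDesign.exists_probabilityMeasure_singleton hsum
        exact ⟨γ, fun _ => hγ⟩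
      · exact ⟨default, fun h => absurd h ht⟩
    choose γ hγ using hbelief
    refine ⟨fun t => ⟨Measure.dirac (γ t), Measure.dirac.isProbabilityMeasure⟩,
      fun _ t ht => ⟨γ t, hγ t ht, rfl⟩, fun _ t ht s => ?_, fun t ht _ γ' hγ' => ?_⟩
    · rw [ProbabilityMeasure.coe_mk, lintegral_dirac'
        _ (QueueDesign.measurable_probabilityMeasure_singleton s), hγ t ht]
    · obtain rfl := QueueDesign.support_dirac_probabilityMeasure hγ'
      simp only [hγ t ht, QueueDesign.QueueModel.noInfoBelief, div_eq_mul_inv]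
      -- Conditioning on still being in the queue multiplies both sides by the same constant.
      simp_rw [mul_right_comm _ (_⁻¹), ENNReal.tsum_mul_right]
      exact mul_le_mul_left
        (QueueDesign.fcfs_obedience hreg hK hgen hopt.1 hB0 hBs hB hE0 hE1 ht) _
  obtain ⟨I, hI, hinfo, hobey⟩ := hmain
  exact ⟨I, hI, ⟨hq, hinfo, hobey⟩, ⟨hp, hπ, hq, hinfo, hgen, hobey⟩,
    fun p' _ _ _ h' => hopt.2 p' (h'.relaxedFeasible hΛ)⟩
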